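/- **Theorem (encoder privacy of the half-succinct NI-OTE).** Let $k,m,\ell,r:\mathbb N\to\mathbb N$ be functions of the security parameter $\lambda$ that are computable in polynomial time in unary (so in particular polynomially bounded), with $k(\lambda)\ge 1$ for all sufficiently large $\lambda$ (for instance $k=\Theta(\lambda)$). Put $q:=2^{r}$ (so $\log q=r$) and $n:=k\cdot\log q$, and let $\mathbf g_q:=(1,2,\dots,2^{\log q-1})$. Let $\chi=\chi(1^\lambda)$ be a distribution over $\mathbb Z$ that can be sampled in probabilistic polynomial time; a vector or matrix drawn from $\chi$ has independent entries drawn from $\chi$, reduced modulo $q$. *Scheme.* Consider the following non-interactive oblivious tensor evaluation scheme for $\mathbb Z_q^m\otimes\mathbb Z_q^\ell$. - $\mathsf{Setup}(1^\lambda)$: sample uniformly random binary matrices $\mathbf A\in\{0,1\}^{n\times m}$ and $\mathbf B\in\{0,1\}^{n\times (m\ell n)}$ and return $\mathsf{pk}:=(\mathbf A,\mathbf B)$. - $\mathsf{Hash}(\mathsf{pk},\mathbf x)$ for $\mathbf x\in\mathbb Z_q^m$: return $d:=\mathbf A\mathbf x$ and $\psi:=\mathbf x$. - $\mathsf{Enc}(\mathsf{pk},\mathbf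 y)$ for $\mathbf y\in\mathbb Z_q^\ell$: sample $\mathbf s\in\mathbb Z_q^k$ uniformly, $\hat{\mathbf E}\in\mathbb Z_q^{m\times m\ell}$ and $\mathbf E'\in\mathbb Z_q^{n\times m\ell}$ from $\chi$, and return $$E:=\mathbf C:=\mathbf A^{\top}\mathbf B\,(\mathbf I_{m\ell}\otimes\mathbf s\otimes\mathbf g_q^{\top})+\mathbf A^{\top}\mathbf E'+\hat{\mathbf E}+\mathbf I_m\otimes\mathbf y^{\top}\in\mathbb Z_q^{m\times m\ell},\qquad \phi:=\mathbf s .$$ - $\mathsf{HashEval}(\mathsf{pk},\mathbf C,\mathbf x):=\mathbf C^{\top}\mathbf x$ and $\mathsf{EncEval}(\mathsf{pk},\mathbf d,\mathbf s):=-(\mathbf I_{m\ell}\otimes\mathbf s^{\top}\otimes\mathbf g_q)\,\mathbf B^{\top}\mathbf d$. *Assumption.* Assume that the $(\chi,k,n m\ell,q)$-LWE problem is hard: for every PPT adversary $\mathcal A$ there is a negligible function $\mathsf{negl}$ such that, for every $\lambda$, if $b\in\{0,1\}$, $\mathbf s\in\mathbb Z_q^k$, $\mathbf M\in\mathbb Z_q^{nm\ell\times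 k}$ and $\mathbf u_1\in\mathbb Z_q^{nm\ell}$ are uniform, $\mathbf e\in\mathbb Z_q^{nm\ell}$ is drawn from $\chi$, and $\mathbf u_0:=\mathbf M\mathbf s+\mathbf e$, then $\left|\Pr[\mathcal A(1^\lambda,\mathbf M,\mathbf u_b)=b]-\tfrac12\right|\le\mathsf{negl}(\lambda)$. *Conclusion.* Then the scheme is encoder private: there is a PPT simulator $\mathsf{Sim}$ such that for every PPT adversary $\mathcal A=(\mathcal A_0,\mathcal A_1)$ there is a negligible function $\mathsf{negl}$ such that, for every $\lambda$, the following experiment returns $1$ with probability at distance at most $\mathsf{negl}(\lambda)$ from $\tfrac12$. Sample $\mathsf{pk}\leftarrow\mathsf{Setup}(1^\lambda)$; run $(\mathbf y,\mathsf{aux})\leftarrow\mathcal A_0(1^\lambda,\mathsf{pk})$; sample a uniform bit $b$; if $b=0$ compute $(E_0,\phi_0)\leftarrow\mathsf{Enc}(\mathsf{pk},\mathbf y)$, otherwise $E_1\leftarrow\mathsf{Sim}(1^\lambda,\mathsf{pk})$; run $b'\leftarrow\mathcal A_1(E_b,\mathsf{aux})$; return $1$ if and only if $b'=b$. Here PPT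 means computable by one (uniform) probabilistic program, whose number of steps is, for all outcomes of its coin tosses, bounded by a polynomial in the size of its input. A function $f\ge 0$ is negligible if $\lambda^{c}f(\lambda)\to0$ for every $c\in\mathbb N$. -/

import Mathlib

open MeasureTheory
open scoped Kronecker Matrix

noncomputable section

/-! ### A machine model with a step count -/

/-- The data on which machines operate: finite binary trees. -/
inductive Data : Type
  | nil : Data
  | pair : Data → Data → Data

namespace Data

/-- The number of nodes of a tree; this is the length of an input. -/
def size : Data → ℕ
  | nil => 1
  | pair a b => a.size + b.size + 1

def head : Data → Data
  | nil => nil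
  | pair a _ => a

def tail : Data → Data
  | nil => nil
  | pair _ b => b

/-- A list is encoded in the usual way by nested pairs. -/
def ofList : List Data → Data
  | [] => nil
  | a :: l => pair a (ofList l)

/-- A bit is encoded by one of two fixed trees. -/
def ofBool : Bool → Data
  | false => nil
  | true => pair nil nil

/-- The unary representation `1ⁿ` of a natural number. -/
def unary (n : ℕ) : Data := ofList (List.replicate n (ofBool true))

end Data

/-- Probabilistic programs (a "while" language). The state of a running program is one binary
tree; `coin` replaces it with a fair random bit, `fork p q` runs `p` and `q` on copies of the state
and pairs the two results, `ite p q` runs `p` if the head of the state is `nil` and `q`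
otherwise, and `loop p` repeats `p` as long as the head of the state is not `nil`. -/
inductive Prog : Type
  | skip : Prog
  | nil : Prog
  | head : Prog
  | tail : Prog
  | coin : Prog
  | seq : Prog → Prog → Prog
  | fork : Prog → Prog → Prog
  | ite : Prog → Prog → Prog
  | loop : Prog → Prog

namespace Prog

/-- `Runs P x t μ`: started on `x`, the program `P` halts after at most `t` steps whatever the
outcomes of its coin tosses, and the distribution of its result is `μ`.

An elementary operation costs as many steps as the sizes of its input and of its output together;
testing or copying the state costs its size. Hence a computation of `t` steps can be carried out
by a probabilistic Turing machine in time polynomial in `t`, and conversely. -/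
inductive Runs : Prog → Data → ℕ → PMF Data → Prop
  | skip (x : Data) : Runs skip x (x.size + x.size) (PMF.pure x)
  | nil (x : Data) : Runs nil x (x.size + Data.nil.size) (PMF.pure Data.nil)
  | head (x : Data) : Runs head x (x.size + x.head.size) (PMF.pure x.head)
  | tail (x : Data) : Runs tail x (x.size + x.tail.size) (PMF.pure x.tail)
  | coin (x : Data) : Runs coin x (x.size + (Data.ofBool true).size)
      ((PMF.uniformOfFintype Bool).map Data.ofBool)
  | seq {p q : Prog} {x : Data} {t₁ t₂ : ℕ} {μ : PMF Data} {ν : Data → PMF Data} :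
      Runs p x t₁ μ → (∀ y ∈ μ.support, Runs q y t₂ (ν y)) →
      Runs (seq p q) x (t₁ + t₂) (μ.bind ν)
  | fork {p q : Prog} {x : Data} {t₁ t₂ : ℕ} {μ ν : PMF Data} :
      Runs p x t₁ μ → Runs q x t₂ ν →
      Runs (fork p q) x (x.size + t₁ + t₂) (μ.bind fun a => ν.map fun b => Data.pair a b)
  | ite_nil {p q : Prog} {x : Data} {t : ℕ} {μ : PMF Data} :
      x.head = Data.nil → Runs p x t μ → Runs (ite p q) x (x.size + t) μ
  | ite_pair {p q : Prog} {x : Data} {t : ℕ} {μ : PMF Data} :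
      x.head ≠ Data.nil → Runs q x t μ → Runs (ite p q) x (x.size + t) μ
  | loop_stop {p : Prog} {x : Data} :
      x.head = Data.nil → Runs (loop p) x x.size (PMF.pure x)
  | loop_step {p : Prog} {x : Data} {t₁ t₂ : ℕ} {μ : PMF Data} {ν : Data → PMF Data} :
      x.head ≠ Data.nil → Runs p x t₁ μ → (∀ y ∈ μ.support, Runs (loop p) y t₂ (ν y)) →
      Runs (loop p) x (x.size + t₁ + t₂) (μ.bind ν)
  | weaken {p : Prog} {x : Data} {t t' : ℕ} {μ : PMF Data} :
      Runs p x t μ → t ≤ t' → Runs p x t' μ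

end Prog

/-- The randomized map that sends the input `inp i` to a sample of `out i` is computable in
probabilistic polynomial time: one program computes it within a number of steps that is bounded
by a polynomial in the size of the input. -/
def IsPPT {ι : Type} (inp : ι → Data) (out : ι → PMF Data) : Prop :=
  ∃ (P : Prog) (p : Polynomial ℕ), ∀ i, P.Runs (inp i) (p.eval (inp i).size) (out i)

/-! ### Encoding of mathematical objects as machine data -/

/-- A type whose elements have a fixed representation as machine data. -/
class ToData (α : Type) where
  toData : α → Data

instance : ToData Data := ⟨id⟩

instance : ToData Bool := ⟨Data.ofBool⟩

instance {α β : Type} [ToData α] [ToData β] : ToData (α × β) :=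
  ⟨fun x => Data.pair (ToData.toData x.1) (ToData.toData x.2)⟩

instance {α : Type} [ToData α] : ToData (List α) :=
  ⟨fun l => Data.ofList (l.map ToData.toData)⟩

/-- A vector is represented by the list of its entries. -/
instance {α : Type} [ToData α] {n : ℕ} : ToData (Fin n → α) :=
  ⟨fun v => ToData.toData (List.ofFn v)⟩

/-- A family indexed by a product is represented as a family of families, in the lexicographic
order of the index pairs. -/
instance {ι ι' α : Type} [ToData (ι → ι' → α)] : ToData (ι × ι' → α) :=
  ⟨fun v => ToData.toData fun i j => v (i, j)⟩

/-- A matrix is represented by the family of its rows. -/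
instance {ι ι' α : Type} [ToData (ι → ι' → α)] : ToData (Matrix ι ι' α) :=
  ⟨fun M => ToData.toData fun i j => M i j⟩

/-- A residue modulo `q` is represented by the `⌈log₂ q⌉` binary digits of its representative in
`{0, …, q - 1}`, the least significant digit first. -/
instance {q : ℕ} : ToData (ZMod q) :=
  ⟨fun x => ToData.toData ((List.range (Nat.clog 2 q)).map fun i => x.val.testBit i)⟩

/-- An integer is represented by its sign and the binary digits of its absolute value. -/
instance : ToData ℤ :=
  ⟨fun z => ToData.toData (decide (z < 0), Nat.bits z.natAbs)⟩

/-! ### Parameters, noise and negligible functions -/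

/-- The parameter `f` of the scheme is a polynomially bounded function of the security parameter
that is computable in polynomial time (both in unary). -/
def PolyTimeParam (f : ℕ → ℕ) : Prop :=
  IsPPT (fun lam : ℕ => Data.unary lam) fun lam => PMF.pure (Data.unary (f lam))

/-- A sample of `χ(1^lam)` can be drawn in probabilistic polynomial time. -/
def EfficientlySamplable (χ : ℕ → PMF ℤ) : Prop :=
  IsPPT (fun lam : ℕ => Data.unary lam) fun lam => (χ lam).map ToData.toData

/-- Vanishes faster than the inverse of any polynomial. -/
def Negligible (f : ℕ → ℝ) : Prop :=
  (∀ lam, 0 ≤ f lam) ∧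
    Asymptotics.SuperpolynomialDecay Filter.atTop (fun lam : ℕ => (lam : ℝ)) f

/-- The distribution of a family of independent samples of `μ`. -/
def iid (ι : Type) [Fintype ι] (μ : PMF ℤ) : PMF (ι → ℤ) :=
  (Measure.pi fun _ : ι => μ.toMeasure).toPMF

theorem iid_apply (ι : Type) [Fintype ι] (μ : PMF ℤ) (e : ι → ℤ) :
    iid ι μ e = ∏ i, μ (e i) := by
  classical
  rw [iid, Measure.toPMF_apply, Measure.pi_singleton]
  exact Finset.prod_congr rfl fun i _ => PMF.toMeasure_apply_singleton _ _ (by measurability)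

/-- A vector of independent samples of `μ`, reduced modulo `q`. -/
def noiseVec (q : ℕ) (ι : Type) [Fintype ι] (μ : PMF ℤ) : PMF (ι → ZMod q) :=
  (iid ι μ).map fun e i => (e i : ZMod q)

/-- A matrix of independent samples of `μ`, reduced modulo `q`. -/
def noiseMat (q : ℕ) (ι ι' : Type) [Fintype ι] [Fintype ι'] (μ : PMF ℤ) :
    PMF (Matrix ι ι' (ZMod q)) :=
  (iid (ι × ι') μ).map fun e => Matrix.of fun i j => (e (i, j) : ZMod q)

/-- The uniform distribution on the matrices over `ℤ/q`. -/
def uniformMat (q : ℕ) [NeZero q] (ι ι' : Type) [Fintype ι] [Fintype ι'] [DecidableEq ι]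
    [DecidableEq ι'] : PMF (Matrix ι ι' (ZMod q)) :=
  (PMF.uniformOfFintype (ι → ι' → ZMod q)).map Matrix.of

/-! ### Learning with errors -/

/-- The `(χ, k, m, q)`-LWE experiment with adversary `A`; it returns whether `A` guesses the bit
`b`. Here `b = false` is the case of an LWE sample and `b = true` the uniform case. -/
def lweExp (χ : ℕ → PMF ℤ) (k m q : ℕ → ℕ) [∀ lam, NeZero (q lam)]
    (A : (lam : ℕ) → Matrix (Fin (m lam)) (Fin (k lam)) (ZMod (q lam)) →
      (Fin (m lam) → ZMod (q lam)) → PMF Bool) (lam : ℕ) : PMF Bool := do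
  let b ← PMF.uniformOfFintype Bool
  let s ← PMF.uniformOfFintype (Fin (k lam) → ZMod (q lam))
  let M ← uniformMat (q lam) (Fin (m lam)) (Fin (k lam))
  let e ← noiseVec (q lam) (Fin (m lam)) (χ lam)
  let u₁ ← PMF.uniformOfFintype (Fin (m lam) → ZMod (q lam))
  let b' ← A lam M (if b then u₁ else M *ᵥ s + e)
  PMF.pure (b' == b)

/-- The `(χ, k, m, q)`-LWE problem is hard: every probabilistic polynomial time adversary, on
input `(1^lam, M, u_b)`, guesses `b` with at most negligible advantage. -/
def LWEHard (χ : ℕ → PMF ℤ) (k m q : ℕ → ℕ) [∀ lam, NeZero (q lam)] : Prop :=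
  ∀ A : (lam : ℕ) → Matrix (Fin (m lam)) (Fin (k lam)) (ZMod (q lam)) →
      (Fin (m lam) → ZMod (q lam)) → PMF Bool,
    IsPPT (ι := Σ lam, Matrix (Fin (m lam)) (Fin (k lam)) (ZMod (q lam)) ×
        (Fin (m lam) → ZMod (q lam)))
      (fun i => ToData.toData (Data.unary i.1, i.2))
      (fun i => (A i.1 i.2.1 i.2.2).map ToData.toData) →
    ∃ negl : ℕ → ℝ, Negligible negl ∧
      ∀ lam, |(lweExp χ k m q A lam true).toReal - 1 / 2| ≤ negl lam

/-! ### Non-interactive oblivious tensor evaluation -/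

/-- The algorithms of a non-interactive oblivious tensor evaluation scheme for
`ℤ_q^m ⊗ ℤ_q^ℓ`. The public keys and the encodings, which are given to adversaries, come with a
representation as machine data. -/
structure NIOTE (m ℓ q : ℕ → ℕ) where
  PK : ℕ → Type
  Digest : ℕ → Type
  HashPriv : ℕ → Type
  Encoding : ℕ → Type
  EncPriv : ℕ → Type
  [pkData : ∀ lam, ToData (PK lam)]
  [encodingData : ∀ lam, ToData (Encoding lam)]
  setup : (lam : ℕ) → PMF (PK lam)
  hash : (lam : ℕ) → PK lam → (Fin (m lam) → ZMod (q lam)) → PMF (Digest lam × HashPriv lam)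
  enc : (lam : ℕ) → PK lam → (Fin (ℓ lam) → ZMod (q lam)) → PMF (Encoding lam × EncPriv lam)
  hashEval : (lam : ℕ) → PK lam → Encoding lam → HashPriv lam →
    (Fin (m lam) × Fin (ℓ lam) → ZMod (q lam))
  encEval : (lam : ℕ) → PK lam → Digest lam → EncPriv lam →
    (Fin (m lam) × Fin (ℓ lam) → ZMod (q lam))

attribute [instance] NIOTE.pkData NIOTE.encodingData

namespace NIOTE

variable {m ℓ q : ℕ → ℕ}

/-- The encoder privacy experiment with adversary `(A₀, A₁)` and simulator `Sim`; it returns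
whether the adversary guesses the bit `b`. -/
def encExp (S : NIOTE m ℓ q) (Sim : (lam : ℕ) → S.PK lam → PMF (S.Encoding lam))
    (A₀ : (lam : ℕ) → S.PK lam → PMF ((Fin (ℓ lam) → ZMod (q lam)) × Data))
    (A₁ : (lam : ℕ) → S.Encoding lam → Data → PMF Bool) (lam : ℕ) : PMF Bool := do
  let pk ← S.setup lam
  let (y, aux) ← A₀ lam pk
  let b ← PMF.uniformOfFintype Bool
  let E ← if b then Sim lam pk else (S.enc lam pk y).map Prod.fst
  let b' ← A₁ lam E aux
  PMF.pure (b' == b)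

/-- Encoder privacy: there is a probabilistic polynomial time simulator such that no probabilistic
polynomial time adversary tells real encodings, of a vector that it chooses after seeing the public
key, from simulated ones. -/
def EncoderPrivate (S : NIOTE m ℓ q) : Prop :=
  ∃ Sim : (lam : ℕ) → S.PK lam → PMF (S.Encoding lam),
    IsPPT (ι := Σ lam, S.PK lam)
      (fun i => ToData.toData (Data.unary i.1, i.2))
      (fun i => (Sim i.1 i.2).map ToData.toData) ∧
    ∀ (A₀ : (lam : ℕ) → S.PK lam → PMF ((Fin (ℓ lam) → ZMod (q lam)) × Data))
      (A₁ : (lam : ℕ) → S.Encoding lam → Data → PMF Bool),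
      IsPPT (ι := Σ lam, S.PK lam)
        (fun i => ToData.toData (Data.unary i.1, i.2))
        (fun i => (A₀ i.1 i.2).map ToData.toData) →
      IsPPT (ι := Σ lam, S.Encoding lam × Data)
        (fun i => ToData.toData i.2)
        (fun i => (A₁ i.1 i.2.1 i.2.2).map ToData.toData) →
      ∃ negl : ℕ → ℝ, Negligible negl ∧
        ∀ lam, |1 / 2 - (S.encExp Sim A₀ A₁ lam true).toReal| ≤ negl lam

end NIOTE

/-! ### The half-succinct scheme

Throughout `q = 2 ^ r`, so that `log q = r`, and `n = k * r`. Sets of `n` indices are written as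
`Fin k × Fin r`, sets of `m * ℓ` indices as `Fin m × Fin ℓ`. -/

namespace HalfSuccinct

/-- The gadget row vector `(1, 2, …, 2 ^ (r - 1))` over `ℤ_q`. -/
def gadget (q r : ℕ) : Matrix Unit (Fin r) (ZMod q) := Matrix.of fun _ j => 2 ^ (j : ℕ)

/-- A binary matrix, regarded as a matrix over `ℤ_q` with entries in `{0, 1}`. -/
def lift (q : ℕ) {ι ι' : Type} (M : Matrix ι ι' (ZMod 2)) : Matrix ι ι' (ZMod q) :=
  M.map fun b => (b.val : ZMod q)

/-- `I_{mℓ} ⊗ s ⊗ gᵀ`. -/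
def secretMat (m ℓ k q r : ℕ) (s : Fin k → ZMod q) :
    Matrix (((Fin m × Fin ℓ) × Fin k) × Fin r) (Fin m × Fin ℓ) (ZMod q) :=
  ((1 : Matrix (Fin m × Fin ℓ) (Fin m × Fin ℓ) (ZMod q)) ⊗ₖ Matrix.replicateCol Unit s ⊗ₖ
    (gadget q r)ᵀ).submatrix id fun j => ((j, ()), ())

/-- `I_m ⊗ yᵀ`. -/
def messageMat (m ℓ q : ℕ) (y : Fin ℓ → ZMod q) :
    Matrix (Fin m) (Fin m × Fin ℓ) (ZMod q) :=
  ((1 : Matrix (Fin m) (Fin m) (ZMod q)) ⊗ₖ Matrix.replicateRow Unit y).submatrix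
    (fun i => (i, ())) id

/-- The half-succinct scheme with noise distribution `χ` and dimensions `k`, `m`, `ℓ`, modulo
`q = 2 ^ r`. -/
def scheme (χ : ℕ → PMF ℤ) (k m ℓ r : ℕ → ℕ) : NIOTE m ℓ (fun lam => 2 ^ r lam) where
  PK lam := Matrix (Fin (k lam) × Fin (r lam)) (Fin (m lam)) (ZMod 2) ×
    Matrix (Fin (k lam) × Fin (r lam))
      (((Fin (m lam) × Fin (ℓ lam)) × Fin (k lam)) × Fin (r lam)) (ZMod 2)
  Digest lam := Fin (k lam) × Fin (r lam) → ZMod (2 ^ r lam)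
  HashPriv lam := Fin (m lam) → ZMod (2 ^ r lam)
  Encoding lam := Matrix (Fin (m lam)) (Fin (m lam) × Fin (ℓ lam)) (ZMod (2 ^ r lam))
  EncPriv lam := Fin (k lam) → ZMod (2 ^ r lam)
  setup lam := do
    let A ← uniformMat 2 (Fin (k lam) × Fin (r lam)) (Fin (m lam))
    let B ← uniformMat 2 (Fin (k lam) × Fin (r lam))
      (((Fin (m lam) × Fin (ℓ lam)) × Fin (k lam)) × Fin (r lam))
    PMF.pure (A, B)
  hash lam pk x := PMF.pure (lift (2 ^ r lam) pk.1 *ᵥ x, x)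
  enc lam pk y := do
    let A := lift (2 ^ r lam) pk.1
    let B := lift (2 ^ r lam) pk.2
    let s ← PMF.uniformOfFintype (Fin (k lam) → ZMod (2 ^ r lam))
    let E ← noiseMat (2 ^ r lam) (Fin (m lam)) (Fin (m lam) × Fin (ℓ lam)) (χ lam)
    let E' ← noiseMat (2 ^ r lam) (Fin (k lam) × Fin (r lam)) (Fin (m lam) × Fin (ℓ lam)) (χ lam)
    let C := Aᵀ * B * secretMat (m lam) (ℓ lam) (k lam) (2 ^ r lam) (r lam) s + Aᵀ * E' + E +
      messageMat (m lam) (ℓ lam) (2 ^ r lam) y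
    PMF.pure (C, s)
  hashEval _ _ C x := Cᵀ *ᵥ x
  encEval lam pk d s :=
    -((secretMat (m lam) (ℓ lam) (k lam) (2 ^ r lam) (r lam) s)ᵀ * (lift (2 ^ r lam) pk.2)ᵀ) *ᵥ d

end HalfSuccinct

end

/-!
The simulator outputs a uniform matrix. A real encoding is turned into a uniform one in two stages,
both of which are reductions to the same LWE problem.

*The factor `B (I ⊗ s ⊗ gᵀ) + E'`.* The rows of the LWE matrix `X` are indexed by the entries of an
`n × mℓ` matrix. Writing the entries of `X` in binary is a bijection `binB` onto the binary matrices
`B`, and the entries of `B (I ⊗ s ⊗ gᵀ)` are those of `X s` (`binB_mul_secretMat`). Hence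
`B (I ⊗ s ⊗ gᵀ) + E'` is the LWE sample `X s + e` (`realEnc_binB`), and it may be replaced by a
uniform matrix `U`. What remains is `Aᵀ U + E + I ⊗ yᵀ`, in which `B` no longer occurs.

*The factor `Aᵀ`.* The columns of this matrix are independent, and each is of the form
`Aᵀ v + w + t` with `v` uniform, `w` noise and `t` fixed by `y`. They are made uniform one after the
other. Writing the first `m` rows of `X` in binary is a bijection `binA` onto the matrices `A`, and
`Aᵀ (s ⊗ g) = X s` for `A = binA X` (`binA_transpose_mulVec`). So if `w` is replaced by the LWE
sample `X s + e`, then the uniform `v` absorbs `s ⊗ g` and the column has the distribution it had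
before (`lweVec_bind_encCol`); if `w` is replaced by a uniform vector, then the column becomes uniform
(`uniform_bind_encCol`). Here `A` is the same for all columns and the reduction knows it, so it can
sample the other columns itself, and a hybrid argument over the `mℓ` columns applies
(`abs_hybProb_sub_le`). The machine model has fair coins only, so the index of the hybrid is uniform
below a power of two that is less than `2 mℓ + 2`; if it is not the index of a column, the reduction
tosses a coin.

The first `m` samples exist unless `k`, `r` or `ℓ` is zero. The first case is excluded for all but
finitely many security parameters, and in the others there is only one encoding.

The other half of the proof is that simulator and reductions run in polynomial time. Programs are
not written down: `PolyTime` and `PPT` are closed under the constructions in which the reductions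
are expressed, in the manner of a typed language whose contexts are the environments `ext`. All
iteration comes from `PPT.loop`, a bounded loop with an invariant that bounds the size of the state.
It yields unary arithmetic, access to and tabulation of vectors, independent sampling, and
arithmetic modulo `2 ^ r` on binary digits. That the distribution of a run is unique
(`Prog.Runs.unique`) lets programs be composed although encodings need not be injective.
-/

noncomputable section

/-! ### Running programs: output size, uniqueness, composition -/

theorem PMF.bind_congr_support {α β : Type*} {μ : PMF α} {f g : α → PMF β}
    (h : ∀ a ∈ μ.support, f a = g a) : μ.bind f = μ.bind g := by
  ext b
  rw [PMF.bind_apply, PMF.bind_apply]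
  refine tsum_congr fun a => ?_
  by_cases ha : μ a = 0
  · simp [ha]
  · rw [h a ((PMF.mem_support_iff _ _).2 ha)]

theorem Polynomial.eval_nat_mono (p : Polynomial ℕ) : Monotone fun n => p.eval n := by
  intro a b hab
  simp only [Polynomial.eval_eq_sum_range]
  gcongr

theorem Data.size_unary (n : ℕ) : (Data.unary n).size = 4 * n + 1 := by
  induction n with
  | zero => rfl
  | succ n ih =>
    have : (Data.unary (n + 1)).size = 3 + (Data.unary n).size + 1 := rfl
    omega

theorem Data.unary_succ (n : ℕ) :
    Data.unary (n + 1) = Data.pair (Data.ofBool true) (Data.unary n) := rfl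

namespace Prog

/-- Programs pay for the output they write, so the running time bounds its size. -/
theorem Runs.size_le {P : Prog} {x : Data} {t : ℕ} {μ : PMF Data} (h : Runs P x t μ) :
    ∀ y ∈ μ.support, y.size ≤ t := by
  induction h with
  | skip x => intro y hy; simp at hy; subst hy; omega
  | nil x => intro y hy; simp at hy; subst hy; omega
  | head x => intro y hy; simp at hy; subst hy; omega
  | tail x => intro y hy; simp at hy; subst hy; omega
  | coin x =>
    intro y hy
    simp only [PMF.support_map, Set.mem_image] at hy
    obtain ⟨b, -, rfl⟩ := hy
    cases b <;> simp [Data.ofBool, Data.size]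
  | seq h1 h2 ih1 ih2 =>
    intro y hy
    simp only [PMF.mem_support_bind_iff] at hy
    obtain ⟨a, ha, hy⟩ := hy
    exact (ih2 a ha y hy).trans (Nat.le_add_left _ _)
  | @fork p q x t₁ t₂ μ ν h1 h2 ih1 ih2 =>
    intro y hy
    simp only [PMF.mem_support_bind_iff, PMF.support_map, Set.mem_image] at hy
    obtain ⟨a, ha, b, hb, rfl⟩ := hy
    have h1 := ih1 a ha
    have h2 := ih2 b hb
    have h3 : 1 ≤ x.size := by cases x <;> simp [Data.size]
    simp only [Data.size]
    omega
  | ite_nil _ _ ih => intro y hy; exact (ih y hy).trans (Nat.le_add_left _ _)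
  | ite_pair _ _ ih => intro y hy; exact (ih y hy).trans (Nat.le_add_left _ _)
  | loop_stop => intro y hy; simp at hy; subst hy; omega
  | loop_step _ h1 h2 ih1 ih2 =>
    intro y hy
    simp only [PMF.mem_support_bind_iff] at hy
    obtain ⟨a, ha, hy⟩ := hy
    exact (ih2 a ha y hy).trans (Nat.le_add_left _ _)
  | weaken _ hle ih => intro y hy; exact (ih y hy).trans hle

theorem Runs.seq_inv {p q : Prog} {x : Data} {t : ℕ} {μ : PMF Data}
    (h : Runs (Prog.seq p q) x t μ) :
    ∃ t₁ t₂ μ' ν, Runs p x t₁ μ' ∧ (∀ y ∈ μ'.support, Runs q y t₂ (ν y)) ∧ μ = μ'.bind ν := by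
  generalize hP : Prog.seq p q = P at h
  induction h with
  | seq h1 h2 => cases hP; exact ⟨_, _, _, _, h1, h2, rfl⟩
  | weaken _ _ ih => exact ih hP
  | _ => cases hP

theorem Runs.fork_inv {p q : Prog} {x : Data} {t : ℕ} {μ : PMF Data}
    (h : Runs (Prog.fork p q) x t μ) :
    ∃ t₁ t₂ μ' ν, Runs p x t₁ μ' ∧ Runs q x t₂ ν ∧
      μ = μ'.bind fun a => ν.map fun b => Data.pair a b := by
  generalize hP : Prog.fork p q = P at h
  induction h with
  | fork h1 h2 => cases hP; exact ⟨_, _, _, _, h1, h2, rfl⟩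
  | weaken _ _ ih => exact ih hP
  | _ => cases hP

theorem Runs.ite_inv {p q : Prog} {x : Data} {t : ℕ} {μ : PMF Data}
    (h : Runs (Prog.ite p q) x t μ) :
    ∃ t', (x.head = Data.nil ∧ Runs p x t' μ) ∨ (x.head ≠ Data.nil ∧ Runs q x t' μ) := by
  generalize hP : Prog.ite p q = P at h
  induction h with
  | ite_nil h1 h2 => cases hP; exact ⟨_, Or.inl ⟨h1, h2⟩⟩
  | ite_pair h1 h2 => cases hP; exact ⟨_, Or.inr ⟨h1, h2⟩⟩
  | weaken _ _ ih => exact ih hP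
  | _ => cases hP

theorem Runs.loop_inv {p : Prog} {x : Data} {t : ℕ} {μ : PMF Data} (h : Runs (Prog.loop p) x t μ) :
    (x.head = Data.nil ∧ μ = PMF.pure x) ∨ (x.head ≠ Data.nil ∧ ∃ t₁ t₂ μ' ν, Runs p x t₁ μ' ∧
      (∀ y ∈ μ'.support, Runs (Prog.loop p) y t₂ (ν y)) ∧ μ = μ'.bind ν) := by
  generalize hP : Prog.loop p = P at h
  induction h with
  | loop_stop h1 => cases hP; exact Or.inl ⟨h1, rfl⟩
  | loop_step h1 h2 h3 => cases hP; exact Or.inr ⟨h1, _, _, _, _, h2, h3, rfl⟩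
  | weaken _ _ ih => exact ih hP
  | _ => cases hP

/-- The result distribution of a run is determined by the program and its input. -/
theorem Runs.unique {P : Prog} {x : Data} {t : ℕ} {μ : PMF Data} (h : Runs P x t μ) :
    ∀ {t' : ℕ} {μ' : PMF Data}, Runs P x t' μ' → μ = μ' := by
  induction h with
  | skip x =>
    intro t' μ' h'
    generalize hP : Prog.skip = P at h'
    induction h' with
    | skip => rfl
    | weaken _ _ ih => exact ih hP
    | _ => cases hP
  | nil x =>
    intro t' μ' h'
    generalize hP : Prog.nil = P at h'
    induction h' with
    | nil => rfl
    | weaken _ _ ih => exact ih hP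
    | _ => cases hP
  | head x =>
    intro t' μ' h'
    generalize hP : Prog.head = P at h'
    induction h' with
    | head => rfl
    | weaken _ _ ih => exact ih hP
    | _ => cases hP
  | tail x =>
    intro t' μ' h'
    generalize hP : Prog.tail = P at h'
    induction h' with
    | tail => rfl
    | weaken _ _ ih => exact ih hP
    | _ => cases hP
  | coin x =>
    intro t' μ' h'
    generalize hP : Prog.coin = P at h'
    induction h' with
    | coin => rfl
    | weaken _ _ ih => exact ih hP
    | _ => cases hP
  | seq h1 h2 ih1 ih2 =>
    intro t' μ' h'
    obtain ⟨_, _, μ₁, ν₁, h1', h2', rfl⟩ := h'.seq_inv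
    obtain rfl := ih1 h1'
    exact PMF.bind_congr_support fun y hy => ih2 y hy (h2' y hy)
  | fork h1 h2 ih1 ih2 =>
    intro t' μ' h'
    obtain ⟨_, _, μ₁, ν₁, h1', h2', rfl⟩ := h'.fork_inv
    obtain rfl := ih1 h1'
    obtain rfl := ih2 h2'
    rfl
  | ite_nil hx _ ih =>
    intro t' μ' h'
    obtain ⟨_, h | h⟩ := h'.ite_inv
    · exact ih h.2
    · exact absurd hx h.1
  | ite_pair hx _ ih =>
    intro t' μ' h'
    obtain ⟨_, h | h⟩ := h'.ite_inv
    · exact absurd h.1 hx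
    · exact ih h.2
  | loop_stop hx =>
    intro t' μ' h'
    obtain h | h := h'.loop_inv
    · exact h.2.symm
    · exact absurd hx h.1
  | loop_step hx h1 h2 ih1 ih2 =>
    intro t' μ' h'
    obtain h | ⟨_, _, _, μ₁, ν₁, h1', h2', rfl⟩ := h'.loop_inv
    · exact absurd h.1 hx
    · obtain rfl := ih1 h1'
      exact PMF.bind_congr_support fun y hy => ih2 y hy (h2' y hy)
  | weaken _ _ ih => exact fun h' => ih h'

/-- Runs on the encodings `e s` of random values `s` can be described by a function of the encoded
data: where `e` is not injective, uniqueness of runs makes the choice of a preimage irrelevant. -/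
theorem Runs.exists_factor {σ : Type*} {q : Prog} {t : ℕ} {μ : PMF σ} {e : σ → Data}
    {ν : σ → PMF Data} (h : ∀ s ∈ μ.support, Runs q (e s) t (ν s)) :
    ∃ ν' : Data → PMF Data, (∀ y ∈ (μ.map e).support, Runs q y t (ν' y)) ∧
      (μ.map e).bind ν' = μ.bind ν := by
  classical
  have hch : ∀ y : Data, ∃ ρ : PMF Data, ∀ s ∈ μ.support, e s = y → ρ = ν s := by
    intro y
    by_cases hy : ∃ s ∈ μ.support, e s = y
    · obtain ⟨s, hs, rfl⟩ := hy
      refine ⟨ν s, fun s' hs' he => ?_⟩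
      have h' := h s' hs'
      rw [he] at h'
      exact (h s hs).unique h'
    · exact ⟨PMF.pure y, fun s hs he => absurd ⟨s, hs, he⟩ hy⟩
  choose ν' hν' using hch
  refine ⟨ν', ?_, ?_⟩
  · intro y hy
    simp only [PMF.support_map, Set.mem_image] at hy
    obtain ⟨s, hs, rfl⟩ := hy
    rw [hν' _ s hs rfl]
    exact h s hs
  · rw [PMF.bind_map]
    exact PMF.bind_congr_support fun s hs => hν' _ s hs rfl

/-- Sequential composition, where the first program outputs encodings of random values. -/
theorem Runs.seq_map {σ : Type*} {p q : Prog} {x : Data} {t₁ t₂ : ℕ} {μ : PMF σ} {e : σ → Data}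
    {ν : σ → PMF Data} (h1 : Runs p x t₁ (μ.map e))
    (h2 : ∀ s ∈ μ.support, Runs q (e s) t₂ (ν s)) : Runs (Prog.seq p q) x (t₁ + t₂) (μ.bind ν) := by
  obtain ⟨ν', h, h'⟩ := Runs.exists_factor h2
  rw [← h']
  exact Runs.seq h1 h

/-- One round of a loop whose states are encodings of random values. -/
theorem Runs.loop_map {σ : Type*} {p : Prog} {x : Data} {t₁ t₂ : ℕ} {μ : PMF σ} {e : σ → Data}
    {ν : σ → PMF Data} (hx : x.head ≠ Data.nil) (h1 : Runs p x t₁ (μ.map e))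
    (h2 : ∀ s ∈ μ.support, Runs (Prog.loop p) (e s) t₂ (ν s)) :
    Runs (Prog.loop p) x (x.size + t₁ + t₂) (μ.bind ν) := by
  obtain ⟨ν', h, h'⟩ := Runs.exists_factor h2
  rw [← h']
  exact Runs.loop_step hx h1 h

end Prog

/-! ### Closure properties of probabilistic polynomial time -/

/-- Natural numbers that serve as sizes and indices are represented in unary. -/
instance : ToData ℕ := ⟨Data.unary⟩

/-- Indices are represented in unary. -/
instance {n : ℕ} : ToData (Fin n) := ⟨fun j => Data.unary j⟩

open ToData (toData)

theorem Data.size_head_le (x : Data) : x.head.size ≤ x.size := by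
  cases x
  · exact le_rfl
  · simp only [Data.head, Data.size]; omega

theorem Data.size_tail_le (x : Data) : x.tail.size ≤ x.size := by
  cases x
  · exact le_rfl
  · simp only [Data.tail, Data.size]; omega

namespace IsPPT

variable {ι κ : Type} {inp : ι → Data} {inp' : κ → Data}

theorem of_le {P : Prog} {out : ι → PMF Data} (p : Polynomial ℕ) {t : ι → ℕ}
    (h : ∀ i, P.Runs (inp i) (t i) (out i)) (ht : ∀ i, t i ≤ p.eval (inp i).size) :
    IsPPT inp out :=
  ⟨P, p, fun i => (h i).weaken (ht i)⟩

theorem reindex {out : κ → PMF Data} (h : IsPPT inp' out) (π : ι → κ) :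
    IsPPT (fun i => inp' (π i)) fun i => out (π i) := by
  obtain ⟨P, p, hP⟩ := h
  exact ⟨P, p, fun i => hP (π i)⟩

/-- Values computed in polynomial time have polynomially bounded size. -/
theorem exists_size_le {x : ι → Data} (h : IsPPT inp fun i => PMF.pure (x i)) :
    ∃ p : Polynomial ℕ, ∀ i, (x i).size ≤ p.eval (inp i).size := by
  obtain ⟨P, p, hP⟩ := h
  exact ⟨p, fun i => (hP i).size_le _ (by simp)⟩

theorem self : IsPPT inp fun i => PMF.pure (inp i) :=
  of_le (Polynomial.X + Polynomial.X) (fun i => Prog.Runs.skip _) fun i => by simp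

/-- Sequential composition with a deterministic first part. -/
theorem comp {π : ι → κ} (hf : IsPPT inp fun i => PMF.pure (inp' (π i)))
    {out : κ → PMF Data} (hg : IsPPT inp' out) : IsPPT inp fun i => out (π i) := by
  obtain ⟨P, p, hP⟩ := hf
  obtain ⟨Q, q, hQ⟩ := hg
  refine of_le (P := Prog.seq P Q) (p + q.comp p) (t := fun i => p.eval (inp i).size +
    q.eval (p.eval (inp i).size)) (fun i => ?_) fun i => by simp
  have h : ∀ y ∈ (PMF.pure (inp' (π i))).support,
      Q.Runs y (q.eval (p.eval (inp i).size)) (out (π i)) := by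
    intro y hy
    obtain rfl : y = inp' (π i) := by simpa using hy
    exact (hQ _).weaken (q.eval_nat_mono ((hP i).size_le _ hy))
  simpa using Prog.Runs.seq (hP i) h

theorem nil : IsPPT inp fun _ => PMF.pure Data.nil :=
  of_le (Polynomial.X + 1) (fun i => Prog.Runs.nil _) fun i => by simp [Data.size]

theorem coin : IsPPT inp fun _ => (PMF.uniformOfFintype Bool).map Data.ofBool :=
  of_le (Polynomial.X + 3) (fun i => Prog.Runs.coin _) fun i => by
    simp [Data.size, Data.ofBool]

theorem head {x : ι → Data} (h : IsPPT inp fun i => PMF.pure (x i)) :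
    IsPPT inp fun i => PMF.pure (x i).head :=
  comp (inp' := x) (π := _root_.id) h (out := fun i => PMF.pure (x i).head)
    (of_le (Polynomial.X + Polynomial.X) (fun i => Prog.Runs.head _) fun i => by
      simpa using Data.size_head_le _)

theorem tail {x : ι → Data} (h : IsPPT inp fun i => PMF.pure (x i)) :
    IsPPT inp fun i => PMF.pure (x i).tail :=
  comp (inp' := x) (π := _root_.id) h (out := fun i => PMF.pure (x i).tail)
    (of_le (Polynomial.X + Polynomial.X) (fun i => Prog.Runs.tail _) fun i => by
      simpa using Data.size_tail_le _)

theorem fork {μ ν : ι → PMF Data} (hμ : IsPPT inp μ) (hν : IsPPT inp ν) :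
    IsPPT inp fun i => (μ i).bind fun a => (ν i).map fun b => Data.pair a b := by
  obtain ⟨P, p, hP⟩ := hμ
  obtain ⟨Q, q, hQ⟩ := hν
  exact of_le (Polynomial.X + p + q) (fun i => Prog.Runs.fork (hP i) (hQ i)) fun i => by simp

theorem pair {x y : ι → Data} (hx : IsPPT inp fun i => PMF.pure (x i))
    (hy : IsPPT inp fun i => PMF.pure (y i)) :
    IsPPT inp fun i => PMF.pure (Data.pair (x i) (y i)) := by
  simpa [PMF.pure_map] using fork hx hy

theorem map_pair {x : ι → Data} {ν : ι → PMF Data} (hx : IsPPT inp fun i => PMF.pure (x i))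
    (hν : IsPPT inp ν) : IsPPT inp fun i => (ν i).map fun b => Data.pair (x i) b := by
  simpa using fork hx hν

/-- Branching on a computed bit; each branch need only be computable on the inputs that
reach it. -/
theorem cond {b : ι → Bool} (hb : IsPPT inp fun i => PMF.pure (Data.ofBool (b i)))
    {out : ι → PMF Data}
    (ht : IsPPT (ι := {i // b i = true}) (fun i => inp i) fun i => out i)
    (hf : IsPPT (ι := {i // b i = false}) (fun i => inp i) fun i => out i) :
    IsPPT inp out := by
  obtain ⟨P, p, hP⟩ := ht
  obtain ⟨Q, q, hQ⟩ := hf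
  refine comp (inp' := fun i => Data.pair (Data.ofBool (b i)) (inp i)) (π := _root_.id)
    (pair hb self) (out := out) ?_
  refine of_le (P := Prog.ite (Prog.seq Prog.tail Q) (Prog.seq Prog.tail P))
    (Polynomial.X + (Polynomial.X + Polynomial.X + (p + q))) (t := fun i =>
      (Data.pair (Data.ofBool (b i)) (inp i)).size +
      (((Data.pair (Data.ofBool (b i)) (inp i)).size + (inp i).size) +
      (p.eval (inp i).size + q.eval (inp i).size))) (fun i => ?_) fun i => ?_
  · rcases hbi : b i with _ | _
    · refine Prog.Runs.ite_nil rfl ?_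
      have := Prog.Runs.seq (q := Q) (Prog.Runs.tail (Data.pair (Data.ofBool false) (inp i)))
        (ν := fun _ => out i) (t₂ := p.eval (inp i).size + q.eval (inp i).size) (fun y hy => by
          obtain rfl : y = inp i := by simpa [Data.tail] using hy
          exact (hQ ⟨i, hbi⟩).weaken (Nat.le_add_left _ _))
      simpa [Data.tail] using this
    · refine Prog.Runs.ite_pair (by simp [Data.head, Data.ofBool]) ?_
      have := Prog.Runs.seq (q := P) (Prog.Runs.tail (Data.pair (Data.ofBool true) (inp i)))
        (ν := fun _ => out i) (t₂ := p.eval (inp i).size + q.eval (inp i).size) (fun y hy => by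
          obtain rfl : y = inp i := by simpa [Data.tail] using hy
          exact (hP ⟨i, hbi⟩).weaken (Nat.le_add_right _ _))
      simpa [Data.tail] using this
  · have hle : (inp i).size ≤ (Data.pair (Data.ofBool (b i)) (inp i)).size :=
      Data.size_tail_le (Data.pair (Data.ofBool (b i)) (inp i))
    have h1 := p.eval_nat_mono hle
    have h2 := q.eval_nat_mono hle
    simp only [Polynomial.eval_add, Polynomial.eval_X] at *
    omega

end IsPPT

/-- The environment `inp`, extended by a value of type `α i`. Environments are the typing contexts
of the calculus given by `PolyTime` and `PPT`: a binder adds a component, which `PolyTime.var`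
reads, and `PolyTime.weaken` and `PPT.weaken` move terms under a binder. -/
def ext {ι : Type} (inp : ι → Data) (α : ι → Type) [∀ i, ToData (α i)] : (Σ i, α i) → Data :=
  fun p => Data.pair (inp p.1) (toData p.2)

/-- The value `f i` can be computed from `inp i` in polynomial time. -/
def PolyTime {ι : Type} (inp : ι → Data) {α : ι → Type} [∀ i, ToData (α i)]
    (f : ∀ i, α i) : Prop :=
  IsPPT inp fun i => PMF.pure (toData (f i))

/-- A sample of `μ i` can be drawn from `inp i` in probabilistic polynomial time. -/
def PPT {ι : Type} (inp : ι → Data) {α : ι → Type} [∀ i, ToData (α i)]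
    (μ : ∀ i, PMF (α i)) : Prop :=
  IsPPT inp fun i => (μ i).map toData

/-- Runs the steps `f (n - 1)`, …, `f 0` in this order. -/
def loopM {S : Type} (f : ℕ → S → PMF S) : ℕ → S → PMF S
  | 0, s => PMF.pure s
  | n + 1, s => (f n s).bind (loopM f n)

section

variable {ι : Type} {inp : ι → Data} {α β : ι → Type} [∀ i, ToData (α i)] [∀ i, ToData (β i)]

theorem PolyTime.ppt {f : ∀ i, α i} (h : PolyTime inp f) : PPT inp fun i => PMF.pure (f i) := by
  simpa [PPT, PolyTime, PMF.pure_map] using h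

theorem PPT.polyTime {f : ∀ i, α i} (h : PPT inp fun i => PMF.pure (f i)) : PolyTime inp f := by
  simpa [PPT, PolyTime, PMF.pure_map] using h

theorem PolyTime.env : PolyTime (ext inp α) fun p => inp p.1 :=
  (IsPPT.self (inp := ext inp α)).head

theorem PolyTime.var : PolyTime (ext inp α) fun p => p.2 :=
  (IsPPT.self (inp := ext inp α)).tail

theorem PolyTime.weaken {f : ∀ i, β i} (h : PolyTime inp f) :
    PolyTime (ext inp α) fun p => f p.1 :=
  IsPPT.comp (π := Sigma.fst) PolyTime.env h

theorem PPT.weaken {μ : ∀ i, PMF (β i)} (h : PPT inp μ) :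
    PPT (ext inp α) fun p => μ p.1 :=
  IsPPT.comp (π := Sigma.fst) PolyTime.env h

/-- Sampling in sequence; the continuation runs in the environment extended by the first sample. -/
theorem PPT.bind {μ : ∀ i, PMF (α i)} (hμ : PPT inp μ) {ν : ∀ i, α i → PMF (β i)}
    (hν : PPT (ext inp α) fun p => ν p.1 p.2) : PPT inp fun i => (μ i).bind (ν i) := by
  obtain ⟨P, p, hP⟩ := IsPPT.map_pair (IsPPT.self (inp := inp)) hμ
  obtain ⟨Q, q, hQ⟩ := hν
  refine IsPPT.of_le (P := Prog.seq P Q) (p + q.comp p) (t := fun i => p.eval (inp i).size +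
    q.eval (p.eval (inp i).size)) (fun i => ?_) fun i => by simp
  rw [PMF.map_bind]
  have h1 := hP i
  simp only [PMF.map_comp] at h1
  refine Prog.Runs.seq_map h1 fun a ha => (hQ ⟨i, a⟩).weaken (q.eval_nat_mono
    (h1.size_le _ ?_))
  rw [PMF.support_map]
  exact ⟨a, ha, rfl⟩

theorem PPT.map {μ : ∀ i, PMF (α i)} (hμ : PPT inp μ) {f : ∀ i, α i → β i}
    (hf : PolyTime (ext inp α) fun p => f p.1 p.2) : PPT inp fun i => (μ i).map (f i) :=
  PPT.bind hμ (ν := fun i a => PMF.pure (f i a)) hf.ppt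

theorem PolyTime.pair {f : ∀ i, α i} {g : ∀ i, β i} (hf : PolyTime inp f)
    (hg : PolyTime inp g) : PolyTime inp fun i => (f i, g i) :=
  IsPPT.pair hf hg

theorem PolyTime.fst {f : ∀ i, α i × β i} (hf : PolyTime inp f) :
    PolyTime inp fun i => (f i).1 :=
  IsPPT.head hf

theorem PolyTime.snd {f : ∀ i, α i × β i} (hf : PolyTime inp f) :
    PolyTime inp fun i => (f i).2 :=
  IsPPT.tail hf

theorem IsPPT.const (d : Data) : IsPPT inp fun _ => PMF.pure d := by
  induction d with
  | nil => exact IsPPT.nil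
  | pair a b iha ihb => exact IsPPT.pair iha ihb

theorem PolyTime.const {α : Type} [ToData α] (a : α) : PolyTime inp fun _ => a :=
  IsPPT.const _

/-- Branching, where each branch need only be computable on the environments that reach it. -/
theorem PPT.cond_of_subtype {b : ι → Bool} (hb : PolyTime inp b) {μ : ∀ i, PMF (α i)}
    (ht : PPT (ι := {i // b i = true}) (fun i => inp i) fun i => μ i)
    (hf : PPT (ι := {i // b i = false}) (fun i => inp i) fun i => μ i) :
    PPT inp μ :=
  IsPPT.cond hb ht hf

theorem PolyTime.reindex {f : ∀ i, α i} (h : PolyTime inp f) {κ : Type} (π : κ → ι) :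
    PolyTime (fun k => inp (π k)) fun k => f (π k) :=
  IsPPT.reindex h π

theorem PPT.reindex {f : ∀ i, PMF (α i)} (h : PPT inp f) {κ : Type} (π : κ → ι) :
    PPT (fun k => inp (π k)) fun k => f (π k) :=
  IsPPT.reindex h π

theorem PPT.cond {b : ι → Bool} (hb : PolyTime inp b) {μ ν : ∀ i, PMF (α i)}
    (hμ : PPT inp μ) (hν : PPT inp ν) : PPT inp fun i => if b i then μ i else ν i := by
  refine PPT.cond_of_subtype hb ?_ ?_
  · have : ∀ i : {i // b i = true}, (if b i then μ i else ν i) = μ i := fun i => by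
      simp [i.2]
    simpa only [PPT, this] using hμ.reindex Subtype.val
  · have : ∀ i : {i // b i = false}, (if b i then μ i else ν i) = ν i := fun i => by
      simp [i.2]
    simpa only [PPT, this] using hν.reindex Subtype.val

theorem PolyTime.cond {b : ι → Bool} (hb : PolyTime inp b) {f g : ∀ i, α i}
    (hf : PolyTime inp f) (hg : PolyTime inp g) :
    PolyTime inp fun i => if b i then f i else g i := by
  refine PPT.polyTime ?_
  convert PPT.cond hb hf.ppt hg.ppt using 3
  split <;> rfl

theorem PPT.coin : PPT inp fun _ => PMF.uniformOfFintype Bool :=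
  IsPPT.coin

/-- Computability of a loop. The invariant `Inv i j s` holds for the states `s` that are reached
with `j` steps left to do; it has to bound the size of the state. -/
theorem PPT.loop {n : ι → ℕ} (hn : PolyTime inp n) {s₀ : ∀ i, α i} (hs : PolyTime inp s₀)
    {step : ∀ i, ℕ → α i → PMF (α i)} (Inv : ∀ i, ℕ → α i → Prop)
    (hstep : PPT (ι := {p : Σ p : (Σ i, Fin (n i)), α p.1 // Inv p.1.1 (p.1.2 + 1) p.2})
      (fun k => ext (ext inp fun i => Fin (n i)) (fun p => α p.1) k.1)
      fun k => step k.1.1.1 k.1.1.2 k.1.2)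
    (h0 : ∀ i, Inv i (n i) (s₀ i))
    (hpres : ∀ i j s, j < n i → Inv i (j + 1) s → ∀ s' ∈ (step i j s).support, Inv i j s')
    (B : Polynomial ℕ)
    (hB : ∀ i j s, j ≤ n i → Inv i j s → (toData s).size ≤ B.eval (inp i).size) :
    PPT inp fun i => loopM (step i) (n i) (s₀ i) := by
  -- The state of the machine loop is `pair (unary j) (pair (inp i) (toData s))`.
  let st : ∀ i, ℕ → α i → Data := fun i j s =>
    Data.pair (Data.unary j) (Data.pair (inp i) (toData s))
  let κ := {p : Σ p : (Σ i, Fin (n i)), α p.1 // Inv p.1.1 (p.1.2 + 1) p.2}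
  let inpκ : κ → Data := fun k => st k.1.1.1 (k.1.1.2 + 1) k.1.2
  have hself : IsPPT inpκ fun k => PMF.pure (inpκ k) := IsPPT.self
  have hj : IsPPT inpκ fun k => PMF.pure (Data.unary k.1.1.2) := hself.head.tail
  have hi : IsPPT inpκ fun k => PMF.pure (inp k.1.1.1) := hself.tail.head
  have hsκ : IsPPT inpκ fun k => PMF.pure (toData k.1.2) := hself.tail.tail
  have hbody : IsPPT inpκ fun k => (step k.1.1.1 k.1.1.2 k.1.2).map
      fun s' => st k.1.1.1 k.1.1.2 s' := by
    have h := IsPPT.map_pair hj (IsPPT.map_pair hi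
      (IsPPT.comp
      (inp' := fun k : κ => ext (ext inp fun i => Fin (n i)) (fun p => α p.1) k.1)
      (π := _root_.id) (IsPPT.pair (IsPPT.pair hi hj) hsκ) hstep))
    simp only [PMF.map_comp] at h
    exact h
  obtain ⟨body, pb, hb⟩ := hbody
  obtain ⟨init, pinit, hinit⟩ := IsPPT.pair hn (IsPPT.pair IsPPT.self hs)
  let S : Polynomial ℕ := pinit + Polynomial.X + B + 2
  have hsize : ∀ i j s, j ≤ n i → Inv i j s → (st i j s).size ≤ S.eval (inp i).size := by
    intro i j s hj hI
    have h1 := hB i j s hj hI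
    have h2 := (hinit i).size_le _ (by simp; rfl)
    have h3 := Data.size_unary (n i)
    have h4 := Data.size_unary j
    have h5 : (toData (n i)).size = (Data.unary (n i)).size := rfl
    simp only [st, S, Data.size, Polynomial.eval_add, Polynomial.eval_X,
      Polynomial.eval_ofNat] at *
    omega
  have hrun : ∀ i j s, j ≤ n i → Inv i j s → Prog.Runs (Prog.loop body) (st i j s)
      (j * (S.eval (inp i).size + pb.eval (S.eval (inp i).size)) + S.eval (inp i).size)
      ((loopM (step i) j s).map fun s => st i 0 s) := by
    intro i j
    induction j with
    | zero =>
      intro s hj hI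
      simp only [loopM, PMF.pure_map]
      exact (Prog.Runs.loop_stop rfl).weaken (by simpa using hsize i 0 s hj hI)
    | succ j ih =>
      intro s hj hI
      have hb' : body.Runs (st i (j + 1) s) _ ((step i j s).map fun s' => st i j s') :=
        hb ⟨⟨⟨i, ⟨j, hj⟩⟩, s⟩, hI⟩
      have hsz := hsize i (j + 1) s hj hI
      have := Prog.Runs.loop_map (by simp [st, Data.unary_succ, Data.head, Data.ofBool])
        (hb'.weaken (pb.eval_nat_mono hsz))
        (fun s' hs' => ih s' (by omega) (hpres i j s hj hI s' hs'))
      rw [loopM, PMF.map_bind]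
      refine this.weaken ?_
      nlinarith
  have hpairs : IsPPT (fun i => st i (n i) (s₀ i)) fun i =>
      (loopM (step i) (n i) (s₀ i)).map toData := by
    refine IsPPT.of_le (P := Prog.seq (Prog.loop body) (Prog.seq Prog.tail Prog.tail))
      (Polynomial.X * (S + pb.comp S) + S + (S + S + (S + S)))
      (t := fun i => (n i * (S.eval (inp i).size + pb.eval (S.eval (inp i).size)) +
        S.eval (inp i).size) + (S.eval (inp i).size + S.eval (inp i).size +
        (S.eval (inp i).size + S.eval (inp i).size)))
      (fun i => ?_) fun i => ?_
    · have h1 := hrun i (n i) (s₀ i) le_rfl (h0 i)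
      refine Prog.Runs.seq_map h1 (ν := fun s => PMF.pure (toData s)) fun s hs => ?_
      have h2 : (st i 0 s).size ≤ S.eval (inp i).size := by
        have hI : ∀ j s₁, j ≤ n i → Inv i j s₁ → s ∈ (loopM (step i) j s₁).support →
            Inv i 0 s := by
          intro j
          induction j with
          | zero =>
            intro s₁ _ hI hs
            obtain rfl : s = s₁ := by simpa [loopM] using hs
            exact hI
          | succ j ih =>
            intro s₁ hj hI hs
            simp only [loopM, PMF.mem_support_bind_iff] at hs
            obtain ⟨s₂, h2, hs⟩ := hs
            exact ih s₂ (by omega) (hpres i j s₁ hj hI s₂ h2) hs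
        exact hsize i 0 s (Nat.zero_le _) (hI _ _ le_rfl (h0 i) hs)
      have h3 := Data.size_tail_le (st i 0 s)
      have h4 := Data.size_tail_le (st i 0 s).tail
      have := Prog.Runs.seq (q := Prog.tail) ((Prog.Runs.tail (st i 0 s)).weaken
        (t' := S.eval (inp i).size + S.eval (inp i).size) (by omega))
        (ν := fun _ => PMF.pure (toData s)) (t₂ := S.eval (inp i).size + S.eval (inp i).size)
        (fun y hy => by
          obtain rfl : y = (st i 0 s).tail := by simpa using hy
          exact (Prog.Runs.tail _).weaken (by omega))
      simpa using this
    · have h1 : n i ≤ (st i (n i) (s₀ i)).size := by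
        have := Data.size_unary (n i)
        simp only [st, Data.size]
        omega
      have h2 : (inp i).size ≤ (st i (n i) (s₀ i)).size := by
        simp only [st, Data.size]
        omega
      have h3 := S.eval_nat_mono h2
      have h4 := pb.eval_nat_mono h3
      simp only [Polynomial.eval_add, Polynomial.eval_mul, Polynomial.eval_X,
        Polynomial.eval_comp] at h3 h4 ⊢
      gcongr
  exact IsPPT.comp (inp' := fun i => st i (n i) (s₀ i)) (π := _root_.id)
    (IsPPT.pair hn (IsPPT.pair IsPPT.self hs)) hpairs

end

/-! ### Loops, unary arithmetic and vectors -/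

section

variable {ι : Type} {inp : ι → Data} {α β : ι → Type} [∀ i, ToData (α i)] [∀ i, ToData (β i)]

/-- Computability of a deterministic loop; `st i j` is the state with `j` steps left to do. -/
theorem PolyTime.countdown {n : ι → ℕ} (hn : PolyTime inp n) (st : ∀ i, ℕ → α i)
    (h0 : PolyTime inp fun i => st i (n i)) {g : ∀ p : (Σ p : (Σ i, Fin (n i)), α p.1), α p.1.1}
    (hg : PolyTime (ext (ext inp fun i => Fin (n i)) fun p => α p.1) g)
    (hst : ∀ i (j : Fin (n i)), g ⟨⟨i, j⟩, st i (j + 1)⟩ = st i j)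
    (B : Polynomial ℕ) (hB : ∀ i j, j ≤ n i → (toData (st i j)).size ≤ B.eval (inp i).size) :
    PolyTime inp fun i => st i 0 := by
  have h := PPT.loop hn h0 (step := fun i j _ => PMF.pure (st i j)) (fun i j s => s = st i j)
    (by
      have h := (hg.reindex (Subtype.val (p := fun p => p.2 = st p.1.1 (p.1.2 + 1)))).ppt
      have e : ∀ k : {p : Σ p : (Σ i, Fin (n i)), α p.1 // p.2 = st p.1.1 (p.1.2 + 1)},
          g k.1 = st k.1.1.1 k.1.1.2 := by
        rintro ⟨⟨⟨i, j⟩, s⟩, hs⟩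
        obtain rfl : s = st i (j + 1) := hs
        exact hst i j
      simp only [e] at h
      exact h)
    (fun _ => rfl) (fun i j s _ _ s' hs' => by simpa using hs') B
    (fun i j s hj hs => by rw [hs]; exact hB i j hj)
  have e : ∀ i j, loopM (fun j _ => PMF.pure (st i j)) j (st i j) = PMF.pure (st i 0) := by
    intro i j
    induction j with
    | zero => rfl
    | succ j ih => rw [loopM, PMF.pure_bind, ih]
  simp only [e] at h
  exact h.polyTime

theorem Data.size_iterate_tail_le (j : ℕ) (d : Data) : (Data.tail^[j] d).size ≤ d.size := by
  induction j with
  | zero => exact le_rfl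
  | succ j ih => rw [Function.iterate_succ_apply']; exact (Data.size_tail_le _).trans ih

/-- Repeated `tail` gives truncated subtraction of unary numbers and random access to lists. -/
theorem PolyTime.iterate_tail {d : ι → Data} (hd : PolyTime inp d) {j : ι → ℕ}
    (hj : PolyTime inp j) : PolyTime inp fun i => Data.tail^[j i] (d i) := by
  obtain ⟨B, hB⟩ := IsPPT.exists_size_le hd
  have := PolyTime.countdown hj (fun i t => Data.tail^[j i - t] (d i)) (by simpa using hd)
    (g := fun p => p.2.tail) (IsPPT.tail PolyTime.var) (fun i t => by
      simp only [← Function.iterate_succ_apply' Data.tail]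
      congr 2
      omega) B (fun i t _ => (Data.size_iterate_tail_le _ _).trans (hB i))
  simpa using this

theorem Data.iterate_tail_unary (a b : ℕ) :
    Data.tail^[b] (Data.unary a) = Data.unary (a - b) := by
  induction b generalizing a with
  | zero => rfl
  | succ b ih =>
    rw [Function.iterate_succ_apply]
    cases a with
    | zero => simpa [Data.unary, Data.ofList, Data.tail] using ih 0
    | succ a => simpa [Data.unary_succ, Data.tail] using ih a

theorem PolyTime.sub {a b : ι → ℕ} (ha : PolyTime inp a) (hb : PolyTime inp b) :
    PolyTime inp fun i => a i - b i := by
  have := PolyTime.iterate_tail (d := fun i => Data.unary (a i)) ha hb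
  simp only [Data.iterate_tail_unary] at this
  exact this

theorem PolyTime.succ {a : ι → ℕ} (ha : PolyTime inp a) : PolyTime inp fun i => a i + 1 :=
  IsPPT.pair (IsPPT.const (Data.ofBool true)) ha

theorem PolyTime.pos {a : ι → ℕ} (ha : PolyTime inp a) :
    PolyTime inp fun i => decide (0 < a i) := by
  have h : PolyTime inp (α := fun _ => Data) fun i => (Data.unary (a i)).head := IsPPT.head ha
  have e : ∀ n : ℕ, (Data.unary n).head = Data.ofBool (decide (0 < n)) := by
    intro n
    cases n <;> rfl
  simp only [e] at h
  exact h

theorem PolyTime.not {a : ι → Bool} (ha : PolyTime inp a) : PolyTime inp fun i => !(a i) := by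
  have := PolyTime.cond ha (.const false) (.const true)
  convert this using 2 with i
  cases a i <;> rfl

theorem PolyTime.and {a b : ι → Bool} (ha : PolyTime inp a) (hb : PolyTime inp b) :
    PolyTime inp fun i => a i && b i := by
  have := PolyTime.cond ha hb (.const false)
  convert this using 2 with i
  cases a i <;> rfl

theorem PolyTime.or {a b : ι → Bool} (ha : PolyTime inp a) (hb : PolyTime inp b) :
    PolyTime inp fun i => a i || b i := by
  have := PolyTime.cond ha (.const true) hb
  convert this using 2 with i
  cases a i <;> rfl

theorem PolyTime.xor {a b : ι → Bool} (ha : PolyTime inp a) (hb : PolyTime inp b) :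
    PolyTime inp fun i => a i ^^ b i := by
  have := PolyTime.cond ha hb.not hb
  convert this using 2 with i
  cases a i <;> cases b i <;> rfl

theorem PolyTime.lt {a b : ι → ℕ} (ha : PolyTime inp a) (hb : PolyTime inp b) :
    PolyTime inp fun i => decide (a i < b i) := by
  have := (hb.sub ha).pos
  simpa only [Nat.sub_pos_iff_lt] using this

theorem PolyTime.le {a b : ι → ℕ} (ha : PolyTime inp a) (hb : PolyTime inp b) :
    PolyTime inp fun i => decide (a i ≤ b i) := by
  have := (hb.lt ha).not
  convert this using 2 with i
  simp [← decide_not]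

theorem PolyTime.eq {a b : ι → ℕ} (ha : PolyTime inp a) (hb : PolyTime inp b) :
    PolyTime inp fun i => decide (a i = b i) := by
  have := (ha.le hb).and (hb.le ha)
  convert this using 2 with i
  rw [← Bool.decide_and]
  exact decide_eq_decide.2 le_antisymm_iff

theorem PolyTime.exists_size_le {f : ∀ i, α i} (h : PolyTime inp f) :
    ∃ p : Polynomial ℕ, ∀ i, (toData (f i)).size ≤ p.eval (inp i).size :=
  IsPPT.exists_size_le h

theorem PolyTime.exists_le {a : ι → ℕ} (ha : PolyTime inp a) :
    ∃ p : Polynomial ℕ, ∀ i, a i ≤ p.eval (inp i).size := by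
  obtain ⟨p, hp⟩ := ha.exists_size_le
  refine ⟨p, fun i => le_trans ?_ (hp i)⟩
  rw [show (toData (a i)).size = 4 * a i + 1 from Data.size_unary _]
  omega

theorem Data.size_toData_nat (n : ℕ) : (toData n).size = 4 * n + 1 := Data.size_unary n

theorem PolyTime.add {a b : ι → ℕ} (ha : PolyTime inp a) (hb : PolyTime inp b) :
    PolyTime inp fun i => a i + b i := by
  obtain ⟨p, hp⟩ := ha.exists_le
  obtain ⟨q, hq⟩ := hb.exists_le
  have := PolyTime.countdown hb (fun i t => a i + (b i - t)) (by simpa using ha)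
    (g := fun p => p.2 + 1) (PolyTime.var.succ) (fun i t => by
      show a i + (b i - (t + 1)) + 1 = _
      omega)
    (4 * (p + q) + 1) (fun i t _ => by
      have := hp i
      have := hq i
      simp only [Data.size_toData_nat, Polynomial.eval_add, Polynomial.eval_mul,
        Polynomial.eval_ofNat, Polynomial.eval_one]
      omega)
  simpa using this

theorem PolyTime.mul {a b : ι → ℕ} (ha : PolyTime inp a) (hb : PolyTime inp b) :
    PolyTime inp fun i => a i * b i := by
  obtain ⟨p, hp⟩ := ha.exists_le
  obtain ⟨q, hq⟩ := hb.exists_le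
  have := PolyTime.countdown hb (fun i t => a i * (b i - t)) (by simpa using .const 0)
    (g := fun p => p.2 + a p.1.1) (PolyTime.var.add ha.weaken.weaken) (fun i t => by
      show a i * (b i - (t + 1)) + a i = _
      rw [← Nat.mul_succ]
      congr 1
      omega)
    (4 * (p * q) + 1) (fun i t _ => by
      have := Nat.mul_le_mul (hp i) ((Nat.sub_le _ t).trans (hq i))
      simp only [Data.size_toData_nat, Polynomial.eval_add, Polynomial.eval_mul,
        Polynomial.eval_ofNat, Polynomial.eval_one]
      omega)
  simpa using this

/-- Computability of a recursion `F i (j + 1) = g i j (F i j)`. Loops count down, so the body is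
applied to the reversed index. -/
theorem PolyTime.recursion {n : ι → ℕ} (hn : PolyTime inp n) (F : ∀ i, ℕ → α i)
    (h0 : PolyTime inp fun i => F i 0) {g : ∀ p : (Σ p : (Σ i, Fin (n i)), α p.1), α p.1.1}
    (hg : PolyTime (ext (ext inp fun i => Fin (n i)) fun p => α p.1) g)
    (hF : ∀ i (j : Fin (n i)), g ⟨⟨i, j⟩, F i j⟩ = F i (j + 1))
    (B : Polynomial ℕ) (hB : ∀ i j, j ≤ n i → (toData (F i j)).size ≤ B.eval (inp i).size) :
    PolyTime inp fun i => F i (n i) := by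
  have hrev : PolyTime (ext (ext inp fun i => Fin (n i)) fun p => α p.1)
      fun p => g ⟨⟨p.1.1, p.1.2.rev⟩, p.2⟩ := by
    refine IsPPT.comp (inp' := ext (ext inp fun i => Fin (n i)) fun p => α p.1)
      (π := fun p : (Σ p : (Σ i, Fin (n i)), α p.1) => ⟨⟨p.1.1, p.1.2.rev⟩, p.2⟩) ?_ hg
    refine IsPPT.pair (IsPPT.pair (PolyTime.env (α := fun i => Fin (n i))).weaken ?_)
      PolyTime.var
    have hj : PolyTime (ext (ext inp fun i => Fin (n i)) fun p => α p.1)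
        fun p => n p.1.1 - (p.1.2 + 1 : ℕ) :=
      hn.weaken.weaken.sub
        (PolyTime.succ (PolyTime.weaken (f := fun p : Σ i, Fin (n i) => (p.2 : ℕ)) PolyTime.var))
    have e : ∀ p : (Σ p : (Σ i, Fin (n i)), α p.1), n p.1.1 - (p.1.2 + 1 : ℕ) = p.1.2.rev :=
      fun p => (Fin.val_rev _).symm
    simp only [e] at hj
    exact hj
  have := PolyTime.countdown hn (fun i t => F i (n i - t)) (by simpa using h0) hrev
    (fun i j => by
      rw [← show ((j.rev : Fin (n i)) : ℕ) + 1 = n i - j by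
        rw [Fin.val_rev]; omega, ← hF, Fin.val_rev]) B
    (fun i j _ => hB i _ (Nat.sub_le _ _))
  simpa using this

theorem Data.iterate_tail_ofList (l : List Data) (j : ℕ) :
    (Data.tail^[j] (Data.ofList l)).head = l.getD j Data.nil := by
  induction j generalizing l with
  | zero => cases l <;> rfl
  | succ j ih =>
    rw [Function.iterate_succ_apply]
    cases l with
    | nil => simpa [Data.ofList, Data.tail] using ih []
    | cons a l => simpa [Data.ofList, Data.tail] using ih l

/-- Random access to the entries of a vector. -/
theorem PolyTime.get {n : ι → ℕ} {v : ∀ i, Fin (n i) → α i} (hv : PolyTime inp v)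
    {j : ∀ i, Fin (n i)} (hj : PolyTime inp j) : PolyTime inp fun i => v i (j i) := by
  have h : PolyTime inp (α := fun _ => Data)
      fun i => (Data.tail^[(j i : ℕ)] (toData (v i))).head :=
    IsPPT.head (PolyTime.iterate_tail (d := fun i => toData (v i)) hv (j := fun i => j i) hj)
  have e : ∀ i, (Data.tail^[(j i : ℕ)] (toData (v i))).head = toData (v i (j i)) := by
    intro i
    refine (Data.iterate_tail_ofList _ _).trans ?_
    simp [List.getD_eq_getElem?_getD]
  simp only [e] at h
  exact h

theorem PolyTime.getD {l : ι → List Bool} (hl : PolyTime inp l) {j : ι → ℕ}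
    (hj : PolyTime inp j) : PolyTime inp fun i => (l i).getD (j i) false := by
  have h : PolyTime inp (α := fun _ => Data)
      fun i => (Data.tail^[(j i : ℕ)] (toData (l i))).head :=
    IsPPT.head (PolyTime.iterate_tail (d := fun i => toData (l i)) hl hj)
  have e : ∀ i, (Data.tail^[(j i : ℕ)] (toData (l i))).head =
      toData ((l i).getD (j i) false) := by
    intro i
    refine (Data.iterate_tail_ofList _ _).trans ?_
    simp only [List.getD_eq_getElem?_getD, List.getElem?_map]
    cases (l i)[j i]? <;> rfl
  simp only [e] at h
  exact h

end

/-- Independent samples of `μ 0`, …, `μ (n - 1)`. The last one is drawn first, which is the order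
of a loop that counts down and conses its samples to a list. -/
def indep {α : Type*} : (n : ℕ) → (Fin n → PMF α) → PMF (Fin n → α)
  | 0, _ => PMF.pure Fin.elim0
  | n + 1, μ => (μ (Fin.last n)).bind fun a =>
      (indep n fun j => μ j.castSucc).map fun v => Fin.snoc (α := fun _ => α) v a

theorem indep_pure {α : Type*} (n : ℕ) (f : Fin n → α) :
    indep n (fun j => PMF.pure (f j)) = PMF.pure f := by
  induction n with
  | zero => exact congrArg PMF.pure (Subsingleton.elim _ _)
  | succ n ih =>
    rw [indep, PMF.pure_bind, ih, PMF.pure_map]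
    exact congrArg PMF.pure (Fin.snoc_init_self f)

/-- A loop that conses independent samples to a list computes `indep`. -/
theorem loopM_cons {α : Type} (n : ℕ) (μ : Fin n → PMF α) {f : ℕ → List α → PMF (List α)}
    (hf : ∀ (j : Fin n) l, f j l = (μ j).map fun a => a :: l) (l : List α) :
    loopM f n l = (indep n μ).map fun v => List.ofFn v ++ l := by
  induction n generalizing l with
  | zero => simp [loopM, indep, PMF.pure_map]
  | succ n ih =>
    rw [loopM, indep, PMF.map_bind, show f n l = _ from hf (Fin.last n) l, PMF.bind_map]
    congr 1
    funext a
    rw [Function.comp_apply, ih (fun j => μ j.castSucc) (fun j l => hf j.castSucc l),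
      PMF.map_comp]
    congr 1
    funext v
    show _ = List.ofFn (Fin.snoc (α := fun _ => α) v a) ++ l
    rw [List.ofFn_succ_last]
    simp

section

variable {ι : Type} {inp : ι → Data} {α : ι → Type} [∀ i, ToData (α i)]

theorem PPT.exists_size_le {μ : ∀ i, PMF (α i)} (h : PPT inp μ) :
    ∃ p : Polynomial ℕ, ∀ i, ∀ a ∈ (μ i).support, (toData a).size ≤ p.eval (inp i).size := by
  obtain ⟨P, p, hP⟩ := h
  refine ⟨p, fun i a ha => (hP i).size_le _ ?_⟩
  rw [PMF.support_map]
  exact ⟨a, ha, rfl⟩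

theorem Data.size_toData_list_le {α : Type} [ToData α] (l : List α) (b : ℕ)
    (h : ∀ a ∈ l, (toData a).size ≤ b) : (toData l).size ≤ l.length * (b + 1) + 1 := by
  induction l with
  | nil => simp [toData, Data.ofList, Data.size]
  | cons a l ih =>
    have h1 := h a (by simp)
    have h2 := ih fun a ha => h a (by simp [ha])
    have h3 : (toData (a :: l)).size = (toData a).size + (toData l).size + 1 := rfl
    rw [h3, List.length_cons]
    linarith

theorem PPT.indep {n : ι → ℕ} (hn : PolyTime inp n) {μ : ∀ i, Fin (n i) → PMF (α i)}
    (hμ : PPT (ext inp fun i => Fin (n i)) fun p => μ p.1 p.2) :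
    PPT inp fun i => indep (n i) (μ i) := by
  classical
  obtain ⟨p, hp⟩ := hμ.exists_size_le
  obtain ⟨q, hq⟩ := hn.exists_size_le
  let Q : Polynomial ℕ := p.comp (Polynomial.X + q + 1)
  have hQ : ∀ i j, ∀ a ∈ (μ i j).support, (toData a).size ≤ Q.eval (inp i).size := by
    intro i j a ha
    refine (hp ⟨i, j⟩ a ha).trans ?_
    simp only [Q, Polynomial.eval_comp]
    apply p.eval_nat_mono
    have h1 := hq i
    have h2 : (toData j).size = 4 * (j : ℕ) + 1 := Data.size_unary _
    rw [Data.size_toData_nat] at h1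
    simp only [ext, Data.size, Polynomial.eval_add, Polynomial.eval_X, Polynomial.eval_one]
    omega
  let step : ∀ i, ℕ → List (α i) → PMF (List (α i)) := fun i j l =>
    if h : j < n i then (μ i ⟨j, h⟩).map fun a => a :: l else PMF.pure l
  have hstep : PPT (ext (ext inp fun i => Fin (n i)) fun p => List (α p.1))
      fun k => step k.1.1 k.1.2 k.2 := by
    have htail : PolyTime (ext (ext (ext inp fun i => Fin (n i)) fun p => List (α p.1))
        fun k => α k.1.1) fun k => k.1.2 := PolyTime.weaken PolyTime.var
    have hc : PolyTime (ext (ext (ext inp fun i => Fin (n i)) fun p => List (α p.1))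
        fun k => α k.1.1) fun k => k.2 :: k.1.2 := IsPPT.pair PolyTime.var htail
    have h : PPT (ext (ext inp fun i => Fin (n i)) fun p => List (α p.1))
        fun k => (μ k.1.1 k.1.2).map fun a => a :: k.2 :=
      PPT.map (inp := ext (ext inp fun i => Fin (n i)) fun p => List (α p.1))
        (α := fun k => α k.1.1) (β := fun k => List (α k.1.1)) (μ := fun k => μ k.1.1 k.1.2)
        hμ.weaken (f := fun k a => a :: k.2) hc
    simpa [step] using h
  have h := PPT.loop hn (α := fun i => List (α i)) (s₀ := fun i => []) IsPPT.nil
    (step := step)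
    -- With `j` samples to go, the list holds the `n i - j` last ones, each of bounded size.
    (fun i j l => l.length + j = n i ∧ ∀ a ∈ l, (toData a).size ≤ Q.eval (inp i).size)
    (hstep.reindex Subtype.val) (fun i => by simp)
    (fun i j l hj hl l' hl' => by
      simp only [step, hj, dif_pos, PMF.support_map, Set.mem_image] at hl'
      obtain ⟨a, ha, rfl⟩ := hl'
      refine ⟨by simp only [List.length_cons]; omega, fun b hb => ?_⟩
      rcases List.mem_cons.1 hb with rfl | hb
      · exact hQ _ _ _ ha
      · exact hl.2 _ hb)
    (q * (Q + 1) + 1) (fun i j l hj hl => by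
      refine (Data.size_toData_list_le l _ hl.2).trans ?_
      have h1 := hq i
      rw [Data.size_toData_nat] at h1
      simp only [Polynomial.eval_add, Polynomial.eval_mul, Polynomial.eval_one]
      gcongr
      omega)
  have e : ∀ i, loopM (step i) (n i) [] = (_root_.indep (n i) (μ i)).map List.ofFn := by
    intro i
    rw [loopM_cons (n i) (μ i) (fun j l => by simp [step])]
    simp
  simp only [PPT, e, PMF.map_comp] at h
  exact h

/-- Tabulation: a vector can be computed if its entries can. -/
theorem PolyTime.vec {n : ι → ℕ} (hn : PolyTime inp n) {f : ∀ i, Fin (n i) → α i}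
    (hf : PolyTime (ext inp fun i => Fin (n i)) fun p => f p.1 p.2) : PolyTime inp f := by
  have := PPT.indep hn (μ := fun i j => PMF.pure (f i j)) hf.ppt
  simp only [indep_pure] at this
  exact this.polyTime

end

/-! ### Arithmetic modulo a power of two -/

/-- The residue `x` as a bit vector. -/
def toBitVec {r : ℕ} (x : ZMod (2 ^ r)) : BitVec r := BitVec.ofNat r x.val

theorem getLsbD_toBitVec {r : ℕ} (x : ZMod (2 ^ r)) (j : ℕ) :
    (toBitVec x).getLsbD j = x.val.testBit j := by
  rw [toBitVec, BitVec.getLsbD_ofNat, ← Nat.testBit_mod_two_pow,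
    Nat.mod_eq_of_lt (ZMod.val_lt x)]

theorem toBitVec_add {r : ℕ} (x y : ZMod (2 ^ r)) :
    toBitVec (x + y) = toBitVec x + toBitVec y := by
  apply BitVec.eq_of_toNat_eq
  simp [toBitVec, ZMod.val_add]

theorem toBitVec_neg {r : ℕ} (x : ZMod (2 ^ r)) : toBitVec (-x) = -toBitVec x := by
  apply BitVec.eq_of_toNat_eq
  simp [toBitVec, ZMod.neg_val', Nat.mod_eq_of_lt (ZMod.val_lt x)]

/-- Residues are represented like the vectors of their binary digits, so that the results on vectors
speak about the digits of residues. -/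
theorem toData_zmod {q w : ℕ} (h : Nat.clog 2 q = w) (x : ZMod q) :
    toData x = toData fun j : Fin w => x.val.testBit j := by
  subst h
  refine congrArg (toData (α := List Bool)) ?_
  rw [List.ofFn_eq_map, ← List.map_coe_finRange_eq_range, List.map_map]
  rfl

theorem clog_two_pow (r : ℕ) : Nat.clog 2 (2 ^ r) = r := Nat.clog_pow 2 r one_lt_two

theorem clog_two_two : Nat.clog 2 2 = 1 := clog_two_pow 1

theorem size_toData_zmod_le {r : ℕ} (x : ZMod (2 ^ r)) : (toData x).size ≤ 4 * r + 1 := by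
  refine (Data.size_toData_list_le (α := Bool) _ 3 fun b _ => ?_).trans ?_
  · cases b <;> simp [toData, Data.ofBool, Data.size]
  · simp [mul_comm]

theorem zmod_ext {r : ℕ} {x y : ZMod (2 ^ r)}
    (h : ∀ j : Fin r, x.val.testBit j = y.val.testBit j) : x = y := by
  apply ZMod.val_injective
  refine Nat.eq_of_testBit_eq fun j => ?_
  by_cases hj : j < r
  · exact h ⟨j, hj⟩
  · have hle : 2 ^ r ≤ 2 ^ j := Nat.pow_le_pow_right two_pos (not_lt.1 hj)
    rw [Nat.testBit_lt_two_pow ((ZMod.val_lt x).trans_le hle),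
      Nat.testBit_lt_two_pow ((ZMod.val_lt y).trans_le hle)]

/-- The binary digits of a residue modulo `2 ^ r`. -/
def digits (r : ℕ) : ZMod (2 ^ r) ≃ (Fin r → Bool) :=
  Equiv.ofBijective (fun x j => x.val.testBit j) <|
    (Fintype.bijective_iff_injective_and_card _).2
      ⟨fun _ _ h => zmod_ext fun j => congrFun h j, by simp [ZMod.card]⟩

section

variable {ι : Type} {inp : ι → Data} {q w r : ι → ℕ}

theorem PolyTime.testBit (hq : ∀ i, Nat.clog 2 (q i) = w i) {x : ∀ i, ZMod (q i)}
    (hx : PolyTime inp x) {j : ι → ℕ} (hj : PolyTime inp j) (hlt : ∀ i, j i < w i) :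
    PolyTime inp fun i => (x i).val.testBit (j i) := by
  have h : PolyTime inp (α := fun i => Fin (w i) → Bool) fun i j => (x i).val.testBit j := by
    simp only [PolyTime, toData_zmod (hq _)] at hx
    exact hx
  exact h.get (j := fun i => ⟨j i, hlt i⟩) hj

theorem PolyTime.zmod_of_testBit (hq : ∀ i, Nat.clog 2 (q i) = w i) (hw : PolyTime inp w)
    {x : ∀ i, ZMod (q i)}
    (hx : PolyTime (ext inp fun i => Fin (w i)) fun p => (x p.1).val.testBit p.2) :
    PolyTime inp x := by
  have h : PolyTime inp (α := fun i => Fin (w i) → Bool) fun i j => (x i).val.testBit j :=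
    PolyTime.vec hw hx
  simp only [PolyTime, toData_zmod (hq _)]
  exact h

theorem PolyTime.bool_recursion {n : ι → ℕ} (hn : PolyTime inp n) (F : ι → ℕ → Bool)
    (h0 : PolyTime inp fun i => F i 0) {g : (Σ _ : (Σ i, Fin (n i)), Bool) → Bool}
    (hg : PolyTime (ext (ext inp fun i => Fin (n i)) fun _ => Bool) g)
    (hF : ∀ i (j : Fin (n i)), g ⟨⟨i, j⟩, F i j⟩ = F i (j + 1)) :
    PolyTime inp fun i => F i (n i) :=
  PolyTime.recursion hn F h0 hg hF 3 fun i j _ => by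
    cases F i j <;> simp [toData, Data.ofBool, Data.size]

/-- Ripple-carry addition: the sum has the digits `x j ^^ y j ^^ c j`, where the carries `c j` are
given by a recursion on bits. -/
theorem PolyTime.zmod_add (hr : PolyTime inp r) {x y : ∀ i, ZMod (2 ^ r i)}
    (hx : PolyTime inp x) (hy : PolyTime inp y) : PolyTime inp fun i => x i + y i := by
  refine PolyTime.zmod_of_testBit (fun i => clog_two_pow _) hr ?_
  have e : ∀ p : Σ i, Fin (r i), (x p.1 + y p.1).val.testBit p.2 =
      ((x p.1).val.testBit p.2 ^^ ((y p.1).val.testBit p.2 ^^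
        BitVec.carry p.2 (toBitVec (x p.1)) (toBitVec (y p.1)) false)) := by
    intro p
    rw [← getLsbD_toBitVec, toBitVec_add, BitVec.getLsbD_add p.2.2, getLsbD_toBitVec,
      getLsbD_toBitVec]
  simp only [e]
  have hv : PolyTime (ext inp fun i => Fin (r i)) fun p => (p.2 : ℕ) := PolyTime.var
  refine .xor (.testBit (fun _ => clog_two_pow _) hx.weaken hv fun p => p.2.2)
    (.xor (.testBit (fun _ => clog_two_pow _) hy.weaken hv fun p => p.2.2) ?_)
  have hj : PolyTime (ext (ext (ext inp fun i => Fin (r i)) fun p => Fin p.2) fun _ => Bool)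
    fun p => (p.1.2 : ℕ) :=
      PolyTime.weaken (f := fun p : Σ p : (Σ i, Fin (r i)), Fin p.2 => (p.2 : ℕ)) PolyTime.var
  have hlt : ∀ p : Σ _ : Σ p : (Σ i, Fin (r i)), Fin p.2, Bool, (p.1.2 : ℕ) < r p.1.1.1 :=
    fun p => p.1.2.2.trans p.1.1.2.2
  have h1 := PolyTime.testBit (fun _ => clog_two_pow _) hx.weaken.weaken.weaken hj hlt
  have h2 := PolyTime.testBit (fun _ => clog_two_pow _) hy.weaken.weaken.weaken hj hlt
  refine PolyTime.bool_recursion hv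
    (fun p j => BitVec.carry j (toBitVec (x p.1)) (toBitVec (y p.1)) false)
    (by simpa using .const false)
    ((h1.and h2).or ((h1.and PolyTime.var).or (h2.and PolyTime.var))) fun p j => ?_
  rw [BitVec.carry_succ, getLsbD_toBitVec, getLsbD_toBitVec]
  simp only [Bool.atLeastTwo, Bool.or_assoc]

/-- Digit `j` of `-x` is that of `x`, flipped if some lower digit of `x` is nonzero. -/
theorem PolyTime.zmod_neg (hr : PolyTime inp r) {x : ∀ i, ZMod (2 ^ r i)}
    (hx : PolyTime inp x) : PolyTime inp fun i => -x i := by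
  refine PolyTime.zmod_of_testBit (fun i => clog_two_pow _) hr ?_
  have e : ∀ p : Σ i, Fin (r i), (-x p.1).val.testBit p.2 =
      ((x p.1).val.testBit p.2 ^^ decide (∃ j < (p.2 : ℕ), (x p.1).val.testBit j = true)) := by
    intro p
    rw [← getLsbD_toBitVec, toBitVec_neg, BitVec.getLsbD_neg]
    simp only [getLsbD_toBitVec, Fin.is_lt, decide_true, Bool.true_and]
  simp only [e]
  have hv : PolyTime (ext inp fun i => Fin (r i)) fun p => (p.2 : ℕ) := PolyTime.var
  refine .xor (.testBit (fun _ => clog_two_pow _) hx.weaken hv fun p => p.2.2) ?_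
  have hj : PolyTime (ext (ext (ext inp fun i => Fin (r i)) fun p => Fin p.2) fun _ => Bool)
    fun p => (p.1.2 : ℕ) :=
      PolyTime.weaken (f := fun p : Σ p : (Σ i, Fin (r i)), Fin p.2 => (p.2 : ℕ)) PolyTime.var
  have h1 := PolyTime.testBit (fun _ => clog_two_pow _) hx.weaken.weaken.weaken hj
    fun p => p.1.2.2.trans p.1.1.2.2
  refine PolyTime.bool_recursion hv
    (fun p j => decide (∃ j' < j, (x p.1).val.testBit j' = true))
    (by simpa using .const false) (PolyTime.var.or h1) fun p j => ?_
  simp only [Nat.lt_succ_iff_lt_or_eq, or_and_right, exists_or, exists_eq_left]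
  rw [Bool.decide_or, Bool.decide_eq_true]

theorem PolyTime.zmod_zero (hr : PolyTime inp r) :
    PolyTime inp fun i => (0 : ZMod (2 ^ r i)) :=
  PolyTime.zmod_of_testBit (fun i => clog_two_pow _) hr (by simpa using .const false)

theorem PolyTime.sum (hr : PolyTime inp r) {n : ι → ℕ} (hn : PolyTime inp n)
    {f : ∀ i, Fin (n i) → ZMod (2 ^ r i)}
    (hf : PolyTime (ext inp fun i => Fin (n i)) fun p => f p.1 p.2) :
    PolyTime inp fun i => ∑ j, f i j := by
  obtain ⟨p, hp⟩ := hr.exists_le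
  have h := PolyTime.recursion hn
    (fun i j => ∑ t ∈ Finset.range j, if h : t < n i then f i ⟨t, h⟩ else 0)
    (by simpa using zmod_zero hr) (zmod_add hr.weaken.weaken PolyTime.var hf.weaken)
    (fun i j => by simp [Finset.sum_range_succ]) (4 * p + 1) (fun i j _ => by
      refine (size_toData_zmod_le _).trans ?_
      have := hp i
      simp only [Polynomial.eval_add, Polynomial.eval_mul, Polynomial.eval_ofNat,
        Polynomial.eval_one]
      omega)
  have e : ∀ i, ∑ j, f i j =
      ∑ t ∈ Finset.range (n i), if h : t < n i then f i ⟨t, h⟩ else 0 := by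
    intro i
    rw [Finset.sum_range]
    simp
  simp only [e]
  exact h

theorem getD_bits (n j : ℕ) : n.bits.getD j false = n.testBit j := by
  rw [Nat.testBit_eq_inth, List.getI]
  rfl

theorem PolyTime.zmod_intCast (hr : PolyTime inp r) {z : ι → ℤ} (hz : PolyTime inp z) :
    PolyTime inp fun i => ((z i : ℤ) : ZMod (2 ^ r i)) := by
  have hz' : PolyTime inp fun i => (decide (z i < 0), Nat.bits (z i).natAbs) := hz
  have h : PolyTime inp fun i => (((z i).natAbs : ℕ) : ZMod (2 ^ r i)) := by
    refine PolyTime.zmod_of_testBit (fun i => clog_two_pow _) hr ?_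
    have hv : PolyTime (ext inp fun i => Fin (r i)) fun p => (p.2 : ℕ) := PolyTime.var
    have := PolyTime.getD hz'.snd.weaken hv
    simp only [getD_bits] at this
    simpa only [ZMod.val_natCast, Nat.testBit_mod_two_pow, Fin.is_lt, decide_true,
      Bool.true_and] using this
  have := PolyTime.cond hz'.fst (zmod_neg hr h) h
  have e : ∀ i, ((z i : ℤ) : ZMod (2 ^ r i)) =
      if decide (z i < 0) then -(((z i).natAbs : ℕ) : ZMod (2 ^ r i)) else
        (((z i).natAbs : ℕ) : ZMod (2 ^ r i)) := by
    intro i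
    by_cases hi : z i < 0
    · have : z i = -((z i).natAbs : ℤ) := by omega
      simp only [hi, decide_true, if_true]
      conv_lhs => rw [this, Int.cast_neg, Int.cast_natCast]
    · have : z i = ((z i).natAbs : ℤ) := by omega
      simp only [hi, decide_false]
      conv_lhs => rw [this, Int.cast_natCast]
      rfl
  simp only [e]
  exact this

/-- Multiplication by a bit. -/
theorem PolyTime.bit_mul (hr : PolyTime inp r) {b : ι → ZMod 2} (hb : PolyTime inp b)
    {x : ∀ i, ZMod (2 ^ r i)} (hx : PolyTime inp x) :
    PolyTime inp fun i => ((b i).val : ZMod (2 ^ r i)) * x i := by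
  have h := PolyTime.cond (PolyTime.testBit (fun _ => clog_two_two) hb (.const 0)
    fun _ => one_pos) hx (zmod_zero hr)
  have e : ∀ (c : ZMod 2) q (y : ZMod q), (c.val : ZMod q) * y =
      if c.val.testBit 0 then y else 0 := by
    intro c q y
    fin_cases c
    · show ((0 : ℕ) : ZMod q) * y = if Nat.testBit 0 0 then y else 0
      simp
    · show ((1 : ℕ) : ZMod q) * y = if Nat.testBit 1 0 then y else 0
      simp
  simp only [e]
  exact h

/-- Computed bits, regarded as elements of `ZMod 2`. -/
theorem PolyTime.zmod_two {b : ι → Bool} (hb : PolyTime inp b) :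
    PolyTime inp fun i => ((b i).toNat : ZMod 2) := by
  refine PolyTime.zmod_of_testBit (fun i => clog_two_two) (.const 1) ?_
  have e : ∀ (c : Bool) (j : Fin 1), ((c.toNat : ZMod 2)).val.testBit j = c := by
    intro c j
    obtain rfl := Subsingleton.elim j 0
    cases c
    · show Nat.testBit 0 0 = _
      simp
    · show Nat.testBit 1 0 = _
      simp
  simp only [e]
  exact hb.weaken

end

/-! ### Independent families and uniform distributions -/

theorem PMF.map_equiv_apply {α β : Type*} (μ : PMF α) (e : α ≃ β) (b : β) :
    μ.map e b = μ (e.symm b) := by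
  classical
  rw [PMF.map_apply, tsum_eq_single (e.symm b)]
  · simp
  · intro a ha
    rw [if_neg]
    rintro rfl
    simp at ha

theorem indep_apply {α : Type*} (n : ℕ) (μ : Fin n → PMF α) (f : Fin n → α) :
    indep n μ f = ∏ j, μ j (f j) := by
  classical
  induction n with
  | zero =>
    rw [indep, Subsingleton.elim f Fin.elim0]
    simp
  | succ n ih =>
    rw [indep, PMF.bind_apply, tsum_eq_single (f (Fin.last n))]
    · rw [PMF.map_apply, tsum_eq_single (Fin.init f)]
      · rw [if_pos (Fin.snoc_init_self f).symm, ih, Fin.prod_univ_castSucc, mul_comm]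
        rfl
      · intro v hv
        rw [if_neg]
        intro h
        have := congrArg (Fin.init (α := fun _ => α)) h
        rw [Fin.init_snoc] at this
        exact hv this.symm
    · intro a ha
      rw [PMF.map_apply, ENNReal.tsum_eq_zero.2, mul_zero]
      intro v
      rw [if_neg]
      rintro rfl
      simp at ha

theorem indep_bind {α β : Type*} (n : ℕ) (μ : Fin n → PMF α) (g : Fin n → α → PMF β) :
    indep n (fun j => (μ j).bind (g j)) =
      (indep n μ).bind fun x => indep n fun j => g j (x j) := by
  induction n with
  | zero => simp [indep]
  | succ n ih =>
    simp only [indep, PMF.bind_bind, PMF.bind_map]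
    congr 1
    funext b
    rw [ih]
    simp only [Function.comp_def, Fin.snoc_last, Fin.snoc_castSucc, PMF.map_bind]
    rw [PMF.bind_comm]

section IndepPi

variable {ι κ α β : Type} [Fintype ι] [Fintype κ]

/-- The distribution of a family of independent samples of the distributions `μ i`. -/
def indepPi (μ : ι → PMF α) : PMF (ι → α) :=
  (indep (Fintype.card ι) fun j => μ ((Fintype.equivFin ι).symm j)).map
    fun v i => v (Fintype.equivFin ι i)

theorem indepPi_apply (μ : ι → PMF α) (f : ι → α) : indepPi μ f = ∏ i, μ i (f i) := by
  have := PMF.map_equiv_apply (indep (Fintype.card ι) fun j => μ ((Fintype.equivFin ι).symm j))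
    ((Fintype.equivFin ι).symm.arrowCongr (Equiv.refl α)) f
  refine this.trans ?_
  rw [indep_apply, ← (Fintype.equivFin ι).symm.prod_comp]
  rfl

theorem indepPi_fin {n : ℕ} (μ : Fin n → PMF α) : indepPi μ = indep n μ := by
  ext f
  rw [indepPi_apply, indep_apply]

theorem indepPi_prod (μ : ι × κ → PMF α) :
    (indepPi fun i => indepPi fun j => μ (i, j)).map (fun f p => f p.1 p.2) = indepPi μ := by
  ext f
  refine (PMF.map_equiv_apply _ (Equiv.curry ι κ α).symm f).trans ?_
  simp only [indepPi_apply, Fintype.prod_prod_type]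
  rfl

theorem indepPi_bind (μ : ι → PMF α) (g : ι → α → PMF β) :
    (indepPi fun i => (μ i).bind (g i)) = (indepPi μ).bind fun x => indepPi fun i => g i (x i) := by
  simp only [indepPi, indep_bind, PMF.map_bind, PMF.bind_map, Function.comp_def,
    Equiv.apply_symm_apply]

theorem indepPi_pure (f : ι → α) : indepPi (fun i => PMF.pure (f i)) = PMF.pure f := by
  simp [indepPi, indep_pure, PMF.pure_map]

theorem indepPi_map (μ : ι → PMF α) (g : ι → α → β) :
    (indepPi fun i => (μ i).map (g i)) = (indepPi μ).map fun x i => g i (x i) := by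
  have := indepPi_bind μ fun i a => PMF.pure (g i a)
  simp only [indepPi_pure] at this
  exact this

theorem indepPi_reindex (μ : ι → PMF α) (e : κ ≃ ι) :
    (indepPi μ).map (fun f j => f (e j)) = indepPi fun j => μ (e j) := by
  ext f
  refine (PMF.map_equiv_apply _ (e.symm.arrowCongr (Equiv.refl α)) f).trans ?_
  rw [indepPi_apply, indepPi_apply, ← e.prod_comp]
  simp [Equiv.arrowCongr]

theorem indepPi_swap (μ : ι → κ → PMF α) :
    (indepPi fun j => indepPi fun i => μ i j).map (fun f i j => f j i) =
      indepPi fun i => indepPi fun j => μ i j := by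
  ext f
  refine (PMF.map_equiv_apply _ (Equiv.piComm fun _ _ => α) f).trans ?_
  simp only [indepPi_apply]
  exact Finset.prod_comm

/-- A mixture in one coordinate of an independent family is a mixture of independent families. -/
theorem indepPi_update_bind [DecidableEq ι] (μ : ι → PMF α) (i : ι) (ν : PMF β)
    (g : β → PMF α) : indepPi (Function.update μ i (ν.bind g)) =
      ν.bind fun b => indepPi (Function.update μ i (g b)) := by
  have key : ∀ (ρ : PMF α) (f : ι → α), indepPi (Function.update μ i ρ) f =
      ρ (f i) * ∏ j ∈ Finset.univ.erase i, μ j (f j) := by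
    intro ρ f
    rw [indepPi_apply, ← Finset.mul_prod_erase _ _ (Finset.mem_univ i), Function.update_self]
    congr 1
    refine Finset.prod_congr rfl fun j hj => ?_
    rw [Function.update_of_ne (Finset.ne_of_mem_erase hj)]
  ext f
  rw [key, PMF.bind_apply, PMF.bind_apply, ← ENNReal.tsum_mul_right]
  refine tsum_congr fun b => ?_
  rw [key, mul_assoc]

theorem iid_eq_indepPi (μ : PMF ℤ) : iid ι μ = indepPi fun _ => μ := by
  ext f
  rw [iid_apply, indepPi_apply]

theorem noiseVec_eq (q : ℕ) (μ : PMF ℤ) :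
    noiseVec q ι μ = indepPi fun _ => μ.map fun z : ℤ => (z : ZMod q) := by
  rw [noiseVec, iid_eq_indepPi, indepPi_map (fun _ => μ)]

theorem noiseMat_eq (q : ℕ) (μ : PMF ℤ) :
    noiseMat q ι κ μ = (indepPi fun _ : ι × κ => μ.map fun z : ℤ => (z : ZMod q)).map
      fun e => Matrix.of fun i j => e (i, j) := by
  rw [noiseMat, iid_eq_indepPi, indepPi_map (fun _ => μ), PMF.map_comp]
  rfl

end IndepPi

/-- The marginal distribution of the first `m` of `n` independent samples. -/
theorem indep_castLE {α : Type*} {m n : ℕ} (h : m ≤ n) (μ : PMF α) :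
    (indep n fun _ => μ).map (fun v j => v (Fin.castLE h j)) = indep m fun _ => μ := by
  induction n, h using Nat.le_induction with
  | base => exact PMF.map_id _
  | succ n h ih =>
    rw [indep, PMF.map_bind]
    simp only [PMF.map_comp]
    have e : ∀ a : α, ((fun (v : Fin (n + 1) → α) j => v (Fin.castLE (Nat.le_succ_of_le h) j)) ∘
        fun v => Fin.snoc (α := fun _ => α) v a) = fun v j => v (Fin.castLE h j) := by
      intro a
      funext v j
      exact Fin.snoc_castSucc (α := fun _ => α) (i := Fin.castLE h j) a v
    have e' := fun a => congrArg (fun f => (indep n fun _ => μ).map f) (e a)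
    simp only [e', ih, PMF.bind_const]

section Uniform

variable {α β : Type} [Fintype α] [Nonempty α] [Fintype β] [Nonempty β]

theorem uniform_map_bijective {f : α → β} (hf : Function.Bijective f) :
    (PMF.uniformOfFintype α).map f = PMF.uniformOfFintype β := by
  ext b
  refine (PMF.map_equiv_apply _ (Equiv.ofBijective f hf) b).trans ?_
  rw [PMF.uniformOfFintype_apply, PMF.uniformOfFintype_apply, Fintype.card_of_bijective hf]

theorem indepPi_uniform {ι : Type} [Fintype ι] [DecidableEq ι] :
    indepPi (fun _ : ι => PMF.uniformOfFintype α) = PMF.uniformOfFintype (ι → α) := by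
  ext f
  rw [indepPi_apply, PMF.uniformOfFintype_apply]
  simp only [PMF.uniformOfFintype_apply, Finset.prod_const, Fintype.card_fun, Finset.card_univ,
    Nat.cast_pow, ENNReal.inv_pow]

theorem uniform_prod : ((PMF.uniformOfFintype α).bind fun a =>
    (PMF.uniformOfFintype β).map fun b => (a, b)) = PMF.uniformOfFintype (α × β) := by
  classical
  ext ⟨a, b⟩
  rw [PMF.bind_apply, tsum_eq_single a]
  · rw [PMF.map_apply, tsum_eq_single b]
    · simp only [if_true, PMF.uniformOfFintype_apply, Fintype.card_prod, Nat.cast_mul]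
      rw [ENNReal.mul_inv (by simp) (by simp)]
    · intro b' hb
      rw [if_neg]
      simpa using hb.symm
  · intro a' ha
    rw [PMF.map_apply, ENNReal.tsum_eq_zero.2, mul_zero]
    intro b'
    rw [if_neg]
    simpa using fun h => absurd h.symm ha

end Uniform

/-! ### Guessing probabilities -/

/-- The probability that a random bit is `true`. -/
def prTrue (μ : PMF Bool) : ℝ := (μ true).toReal

theorem prTrue_nonneg (μ : PMF Bool) : 0 ≤ prTrue μ := ENNReal.toReal_nonneg

theorem prTrue_le_one (μ : PMF Bool) : prTrue μ ≤ 1 :=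
  ENNReal.toReal_le_of_le_ofReal zero_le_one (by simpa using PMF.coe_le_one μ true)

theorem toReal_apply_false (μ : PMF Bool) : (μ false).toReal = 1 - prTrue μ := by
  have h := PMF.tsum_coe μ
  rw [tsum_bool] at h
  have := congrArg ENNReal.toReal h
  rw [ENNReal.toReal_add (PMF.apply_ne_top _ _) (PMF.apply_ne_top _ _)] at this
  simp only [ENNReal.toReal_one] at this
  rw [prTrue]
  linarith

/-- The probability of guessing a uniform bit `b` from a sample of `μ b`. -/
theorem prTrue_guess (μ : Bool → PMF Bool) :
    prTrue ((PMF.uniformOfFintype Bool).bind fun b => (μ b).bind fun b' =>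
      PMF.pure (b' == b)) = 1 / 2 + (prTrue (μ true) - prTrue (μ false)) / 2 := by
  have h : ∀ b, ((μ b).bind fun b' => PMF.pure (b' == b)) true = μ b b := by
    intro b
    rw [PMF.bind_apply, tsum_bool]
    cases b <;> simp [PMF.pure_apply]
  rw [prTrue, PMF.bind_apply, tsum_bool, h, h, PMF.uniformOfFintype_apply,
    PMF.uniformOfFintype_apply, ENNReal.toReal_add, ENNReal.toReal_mul, ENNReal.toReal_mul,
    toReal_apply_false]
  · simp only [Fintype.card_bool, ENNReal.toReal_inv, prTrue]
    norm_num
    ring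
  all_goals exact ENNReal.mul_ne_top (by simp) (PMF.apply_ne_top _ _)

theorem prTrue_uniform_bind {α : Type} [Fintype α] [Nonempty α] (f : α → PMF Bool) :
    prTrue ((PMF.uniformOfFintype α).bind f) = (∑ a, prTrue (f a)) / Fintype.card α := by
  rw [prTrue, PMF.bind_apply, tsum_fintype, ENNReal.toReal_sum fun a _ =>
    ENNReal.mul_ne_top (by simp) (PMF.apply_ne_top _ _), Finset.sum_div]
  refine Finset.sum_congr rfl fun a _ => ?_
  rw [ENNReal.toReal_mul, PMF.uniformOfFintype_apply, ENNReal.toReal_inv, ENNReal.toReal_natCast,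
    prTrue, inv_mul_eq_div]

theorem prTrue_uniform : prTrue (PMF.uniformOfFintype Bool) = 1 / 2 := by
  simp [prTrue, PMF.uniformOfFintype_apply]

open HalfSuccinct

/-! ### Gadget decomposition -/

theorem sum_testBit_two_pow (n r : ℕ) :
    ∑ j ∈ Finset.range r, (n.testBit j).toNat * 2 ^ j = n % 2 ^ r := by
  induction r with
  | zero => simp [Nat.mod_one]
  | succ r ih => rw [Finset.sum_range_succ, ih, Nat.mod_pow_succ, Nat.toNat_testBit, mul_comm]

theorem toNat_zmod_two_bijective : Function.Bijective fun b : Bool => (b.toNat : ZMod 2) := by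
  decide

theorem val_toNat_zmod_two (b : Bool) : (b.toNat : ZMod 2).val = b.toNat := by
  cases b <;> rfl

/-- The binary digits of a residue modulo `2 ^ r`, as elements of `ZMod 2`. -/
def gadgetInv (r : ℕ) : ZMod (2 ^ r) ≃ (Fin r → ZMod 2) :=
  (digits r).trans ((Equiv.refl _).arrowCongr (Equiv.ofBijective _ toNat_zmod_two_bijective))

theorem gadgetInv_apply {r : ℕ} (x : ZMod (2 ^ r)) (j : Fin r) :
    gadgetInv r x j = ((x.val.testBit j).toNat : ZMod 2) := rfl

theorem sum_gadgetInv {r : ℕ} (x : ZMod (2 ^ r)) :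
    ∑ j, ((gadgetInv r x j).val : ZMod (2 ^ r)) * 2 ^ (j : ℕ) = x := by
  simp only [gadgetInv_apply, val_toNat_zmod_two]
  have h := sum_testBit_two_pow x.val r
  rw [Nat.mod_eq_of_lt (ZMod.val_lt x), Finset.sum_range] at h
  have := congrArg (Nat.cast : ℕ → ZMod (2 ^ r)) h
  rw [ZMod.natCast_zmod_val] at this
  conv_rhs => rw [← this]
  push_cast
  rfl

section

variable {K M L R : ℕ}

/-- The samples of the LWE problem are indexed by the entries of an `n × mℓ` matrix. -/
def rowIdx (K M L R : ℕ) :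
    (Fin K × Fin R) × (Fin M × Fin L) ≃ Fin (K * R * (M * L)) :=
  (finProdFinEquiv.prodCongr finProdFinEquiv).trans finProdFinEquiv

/-- The binary matrix `B` whose products with `I ⊗ s ⊗ gᵀ` are the products of `X` with `s`. -/
def binB (X : Matrix (Fin (K * R * (M * L))) (Fin K) (ZMod (2 ^ R))) :
    Matrix (Fin K × Fin R) (((Fin M × Fin L) × Fin K) × Fin R) (ZMod 2) :=
  Matrix.of fun a c => gadgetInv R (X (rowIdx K M L R (a, c.1.1)) c.1.2) c.2

/-- The binary matrix `A` for which `Aᵀ (s ⊗ gᵀ) = X s`. -/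
def binA (X : Matrix (Fin M) (Fin K) (ZMod (2 ^ R))) :
    Matrix (Fin K × Fin R) (Fin M) (ZMod 2) :=
  Matrix.of fun a i => gadgetInv R (X i a.1) a.2

theorem binB_bijective : Function.Bijective (binB (K := K) (M := M) (L := L) (R := R)) := by
  constructor
  · intro X Y h
    ext i e
    obtain ⟨⟨a, c⟩, rfl⟩ := (rowIdx K M L R).surjective i
    apply (gadgetInv R).injective
    funext f
    exact congrFun (congrFun h a) ((c, e), f)
  · intro B
    refine ⟨Matrix.of fun i e => (gadgetInv R).symm fun f =>
      B ((rowIdx K M L R).symm i).1 ((((rowIdx K M L R).symm i).2, e), f), ?_⟩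
    ext a ⟨⟨c, e⟩, f⟩
    simp [binB]

theorem binA_bijective : Function.Bijective (binA (K := K) (M := M) (R := R)) := by
  constructor
  · intro X Y h
    ext i e
    apply (gadgetInv R).injective
    funext f
    exact congrFun (congrFun h (e, f)) i
  · intro A
    refine ⟨Matrix.of fun i e => (gadgetInv R).symm fun f => A (e, f) i, ?_⟩
    ext ⟨e, f⟩ i
    simp [binA]

theorem secretMat_apply (s : Fin K → ZMod (2 ^ R)) (c' : Fin M × Fin L) (e : Fin K) (f : Fin R)
    (c : Fin M × Fin L) : secretMat M L K (2 ^ R) R s ((c', e), f) c =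
      if c' = c then s e * 2 ^ (f : ℕ) else 0 := by
  simp [secretMat, gadget, Matrix.one_apply]

theorem binB_mul_secretMat (X : Matrix (Fin (K * R * (M * L))) (Fin K) (ZMod (2 ^ R)))
    (s : Fin K → ZMod (2 ^ R)) (a : Fin K × Fin R) (c : Fin M × Fin L) :
    (lift (2 ^ R) (binB X) * secretMat M L K (2 ^ R) R s) a c =
      (X *ᵥ s) (rowIdx K M L R (a, c)) := by
  rw [Matrix.mul_apply, Fintype.sum_prod_type, Fintype.sum_prod_type, Finset.sum_eq_single c]
  · refine Finset.sum_congr rfl fun e _ => ?_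
    show _ = X (rowIdx K M L R (a, c)) e * s e
    conv_rhs => rw [← sum_gadgetInv (X (rowIdx K M L R (a, c)) e), Finset.sum_mul]
    refine Finset.sum_congr rfl fun f _ => ?_
    rw [secretMat_apply, if_pos rfl]
    simp only [lift, binB, Matrix.map_apply, Matrix.of_apply]
    ring
  · intro c' _ hc
    simp [secretMat_apply, hc]
  · simp

theorem binA_transpose_mulVec (X : Matrix (Fin M) (Fin K) (ZMod (2 ^ R)))
    (s : Fin K → ZMod (2 ^ R)) :
    (lift (2 ^ R) (binA X))ᵀ *ᵥ (fun a => s a.1 * 2 ^ (a.2 : ℕ)) = X *ᵥ s := by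
  funext i
  rw [Matrix.mulVec, dotProduct, Fintype.sum_prod_type]
  refine Finset.sum_congr rfl fun e _ => ?_
  show _ = X i e * s e
  conv_rhs => rw [← sum_gadgetInv (X i e), Finset.sum_mul]
  refine Finset.sum_congr rfl fun f _ => ?_
  simp only [lift, binA, Matrix.map_apply, Matrix.of_apply, Matrix.transpose_apply]
  ring

/-! ### Encodings as distributions -/

/-- The vector part of an LWE sample with matrix `X`. -/
def lweVec {q N : ℕ} [NeZero q] (μ : PMF ℤ) (X : Matrix (Fin N) (Fin K) (ZMod q)) :
    PMF (Fin N → ZMod q) :=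
  (PMF.uniformOfFintype (Fin K → ZMod q)).bind fun s =>
    (noiseVec q (Fin N) μ).map fun e => X *ᵥ s + e

/-- `Aᵀ U + E + I ⊗ yᵀ`, where the vector `u` lists the entries of `U`. -/
def ctext (A : Matrix (Fin K × Fin R) (Fin M) (ZMod 2))
    (u : Fin (K * R * (M * L)) → ZMod (2 ^ R))
    (E : Matrix (Fin M) (Fin M × Fin L) (ZMod (2 ^ R))) (y : Fin L → ZMod (2 ^ R)) :
    Matrix (Fin M) (Fin M × Fin L) (ZMod (2 ^ R)) :=
  (lift (2 ^ R) A)ᵀ * (Matrix.of fun a c => u (rowIdx K M L R (a, c))) + E +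
    messageMat M L (2 ^ R) y

/-- An encoding of `y` in which `u` takes the place of the entries of `B (I ⊗ s ⊗ gᵀ) + E'`. -/
def encOf (μ : PMF ℤ) (A : Matrix (Fin K × Fin R) (Fin M) (ZMod 2)) (y : Fin L → ZMod (2 ^ R))
    (u : Fin (K * R * (M * L)) → ZMod (2 ^ R)) :
    PMF (Matrix (Fin M) (Fin M × Fin L) (ZMod (2 ^ R))) :=
  (noiseMat (2 ^ R) (Fin M) (Fin M × Fin L) μ).map fun E => ctext A u E y

theorem noiseMat_map_reindex {ι κ ν : Type} [Fintype ι] [Fintype κ] [Fintype ν] (q : ℕ)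
    (μ : PMF ℤ) (e : ν ≃ ι × κ) :
    (noiseMat q ι κ μ).map (fun E i => E (e i).1 (e i).2) = noiseVec q ν μ := by
  rw [noiseMat_eq, PMF.map_comp, noiseVec_eq]
  exact indepPi_reindex _ e

/-- The encoding of `y`, without its private part. -/
def realEnc (μ : PMF ℤ) (A : Matrix (Fin K × Fin R) (Fin M) (ZMod 2))
    (B : Matrix (Fin K × Fin R) (((Fin M × Fin L) × Fin K) × Fin R) (ZMod 2))
    (y : Fin L → ZMod (2 ^ R)) : PMF (Matrix (Fin M) (Fin M × Fin L) (ZMod (2 ^ R))) :=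
  (PMF.uniformOfFintype (Fin K → ZMod (2 ^ R))).bind fun s =>
    (noiseMat (2 ^ R) (Fin M) (Fin M × Fin L) μ).bind fun E =>
      (noiseMat (2 ^ R) (Fin K × Fin R) (Fin M × Fin L) μ).map fun E' =>
        (lift (2 ^ R) A)ᵀ * lift (2 ^ R) B * secretMat M L K (2 ^ R) R s +
          (lift (2 ^ R) A)ᵀ * E' + E + messageMat M L (2 ^ R) y

theorem enc_map_fst (χ : ℕ → PMF ℤ) (k m ℓ r : ℕ → ℕ) (lam : ℕ)
    (pk : (scheme χ k m ℓ r).PK lam) (y : Fin (ℓ lam) → ZMod (2 ^ r lam)) :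
    ((scheme χ k m ℓ r).enc lam pk y).map Prod.fst = realEnc (χ lam) pk.1 pk.2 y := by
  show PMF.map Prod.fst (PMF.bind _ fun s => PMF.bind _ fun E => PMF.bind _ fun E' =>
    PMF.pure _) = _
  simp only [PMF.map_bind]
  refine congrArg _ (funext fun s => congrArg _ (funext fun E => congrArg _ (funext fun E' => ?_)))
  exact PMF.pure_map _ _

/-- For `B = binB X`, the matrix `B (I ⊗ s ⊗ gᵀ) + E'` lists the entries of the LWE sample
`X s + e`. -/
theorem realEnc_binB (μ : PMF ℤ) (A : Matrix (Fin K × Fin R) (Fin M) (ZMod 2))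
    (X : Matrix (Fin (K * R * (M * L))) (Fin K) (ZMod (2 ^ R))) (y : Fin L → ZMod (2 ^ R)) :
    realEnc μ A (binB X) y = (lweVec μ X).bind (encOf μ A y) := by
  rw [lweVec, PMF.bind_bind, realEnc]
  congr 1
  funext s
  rw [← noiseMat_map_reindex _ μ (rowIdx K M L R).symm, PMF.map_comp, PMF.bind_map]
  simp only [encOf, PMF.map, Function.comp_def]
  rw [PMF.bind_comm]
  congr 1
  funext E'
  congr 1
  funext E
  rw [ctext, Matrix.mul_assoc, ← Matrix.mul_add]
  congr 4
  ext a c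
  simp [binB_mul_secretMat]

/-- A column of `Aᵀ V + W + T`, where `V` is uniform and the column of `W` is drawn from `ν`. -/
def encCol (A : Matrix (Fin K × Fin R) (Fin M) (ZMod 2)) (ν : PMF (Fin M → ZMod (2 ^ R)))
    (t : Fin M → ZMod (2 ^ R)) : PMF (Fin M → ZMod (2 ^ R)) :=
  (PMF.uniformOfFintype (Fin K × Fin R → ZMod (2 ^ R))).bind fun v =>
    ν.map fun w => (lift (2 ^ R) A)ᵀ *ᵥ v + w + t

/-- Challenges that are LWE samples for the public matrix lead to columns of an encoding: the
secret of the sample is absorbed by the uniform vector `v`. -/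
theorem lweVec_bind_encCol (μ : PMF ℤ) (X : Matrix (Fin M) (Fin K) (ZMod (2 ^ R)))
    (t : Fin M → ZMod (2 ^ R)) :
    ((lweVec μ X).bind fun u => encCol (binA X) (PMF.pure u) t) =
      encCol (binA X) (noiseVec (2 ^ R) (Fin M) μ) t := by
  have h : ∀ (s : Fin K → ZMod (2 ^ R)) (e : Fin M → ZMod (2 ^ R)),
      encCol (binA X) (PMF.pure (X *ᵥ s + e)) t = encCol (binA X) (PMF.pure e) t := by
    intro s e
    simp only [encCol, PMF.pure_map]
    rw [← uniform_map_bijective (Equiv.addRight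
      fun a : Fin K × Fin R => s a.1 * 2 ^ (a.2 : ℕ)).bijective]
    conv_rhs => rw [PMF.bind_map]
    rw [uniform_map_bijective (Equiv.addRight
      fun a : Fin K × Fin R => s a.1 * 2 ^ (a.2 : ℕ)).bijective]
    congr 1
    funext v
    rw [Function.comp_apply, Equiv.coe_addRight, Matrix.mulVec_add, binA_transpose_mulVec,
      add_assoc (_ *ᵥ v) (X *ᵥ s)]
  simp only [lweVec, PMF.bind_bind, PMF.bind_map, Function.comp_def, h, PMF.bind_const]
  simp only [encCol, PMF.pure_map]
  rw [PMF.bind_comm]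
  rfl

/-- Uniform challenges lead to uniform columns. -/
theorem uniform_bind_encCol (A : Matrix (Fin K × Fin R) (Fin M) (ZMod 2))
    (t : Fin M → ZMod (2 ^ R)) :
    ((PMF.uniformOfFintype (Fin M → ZMod (2 ^ R))).bind fun u => encCol A (PMF.pure u) t) =
      PMF.uniformOfFintype (Fin M → ZMod (2 ^ R)) := by
  simp only [encCol, PMF.pure_map]
  rw [PMF.bind_comm]
  have h : ∀ v : Fin K × Fin R → ZMod (2 ^ R),
      ((PMF.uniformOfFintype (Fin M → ZMod (2 ^ R))).bind fun u =>
        PMF.pure ((lift (2 ^ R) A)ᵀ *ᵥ v + u + t)) = PMF.uniformOfFintype _ := fun v =>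
    uniform_map_bijective ((Equiv.addLeft ((lift (2 ^ R) A)ᵀ *ᵥ v)).trans
      (Equiv.addRight t)).bijective
  simp only [h, PMF.bind_const]

/-- The columns of the `j`-th hybrid: the first `j` of them are uniform, the others are those of
an encoding of `y`. -/
def hybCol (μ : PMF ℤ) (j : ℕ) (A : Matrix (Fin K × Fin R) (Fin M) (ZMod 2))
    (y : Fin L → ZMod (2 ^ R)) (c : Fin M × Fin L) : PMF (Fin M → ZMod (2 ^ R)) :=
  if (finProdFinEquiv c : ℕ) < j then PMF.uniformOfFintype (Fin M → ZMod (2 ^ R)) else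
    encCol A (noiseVec (2 ^ R) (Fin M) μ) fun i => messageMat M L (2 ^ R) y i c

/-- The columns of the `j`-th hybrid with the challenge `u` in the `j`-th one. -/
def chalCol (μ : PMF ℤ) (j : ℕ) (A : Matrix (Fin K × Fin R) (Fin M) (ZMod 2))
    (y : Fin L → ZMod (2 ^ R)) (u : Fin M → ZMod (2 ^ R)) (c : Fin M × Fin L) :
    PMF (Fin M → ZMod (2 ^ R)) :=
  if (finProdFinEquiv c : ℕ) < j then PMF.uniformOfFintype (Fin M → ZMod (2 ^ R)) else
    encCol A (if (finProdFinEquiv c : ℕ) = j then PMF.pure u else noiseVec (2 ^ R) (Fin M) μ)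
      fun i => messageMat M L (2 ^ R) y i c

/-- The matrix with independent columns drawn from the distributions `ν c`. -/
def ofCols {ι κ α : Type} [Fintype κ] (ν : κ → PMF (ι → α)) : PMF (Matrix ι κ α) :=
  (indepPi ν).map fun C => Matrix.of fun i c => C c i

/-- Only column `c` of the matrix depends on the challenge. -/
theorem chalCol_eq_update (μ : PMF ℤ) (A : Matrix (Fin K × Fin R) (Fin M) (ZMod 2))
    (y : Fin L → ZMod (2 ^ R)) (u : Fin M → ZMod (2 ^ R)) (c : Fin M × Fin L) :
    chalCol μ (finProdFinEquiv c) A y u = Function.update (hybCol μ (finProdFinEquiv c) A y) c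
      (encCol A (PMF.pure u) fun i => messageMat M L (2 ^ R) y i c) := by
  funext c'
  by_cases h : c' = c
  · subst h
    simp [chalCol]
  · have h' : (finProdFinEquiv c' : ℕ) ≠ finProdFinEquiv c := fun h' =>
      h (finProdFinEquiv.injective (Fin.ext h'))
    rw [Function.update_of_ne h]
    simp only [chalCol, hybCol, if_neg h']

theorem ofCols_update_bind {ι κ α β : Type} [Fintype κ] [DecidableEq κ] (ν : κ → PMF (ι → α))
    (c : κ) (ρ : PMF β) (g : β → PMF (ι → α)) :
    (ρ.bind fun b => ofCols (Function.update ν c (g b))) =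
      ofCols (Function.update ν c (ρ.bind g)) := by
  rw [ofCols, indepPi_update_bind, PMF.map_bind]
  rfl

/-- With an LWE sample as the challenge in column `c`, the columns are those of the hybrid before
this column is replaced. -/
theorem lweVec_bind_chalCol (μ : PMF ℤ) (X : Matrix (Fin M) (Fin K) (ZMod (2 ^ R)))
    (y : Fin L → ZMod (2 ^ R)) (c : Fin M × Fin L) :
    ((lweVec μ X).bind fun u => ofCols (chalCol μ (finProdFinEquiv c) (binA X) y u)) =
      ofCols (hybCol μ (finProdFinEquiv c) (binA X) y) := by
  simp only [chalCol_eq_update]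
  rw [ofCols_update_bind, lweVec_bind_encCol]
  congr 1
  rw [Function.update_eq_self_iff]
  simp [hybCol]

/-- With a uniform challenge in column `c`, the columns are those of the hybrid after this column is
replaced. -/
theorem uniform_bind_chalCol (μ : PMF ℤ) (A : Matrix (Fin K × Fin R) (Fin M) (ZMod 2))
    (y : Fin L → ZMod (2 ^ R)) (c : Fin M × Fin L) :
    ((PMF.uniformOfFintype (Fin M → ZMod (2 ^ R))).bind fun u =>
      ofCols (chalCol μ (finProdFinEquiv c) A y u)) =
      ofCols (hybCol μ (finProdFinEquiv c + 1) A y) := by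
  simp only [chalCol_eq_update]
  rw [ofCols_update_bind, uniform_bind_encCol]
  congr 1
  funext c'
  by_cases h : c' = c
  · subst h
    simp [hybCol]
  · have h' : (finProdFinEquiv c' : ℕ) ≠ finProdFinEquiv c := fun h' =>
      h (finProdFinEquiv.injective (Fin.ext h'))
    rw [Function.update_of_ne h]
    simp only [hybCol]
    congr 1
    simp only [eq_iff_iff]
    omega

/-- Before the first hybrid step: the encoding with a uniform `U`. -/
theorem ofCols_hybCol_zero (μ : PMF ℤ) (A : Matrix (Fin K × Fin R) (Fin M) (ZMod 2))
    (y : Fin L → ZMod (2 ^ R)) : ofCols (hybCol μ 0 A y) =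
      (PMF.uniformOfFintype (Fin (K * R * (M * L)) → ZMod (2 ^ R))).bind (encOf μ A y) := by
  have hbij : Function.Bijective fun (U : Fin M × Fin L → Fin K × Fin R → ZMod (2 ^ R))
      (i : Fin (K * R * (M * L))) =>
        U ((rowIdx K M L R).symm i).2 ((rowIdx K M L R).symm i).1 := by
    constructor
    · intro U V h
      funext c a
      simpa using congrFun h (rowIdx K M L R (a, c))
    · intro u
      exact ⟨fun c a => u (rowIdx K M L R (a, c)), by funext i; simp⟩
  rw [← uniform_map_bijective hbij, PMF.bind_map, ← indepPi_uniform]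
  have hnoise : (indepPi fun _ : Fin M × Fin L => noiseVec (2 ^ R) (Fin M) μ).map
      (fun C => Matrix.of fun i c => C c i) = noiseMat (2 ^ R) (Fin M) (Fin M × Fin L) μ := by
    simp only [noiseVec_eq, noiseMat_eq]
    have h1 := indepPi_swap fun (_ : Fin M) (_ : Fin M × Fin L) =>
      PMF.map (fun z : ℤ => (z : ZMod (2 ^ R))) μ
    have h2 := indepPi_prod fun _ : Fin M × (Fin M × Fin L) =>
      PMF.map (fun z : ℤ => (z : ZMod (2 ^ R))) μ
    rw [← h2, PMF.map_comp, ← h1, PMF.map_comp]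
    rfl
  have h0 : hybCol μ 0 A y = fun c => encCol A (noiseVec (2 ^ R) (Fin M) μ) fun i =>
      messageMat M L (2 ^ R) y i c := by
    funext c
    simp only [hybCol, Nat.not_lt_zero, if_false]
  simp only [ofCols, h0, encCol]
  rw [indepPi_bind, PMF.map_bind]
  congr 1
  funext V
  rw [indepPi_map (fun _ => noiseVec (2 ^ R) (Fin M) μ), PMF.map_comp, Function.comp_apply,
    encOf, ← hnoise, PMF.map_comp]
  congr 1
  funext W
  ext i c
  simp [ctext, Matrix.mul_apply, Matrix.mulVec, dotProduct]

/-- After the last hybrid step: a uniform matrix. -/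
theorem ofCols_hybCol_last (μ : PMF ℤ) (A : Matrix (Fin K × Fin R) (Fin M) (ZMod 2))
    (y : Fin L → ZMod (2 ^ R)) : ofCols (hybCol μ (M * L) A y) =
      uniformMat (2 ^ R) (Fin M) (Fin M × Fin L) := by
  have h : hybCol μ (M * L) A y = fun _ => PMF.uniformOfFintype (Fin M → ZMod (2 ^ R)) := by
    funext c
    simp only [hybCol, (finProdFinEquiv c).is_lt, if_true]
  rw [h, ofCols, indepPi_uniform, uniformMat]
  have hbij : Function.Bijective fun (C : Fin M → Fin M × Fin L → ZMod (2 ^ R)) c i => C i c :=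
    (Equiv.piComm fun _ _ => ZMod (2 ^ R)).bijective
  rw [← uniform_map_bijective hbij, PMF.map_comp]
  rfl

end

/-! ### The choice of a hybrid -/

/-- Doubles the range of a uniform number, unless it has reached the size `N`. A state `(W, j)`
consists of the size of the range and of the number. -/
def doubleStep (N : ℕ) (s : ℕ × ℕ) : PMF (ℕ × ℕ) :=
  if N ≤ s.1 then PMF.pure s else
    (PMF.uniformOfFintype Bool).map fun b => (s.1 + s.1, s.2 + s.2 + b.toNat)

/-- A random index that is uniform below the first power of two that is at least `N`. Programs that
have only fair coins and have to halt cannot draw a uniform number below `N` itself. -/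
def hybridIndex (N : ℕ) : PMF ℕ :=
  (loopM (fun _ => doubleStep N) N (1, 0)).map Prod.snd

theorem uniform_bind_doubleStep {N T : ℕ} (h : ¬N ≤ 2 ^ T) :
    ((PMF.uniformOfFintype (Fin (2 ^ T))).bind fun j => doubleStep N (2 ^ T, j)) =
      (PMF.uniformOfFintype (Fin (2 ^ (T + 1)))).map
        fun j : Fin (2 ^ (T + 1)) => (2 ^ (T + 1), (j : ℕ)) := by
  have hbij : Function.Bijective fun p : Fin (2 ^ T) × Bool =>
      (⟨(p.1 : ℕ) + p.1 + p.2.toNat, by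
        have h1 := p.1.2
        have h2 : p.2.toNat ≤ 1 := Bool.toNat_le p.2
        rw [pow_succ]
        omega⟩ : Fin (2 ^ (T + 1))) := by
    refine (Fintype.bijective_iff_injective_and_card _).2 ⟨?_, by simp [pow_succ]⟩
    rintro ⟨⟨j, hj⟩, b⟩ ⟨⟨j', hj'⟩, b'⟩ h
    simp only [Fin.mk.injEq, Prod.mk.injEq] at h ⊢
    cases b <;> cases b' <;> simp at h ⊢ <;> omega
  rw [← uniform_map_bijective hbij, ← uniform_prod, PMF.map_comp, PMF.map_bind]
  congr 1
  funext j
  rw [doubleStep, if_neg h, PMF.map_comp]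
  congr 1
  funext b
  simp only [Function.comp_apply, Prod.mk.injEq, and_true]
  rw [pow_succ, mul_two]

/-- The range of `hybridIndex N`. The number `N` of rounds suffices since `N ≤ 2 ^ N`, and doubling
stops at the first power of two that is at least `N`. -/
theorem exists_hybridIndex_eq (N : ℕ) : ∃ T : ℕ, N ≤ 2 ^ T ∧ 2 ^ T ≤ 2 * N + 1 ∧
    hybridIndex N = (PMF.uniformOfFintype (Fin (2 ^ T))).map fun j : Fin (2 ^ T) => (j : ℕ) := by
  -- After `t` rounds, the range has reached `N` or has doubled `t` times.
  have key : ∀ t T : ℕ, 2 ^ T ≤ 2 * N + 1 → ∃ T', (N ≤ 2 ^ T' ∨ T + t ≤ T') ∧ 2 ^ T' ≤ 2 * N + 1 ∧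
      ((PMF.uniformOfFintype (Fin (2 ^ T))).bind fun j =>
        loopM (fun _ => doubleStep N) t (2 ^ T, j)) =
      (PMF.uniformOfFintype (Fin (2 ^ T'))).map fun j : Fin (2 ^ T') => (2 ^ T', (j : ℕ)) := by
    intro t
    induction t with
    | zero => exact fun T hT => ⟨T, Or.inr le_rfl, hT, rfl⟩
    | succ t ih =>
      intro T hT
      by_cases h : N ≤ 2 ^ T
      · refine ⟨T, Or.inl h, hT, ?_⟩
        have hconst : ∀ (t : ℕ) (j : Fin (2 ^ T)), loopM (fun _ => doubleStep N) t (2 ^ T, j) =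
            PMF.pure (2 ^ T, (j : ℕ)) := by
          intro t j
          induction t with
          | zero => rfl
          | succ t ih => rw [loopM, doubleStep, if_pos h, PMF.pure_bind, ih]
        simp only [hconst]
        rfl
      · obtain ⟨T', h1, h2, h3⟩ := ih (T + 1) (by rw [pow_succ]; omega)
        have hloop : ((PMF.uniformOfFintype (Fin (2 ^ T))).bind fun j =>
            loopM (fun _ => doubleStep N) (t + 1) (2 ^ T, j)) =
            (PMF.uniformOfFintype (Fin (2 ^ (T + 1)))).bind fun j =>
              loopM (fun _ => doubleStep N) t (2 ^ (T + 1), j) := by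
          simp only [loopM]
          rw [← PMF.bind_bind, uniform_bind_doubleStep h, PMF.bind_map]
          rfl
        exact ⟨T', h1.imp id (by omega), h2, hloop.trans h3⟩
  obtain ⟨T, h1, h2, h3⟩ := key N 0 (by omega)
  refine ⟨T, ?_, h2, ?_⟩
  · rcases h1 with h1 | h1
    · exact h1
    · exact Nat.lt_two_pow_self.le.trans (Nat.pow_le_pow_right two_pos (by omega))
  · have h := congrArg (PMF.map Prod.snd) h3
    rw [PMF.map_comp, PMF.map_bind] at h
    have h0 : ∀ j : Fin (2 ^ 0), (2 ^ 0, (j : ℕ)) = (1, 0) := by decide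
    simp only [h0, PMF.bind_const] at h
    exact h

/-! ### The reductions -/

theorem uniformMat_map_bijective {q q' : ℕ} [NeZero q] [NeZero q'] {ι ι' κ κ' : Type} [Fintype ι]
    [Fintype ι'] [Fintype κ] [Fintype κ'] [DecidableEq ι] [DecidableEq ι'] [DecidableEq κ]
    [DecidableEq κ'] {f : Matrix ι ι' (ZMod q) → Matrix κ κ' (ZMod q')}
    (hf : Function.Bijective f) : (uniformMat q ι ι').map f = uniformMat q' κ κ' := by
  rw [uniformMat, uniformMat, PMF.map_comp,
    ← uniform_map_bijective (Matrix.of.symm.bijective.comp (hf.comp Matrix.of.bijective)),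
    PMF.map_comp]
  rfl

theorem indep_uniform (n : ℕ) (α : Type) [Fintype α] [Nonempty α] :
    indep n (fun _ => PMF.uniformOfFintype α) = PMF.uniformOfFintype (Fin n → α) := by
  rw [← indepPi_fin, indepPi_uniform]

theorem uniformMat_map_castLE {q : ℕ} [NeZero q] {m n k : ℕ} (h : m ≤ n) :
    (uniformMat q (Fin n) (Fin k)).map (fun X => X.submatrix (Fin.castLE h) id) =
      uniformMat q (Fin m) (Fin k) := by
  rw [uniformMat, uniformMat, ← indep_uniform n (Fin k → ZMod q),
    ← indep_uniform m (Fin k → ZMod q), PMF.map_comp,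
    ← indep_castLE h, PMF.map_comp]
  rfl

theorem lweVec_map_castLE {q : ℕ} [NeZero q] {m n k : ℕ} (h : m ≤ n) (μ : PMF ℤ)
    (X : Matrix (Fin n) (Fin k) (ZMod q)) :
    (lweVec μ X).map (fun u i => u (Fin.castLE h i)) =
      lweVec μ (X.submatrix (Fin.castLE h) id) := by
  rw [lweVec, lweVec, PMF.map_bind]
  congr 1
  funext s
  rw [PMF.map_comp, noiseVec_eq, noiseVec_eq, indepPi_fin, indepPi_fin, ← indep_castLE h,
    PMF.map_comp]
  rfl

section

variable {K M L R : ℕ}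
  (A₀ : Matrix (Fin K × Fin R) (Fin M) (ZMod 2) ×
    Matrix (Fin K × Fin R) (((Fin M × Fin L) × Fin K) × Fin R) (ZMod 2) →
      PMF ((Fin L → ZMod (2 ^ R)) × Data))
  (A₁ : Matrix (Fin M) (Fin M × Fin L) (ZMod (2 ^ R)) → Data → PMF Bool)

/-- The output of the adversary `(A₀, A₁)` when it is given an encoding drawn by `F`. -/
def game (F : Matrix (Fin K × Fin R) (Fin M) (ZMod 2) →
    Matrix (Fin K × Fin R) (((Fin M × Fin L) × Fin K) × Fin R) (ZMod 2) →
      (Fin L → ZMod (2 ^ R)) → PMF (Matrix (Fin M) (Fin M × Fin L) (ZMod (2 ^ R)))) : PMF Bool :=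
  (uniformMat 2 (Fin K × Fin R) (Fin M)).bind fun A =>
    (uniformMat 2 (Fin K × Fin R) (((Fin M × Fin L) × Fin K) × Fin R)).bind fun B =>
      (A₀ (A, B)).bind fun w => (F A B w.1).bind fun C => A₁ C w.2

/-- The LWE adversary that uses its samples as the entries of `B (I ⊗ s ⊗ gᵀ) + E'`. -/
def reduceB (μ : PMF ℤ) (X : Matrix (Fin (K * R * (M * L))) (Fin K) (ZMod (2 ^ R)))
    (u : Fin (K * R * (M * L)) → ZMod (2 ^ R)) : PMF Bool :=
  (uniformMat 2 (Fin K × Fin R) (Fin M)).bind fun A => (A₀ (A, binB X)).bind fun w =>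
    (encOf μ A w.1 u).bind fun C => A₁ C w.2

/-- The LWE adversary that uses its samples in column `j` of the encoding. -/
def reduceA (μ : PMF ℤ) (j : ℕ) (X : Matrix (Fin M) (Fin K) (ZMod (2 ^ R)))
    (u : Fin M → ZMod (2 ^ R)) : PMF Bool :=
  (uniformMat 2 (Fin K × Fin R) (((Fin M × Fin L) × Fin K) × Fin R)).bind fun B =>
    (A₀ (binA X, B)).bind fun w =>
      (ofCols (chalCol μ j (binA X) w.1 u)).bind fun C => A₁ C w.2

/-- The LWE adversary that uses the first `M` of its samples in a random column of the encoding. -/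
def reduceHyb (μ : PMF ℤ) (h : M ≤ K * R * (M * L))
    (X : Matrix (Fin (K * R * (M * L))) (Fin K) (ZMod (2 ^ R)))
    (u : Fin (K * R * (M * L)) → ZMod (2 ^ R)) : PMF Bool :=
  (hybridIndex (M * L)).bind fun j =>
    if decide (j < M * L) = true then
      reduceA A₀ A₁ μ j (X.submatrix (Fin.castLE h) id) fun i => u (Fin.castLE h i)
    else PMF.uniformOfFintype Bool

/-- `reduceB`, run on a uniform `X` and `u` drawn from `T X`, plays the game in which the encoding
is built from `T X`: since `binB` is a bijection, the public matrix `B` has the right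
distribution. -/
theorem bind_reduceB (μ : PMF ℤ)
    (T : Matrix (Fin (K * R * (M * L))) (Fin K) (ZMod (2 ^ R)) →
      PMF (Fin (K * R * (M * L)) → ZMod (2 ^ R)))
    {F : Matrix (Fin K × Fin R) (Fin M) (ZMod 2) →
      Matrix (Fin K × Fin R) (((Fin M × Fin L) × Fin K) × Fin R) (ZMod 2) →
      (Fin L → ZMod (2 ^ R)) → PMF (Matrix (Fin M) (Fin M × Fin L) (ZMod (2 ^ R)))}
    (hF : ∀ A X y, F A (binB X) y = (T X).bind (encOf μ A y)) :
    ((uniformMat (2 ^ R) (Fin (K * R * (M * L))) (Fin K)).bind fun X =>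
      (T X).bind (reduceB A₀ A₁ μ X)) = game A₀ A₁ F := by
  simp only [game, ← uniformMat_map_bijective (binB_bijective (K := K) (M := M) (L := L) (R := R)),
    PMF.bind_map, Function.comp_def, hF, PMF.bind_bind]
  rw [PMF.bind_comm]
  congr 1
  funext X
  delta reduceB
  rw [PMF.bind_comm]
  congr 1
  funext A
  rw [PMF.bind_comm]

/-- `reduceA`, run on a uniform `X` and `u` drawn from `T X`, plays the game in which the challenge
is drawn from `T X`: since `binA` is a bijection, the public matrix `A` has the right
distribution. -/
theorem bind_reduceA (μ : PMF ℤ) (j : ℕ)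
    (T : Matrix (Fin M) (Fin K) (ZMod (2 ^ R)) → PMF (Fin M → ZMod (2 ^ R)))
    {F : Matrix (Fin K × Fin R) (Fin M) (ZMod 2) →
      (Fin L → ZMod (2 ^ R)) → PMF (Matrix (Fin M) (Fin M × Fin L) (ZMod (2 ^ R)))}
    (hF : ∀ X y, F (binA X) y = (T X).bind fun u => ofCols (chalCol μ j (binA X) y u)) :
    ((uniformMat (2 ^ R) (Fin M) (Fin K)).bind fun X => (T X).bind (reduceA A₀ A₁ μ j X)) =
      game A₀ A₁ fun A _ y => F A y := by
  simp only [game, ← uniformMat_map_bijective (binA_bijective (K := K) (M := M) (R := R)),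
    PMF.bind_map, Function.comp_def, hF, PMF.bind_bind]
  congr 1
  funext X
  delta reduceA
  rw [PMF.bind_comm]
  congr 1
  funext B
  rw [PMF.bind_comm]

/-- The probability that the adversary outputs `true` in the `j`-th hybrid. -/
def hybProb (μ : PMF ℤ) (j : ℕ) : ℝ := prTrue (game A₀ A₁ fun A _ y => ofCols (hybCol μ j A y))

/-- The acceptance probability of `reduceHyb` is an average over the hybrids. The distribution `T`
of the challenge is that of LWE samples, with `d = 0`, or uniform, with `d = 1`. -/
theorem prTrue_bind_reduceHyb (μ : PMF ℤ) (h : M ≤ K * R * (M * L))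
    (T : ∀ n, Matrix (Fin n) (Fin K) (ZMod (2 ^ R)) → PMF (Fin n → ZMod (2 ^ R)))
    (hT : ∀ X, (T (K * R * (M * L)) X).map (fun u i => u (Fin.castLE h i)) =
      T M (X.submatrix (Fin.castLE h) id)) (d : ℕ)
    (hd : ∀ X (y : Fin L → ZMod (2 ^ R)) (c : Fin M × Fin L), ((T M X).bind fun u =>
      ofCols (chalCol μ (finProdFinEquiv c) (binA X) y u)) =
        ofCols (hybCol μ (finProdFinEquiv c + d) (binA X) y))
    {W : ℕ} [NeZero W] (hW : hybridIndex (M * L) =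
      (PMF.uniformOfFintype (Fin W)).map fun j : Fin W => (j : ℕ)) :
    prTrue ((uniformMat (2 ^ R) (Fin (K * R * (M * L))) (Fin K)).bind fun X =>
      (T _ X).bind (reduceHyb A₀ A₁ μ h X)) =
      (∑ j ∈ Finset.range W, if j < M * L then hybProb A₀ A₁ μ (j + d) else 1 / 2) / W := by
  -- Only the first `M` samples are used, and they are LWE samples or uniform themselves.
  have hmarg : ∀ G : Matrix (Fin M) (Fin K) (ZMod (2 ^ R)) → (Fin M → ZMod (2 ^ R)) → PMF Bool,
      ((uniformMat (2 ^ R) (Fin (K * R * (M * L))) (Fin K)).bind fun X => (T _ X).bind fun u =>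
        G (X.submatrix (Fin.castLE h) id) fun i => u (Fin.castLE h i)) =
      (uniformMat (2 ^ R) (Fin M) (Fin K)).bind fun X => (T M X).bind (G X) := by
    intro G
    rw [← uniformMat_map_castLE h, PMF.bind_map]
    congr 1
    funext X
    rw [Function.comp_apply, ← hT, PMF.bind_map]
    rfl
  have e : ((uniformMat (2 ^ R) (Fin (K * R * (M * L))) (Fin K)).bind fun X =>
      (T _ X).bind (reduceHyb A₀ A₁ μ h X)) = (hybridIndex (M * L)).bind fun j =>
        if j < M * L then game A₀ A₁ fun A _ y => ofCols (hybCol μ (j + d) A y)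
        else PMF.uniformOfFintype Bool := by
    rw [show (fun X => (T _ X).bind (reduceHyb A₀ A₁ μ h X)) = fun X =>
      (hybridIndex (M * L)).bind fun j => (T _ X).bind fun u => if j < M * L then
        reduceA A₀ A₁ μ j (X.submatrix (Fin.castLE h) id) (fun i => u (Fin.castLE h i))
        else PMF.uniformOfFintype Bool from funext fun X => by
          delta reduceHyb
          simp only [decide_eq_true_eq]
          rw [PMF.bind_comm], PMF.bind_comm]
    congr 1
    funext j
    split_ifs with hj
    · rw [hmarg]
      obtain ⟨c, hc⟩ := finProdFinEquiv.surjective (⟨j, hj⟩ : Fin (M * L))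
      have hc' : (finProdFinEquiv c : ℕ) = j := congrArg Fin.val hc
      refine bind_reduceA A₀ A₁ μ j (T M) (F := fun A y => ofCols (hybCol μ (j + d) A y)) ?_
      intro X y
      rw [← hc', hd]
    · simp only [PMF.bind_const]
  rw [e, hW, PMF.bind_map]
  refine (prTrue_uniform_bind _).trans ?_
  rw [Fintype.card_fin, Finset.sum_range]
  congr 1
  refine Finset.sum_congr rfl fun j _ => ?_
  simp only [Function.comp_apply]
  split_ifs
  · rfl
  · exact prTrue_uniform

/-- The hybrid argument: the advantage of `reduceHyb` is that of `(A₀, A₁)`, divided by the number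
of values of the random index. -/
theorem abs_hybProb_sub_le (μ : PMF ℤ) (h : M ≤ K * R * (M * L)) :
    |hybProb A₀ A₁ μ (M * L) - hybProb A₀ A₁ μ 0| ≤ (2 * (M * L) + 1 : ℕ) *
      |prTrue ((uniformMat (2 ^ R) (Fin (K * R * (M * L))) (Fin K)).bind fun X =>
        (PMF.uniformOfFintype _).bind (reduceHyb A₀ A₁ μ h X)) -
      prTrue ((uniformMat (2 ^ R) (Fin (K * R * (M * L))) (Fin K)).bind fun X =>
        (lweVec μ X).bind (reduceHyb A₀ A₁ μ h X))| := by
  obtain ⟨T, h1, h2, h3⟩ := exists_hybridIndex_eq (M * L)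
  rw [prTrue_bind_reduceHyb A₀ A₁ μ h (fun n _ => PMF.uniformOfFintype _) (fun _ => by
      rw [← indep_uniform, ← indep_uniform, indep_castLE]) 1
      (fun X y c => uniform_bind_chalCol μ (binA X) y c) h3,
    prTrue_bind_reduceHyb A₀ A₁ μ h (fun n => lweVec μ) (fun X => lweVec_map_castLE h μ X) 0
      (fun X y c => lweVec_bind_chalCol μ X y c) h3, ← sub_div, ← Finset.sum_sub_distrib]
  have hsum : ∑ j ∈ Finset.range (2 ^ T), ((if j < M * L then hybProb A₀ A₁ μ (j + 1) else 1 / 2) -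
      if j < M * L then hybProb A₀ A₁ μ (j + 0) else 1 / 2) =
      hybProb A₀ A₁ μ (M * L) - hybProb A₀ A₁ μ 0 := by
    rw [← Finset.sum_range_sub, ← Finset.sum_subset (Finset.range_mono h1)]
    · refine Finset.sum_congr rfl fun j hj => ?_
      rw [if_pos (Finset.mem_range.1 hj), if_pos (Finset.mem_range.1 hj), add_zero]
    · intro j _ hj
      have := mt Finset.mem_range.2 hj
      rw [if_neg this, if_neg this, sub_self]
  rw [hsum, abs_div]
  have hpos : (0 : ℝ) < (2 ^ T : ℕ) := by positivity
  rw [abs_of_pos hpos, mul_div_assoc', le_div_iff₀ hpos, mul_comm]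
  have : ((2 ^ T : ℕ) : ℝ) ≤ (2 * (M * L) + 1 : ℕ) := by exact_mod_cast h2
  gcongr

end

/-! ### Programs for uniform matrices and noise -/

section

variable {ι : Type} {inp : ι → Data}

theorem PPT.pi_fin {α : ι → Type} [∀ i, ToData (α i)] {n : ι → ℕ} (hn : PolyTime inp n)
    {μ : ∀ i, Fin (n i) → PMF (α i)}
    (hμ : PPT (ext inp fun i => Fin (n i)) fun p => μ p.1 p.2) :
    PPT inp fun i => indepPi (μ i) := by
  simp only [indepPi_fin]
  exact PPT.indep hn hμ

theorem PPT.pi_prod {κ ν α : ι → Type} [∀ i, Fintype (κ i)] [∀ i, Fintype (ν i)]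
    [∀ i, ToData (κ i → ν i → α i)] {μ : ∀ i, κ i × ν i → PMF (α i)}
    (h : PPT inp fun i => indepPi fun a => indepPi fun b => μ i (a, b)) :
    PPT inp fun i => indepPi (μ i) := by
  simp only [PPT, ← indepPi_prod, PMF.map_comp]
  exact h

/-- Functions on a product are represented like their curried forms. -/
theorem PolyTime.curry {κ ν α : ι → Type} [∀ i, ToData (κ i → ν i → α i)]
    {f : ∀ i, κ i × ν i → α i} (h : PolyTime inp f) :
    PolyTime inp fun i a b => f i (a, b) :=
  h

theorem PolyTime.uncurry {κ ν α : ι → Type} [∀ i, ToData (κ i → ν i → α i)]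
    {f : ∀ i, κ i × ν i → α i} (h : PolyTime inp fun i a b => f i (a, b)) : PolyTime inp f :=
  h

theorem PPT.uniform_zmod {r : ι → ℕ} (hr : PolyTime inp r) :
    PPT inp fun i => PMF.uniformOfFintype (ZMod (2 ^ r i)) := by
  have h := PPT.indep hr (μ := fun _ _ => PMF.uniformOfFintype Bool) PPT.coin
  simp only [indep_uniform, ← uniform_map_bijective (digits _).bijective, PPT, PMF.map_comp] at h
  have e : ∀ i, (toData : ZMod (2 ^ r i) → Data) = toData ∘ digits (r i) := fun i =>
    funext fun x => toData_zmod (clog_two_pow _) x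
  simp only [PPT, e]
  exact h

theorem PPT.uniform_zmod_two : PPT inp fun _ => PMF.uniformOfFintype (ZMod 2) := by
  have h := PPT.map (PPT.coin (inp := inp)) (f := fun _ b => (b.toNat : ZMod 2))
    (PolyTime.zmod_two PolyTime.var)
  simp only [uniform_map_bijective toNat_zmod_two_bijective] at h
  exact h

theorem uniformMat_eq {q : ℕ} [NeZero q] {κ ν : Type} [Fintype κ] [Fintype ν] [DecidableEq κ]
    [DecidableEq ν] : uniformMat q κ ν =
      (indepPi fun _ : κ => indepPi fun _ : ν => PMF.uniformOfFintype (ZMod q)).map Matrix.of := by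
  rw [indepPi_uniform, indepPi_uniform, uniformMat]

theorem PPT.matrix {κ ν α : ι → Type} [∀ i, ToData (κ i → ν i → α i)]
    {μ : ∀ i, PMF (κ i → ν i → α i)} (h : PPT inp μ) :
    PPT inp fun i => (μ i).map Matrix.of := by
  simp only [PPT, PMF.map_comp]
  exact h

variable {K M L R : ι → ℕ}

theorem PPT.uniformMat_enc (hM : PolyTime inp M) (hL : PolyTime inp L) (hR : PolyTime inp R) :
    PPT inp fun i => uniformMat (2 ^ R i) (Fin (M i)) (Fin (M i) × Fin (L i)) := by
  simp only [uniformMat_eq]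
  exact .matrix (.pi_fin hM (.pi_prod (.pi_fin hM.weaken (.pi_fin hL.weaken.weaken
    (PPT.uniform_zmod hR).weaken.weaken.weaken))))

theorem PPT.uniformMat_pubA (hK : PolyTime inp K) (hM : PolyTime inp M) (hR : PolyTime inp R) :
    PPT inp fun i => uniformMat 2 (Fin (K i) × Fin (R i)) (Fin (M i)) := by
  simp only [uniformMat_eq]
  exact .matrix (.pi_prod (.pi_fin hK (.pi_fin hR.weaken (.pi_fin hM.weaken.weaken
    PPT.uniform_zmod_two))))

theorem PPT.uniformMat_pubB (hK : PolyTime inp K) (hM : PolyTime inp M) (hL : PolyTime inp L)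
    (hR : PolyTime inp R) : PPT inp fun i => uniformMat 2 (Fin (K i) × Fin (R i))
      (((Fin (M i) × Fin (L i)) × Fin (K i)) × Fin (R i)) := by
  simp only [uniformMat_eq]
  refine .matrix (.pi_prod (.pi_fin hK (.pi_fin hR.weaken ?_)))
  have hK := hK.weaken (α := fun i => Fin (K i)) |>.weaken (α := fun p => Fin (R p.1))
  have hM := hM.weaken (α := fun i => Fin (K i)) |>.weaken (α := fun p => Fin (R p.1))
  have hL := hL.weaken (α := fun i => Fin (K i)) |>.weaken (α := fun p => Fin (R p.1))
  have hR := hR.weaken (α := fun i => Fin (K i)) |>.weaken (α := fun p => Fin (R p.1))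
  exact .pi_prod (.pi_prod (.pi_prod (.pi_fin hM (.pi_fin hL.weaken (.pi_fin hK.weaken.weaken
    (.pi_fin hR.weaken.weaken.weaken PPT.uniform_zmod_two))))))

theorem PPT.noise {μ : ι → PMF ℤ} (hμ : PPT inp μ) (hR : PolyTime inp R) :
    PPT inp fun i => (μ i).map fun z : ℤ => (z : ZMod (2 ^ R i)) :=
  PPT.map hμ (PolyTime.zmod_intCast hR.weaken PolyTime.var)

theorem PPT.noiseVec_fin {μ : ι → PMF ℤ} (hμ : PPT inp μ) (hM : PolyTime inp M)
    (hR : PolyTime inp R) : PPT inp fun i => noiseVec (2 ^ R i) (Fin (M i)) (μ i) := by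
  simp only [noiseVec_eq]
  exact .pi_fin hM (PPT.noise hμ hR).weaken

theorem PPT.noiseMat_enc {μ : ι → PMF ℤ} (hμ : PPT inp μ) (hM : PolyTime inp M)
    (hL : PolyTime inp L) (hR : PolyTime inp R) :
    PPT inp fun i => noiseMat (2 ^ R i) (Fin (M i)) (Fin (M i) × Fin (L i)) (μ i) := by
  have h : PPT inp fun i => indepPi fun _ : Fin (M i) × (Fin (M i) × Fin (L i)) =>
      (μ i).map fun z : ℤ => (z : ZMod (2 ^ R i)) :=
    .pi_prod (.pi_fin hM (.pi_prod (.pi_fin hM.weaken (.pi_fin hL.weaken.weaken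
      (PPT.noise hμ hR).weaken.weaken.weaken))))
  simp only [PPT, noiseMat_eq, PMF.map_comp]
  exact h

/-! ### Programs for encodings -/

theorem PolyTime.lift_transpose_mulVec (hK : PolyTime inp K) (hR : PolyTime inp R)
    {A : ∀ i, Matrix (Fin (K i) × Fin (R i)) (Fin (M i)) (ZMod 2)} (hA : PolyTime inp A)
    {v : ∀ i, Fin (K i) × Fin (R i) → ZMod (2 ^ R i)} (hv : PolyTime inp v)
    {j : ∀ i, Fin (M i)} (hj : PolyTime inp j) :
    PolyTime inp fun i => ((lift (2 ^ R i) (A i))ᵀ *ᵥ v i) (j i) := by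
  have e : ∀ i, ((lift (2 ^ R i) (A i))ᵀ *ᵥ v i) (j i) =
      ∑ a, ∑ b, ((A i (a, b) (j i)).val : ZMod (2 ^ R i)) * v i (a, b) := by
    intro i
    rw [Matrix.mulVec, dotProduct, Fintype.sum_prod_type]
    rfl
  simp only [e]
  have hA' : PolyTime inp (α := fun i => Fin (K i) → Fin (R i) → Fin (M i) → ZMod 2)
    fun i a b j => A i (a, b) j := hA
  have hv' : PolyTime inp (α := fun i => Fin (K i) → Fin (R i) → ZMod (2 ^ R i))
    fun i a b => v i (a, b) := hv
  refine .sum hR hK (.sum hR.weaken hR.weaken (.bit_mul hR.weaken.weaken ?_ ?_))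
  · exact ((hA'.weaken.weaken.get (PolyTime.var.weaken)).get PolyTime.var).get hj.weaken.weaken
  · exact (hv'.weaken.weaken.get (PolyTime.var.weaken)).get PolyTime.var

theorem messageMat_apply {m ℓ q : ℕ} (y : Fin ℓ → ZMod q) (i c : Fin m) (d : Fin ℓ) :
    messageMat m ℓ q y i (c, d) = if decide ((i : ℕ) = c) = true then y d else 0 := by
  simp [messageMat, Matrix.one_apply, Fin.ext_iff]

theorem PolyTime.messageMat (hR : PolyTime inp R) {y : ∀ i, Fin (L i) → ZMod (2 ^ R i)}
    (hy : PolyTime inp y) {j c : ∀ i, Fin (M i)} (hj : PolyTime inp j) (hc : PolyTime inp c)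
    {d : ∀ i, Fin (L i)} (hd : PolyTime inp d) :
    PolyTime inp fun i => messageMat (M i) (L i) (2 ^ R i) (y i) (j i) (c i, d i) := by
  simp only [messageMat_apply]
  exact .cond (.eq hj hc) (hy.get hd) (.zmod_zero hR)

theorem PolyTime.finProd {m n : ι → ℕ} (hn : PolyTime inp n) {a : ∀ i, Fin (m i)}
    (ha : PolyTime inp a) {b : ∀ i, Fin (n i)} (hb : PolyTime inp b) :
    PolyTime inp fun i => finProdFinEquiv (a i, b i) :=
  PolyTime.add (a := fun i => b i) (b := fun i => n i * a i) hb (hn.mul ha)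

theorem PolyTime.rowIdx (hM : PolyTime inp M) (hL : PolyTime inp L) (hR : PolyTime inp R)
    {a : ∀ i, Fin (K i)} (ha : PolyTime inp a) {b : ∀ i, Fin (R i)} (hb : PolyTime inp b)
    {c : ∀ i, Fin (M i)} (hc : PolyTime inp c) {d : ∀ i, Fin (L i)} (hd : PolyTime inp d) :
    PolyTime inp fun i => rowIdx (K i) (M i) (L i) (R i) ((a i, b i), (c i, d i)) :=
  PolyTime.finProd (hM.mul hL) (PolyTime.finProd hR ha hb) (PolyTime.finProd hL hc hd)

theorem PolyTime.ctext (hK : PolyTime inp K) (hM : PolyTime inp M) (hL : PolyTime inp L)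
    (hR : PolyTime inp R) {A : ∀ i, Matrix (Fin (K i) × Fin (R i)) (Fin (M i)) (ZMod 2)}
    (hA : PolyTime inp A) {u : ∀ i, Fin (K i * R i * (M i * L i)) → ZMod (2 ^ R i)}
    (hu : PolyTime inp u) {E : ∀ i, Matrix (Fin (M i)) (Fin (M i) × Fin (L i)) (ZMod (2 ^ R i))}
    (hE : PolyTime inp E) {y : ∀ i, Fin (L i) → ZMod (2 ^ R i)} (hy : PolyTime inp y) :
    PolyTime inp fun i => ctext (A i) (u i) (E i) (y i) := by
  have e : ∀ i j c d, _root_.ctext (A i) (u i) (E i) (y i) j (c, d) =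
      ((lift (2 ^ R i) (A i))ᵀ *ᵥ fun a => u i (_root_.rowIdx (K i) (M i) (L i) (R i)
        (a, (c, d)))) j + E i j (c, d) +
        HalfSuccinct.messageMat (M i) (L i) (2 ^ R i) (y i) j (c, d) := fun _ _ _ _ => rfl
  have hE' : PolyTime inp (α := fun i => Fin (M i) → Fin (M i) × Fin (L i) → ZMod (2 ^ R i))
    fun i j => E i j := hE
  suffices h : PolyTime inp (α := fun i => Fin (M i) → Fin (M i) × Fin (L i) → ZMod (2 ^ R i))
    fun i => _root_.ctext (A i) (u i) (E i) (y i) from h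
  refine .vec hM (.uncurry (.vec hM.weaken (.vec hL.weaken.weaken ?_)))
  simp only [e]
  have hj : PolyTime (ext (ext (ext inp fun i => Fin (M i)) fun p => Fin (M p.1))
    fun p => Fin (L p.1.1)) fun p => p.1.1.2 := PolyTime.var.weaken.weaken
  have hc : PolyTime (ext (ext (ext inp fun i => Fin (M i)) fun p => Fin (M p.1))
    fun p => Fin (L p.1.1)) fun p => p.1.2 := PolyTime.var.weaken
  have hR' := hR.weaken.weaken.weaken (α := fun p : Σ p : Σ i, Fin (M i), Fin (M p.1) =>
    Fin (L p.1.1))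
  refine .zmod_add hR' (.zmod_add hR' ?_ ?_) ?_
  · refine .lift_transpose_mulVec hK.weaken.weaken.weaken hR' hA.weaken.weaken.weaken ?_ hj
    refine PolyTime.vec hK.weaken.weaken.weaken (PolyTime.vec hR'.weaken ?_)
    exact hu.weaken.weaken.weaken.weaken.weaken.get
      (.rowIdx hM.weaken.weaken.weaken.weaken.weaken hL.weaken.weaken.weaken.weaken.weaken
        hR'.weaken.weaken PolyTime.var.weaken PolyTime.var hc.weaken.weaken
        PolyTime.var.weaken.weaken)
  · exact ((hE'.weaken.weaken.weaken.get hj).curry.get hc).get PolyTime.var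
  · exact .messageMat hR' hy.weaken.weaken.weaken hj hc PolyTime.var

theorem PPT.encOf (hK : PolyTime inp K) (hM : PolyTime inp M) (hL : PolyTime inp L)
    (hR : PolyTime inp R) {μ : ι → PMF ℤ} (hμ : PPT inp μ)
    {A : ∀ i, Matrix (Fin (K i) × Fin (R i)) (Fin (M i)) (ZMod 2)}
    (hA : PolyTime inp A) {y : ∀ i, Fin (L i) → ZMod (2 ^ R i)} (hy : PolyTime inp y)
    {u : ∀ i, Fin (K i * R i * (M i * L i)) → ZMod (2 ^ R i)} (hu : PolyTime inp u) :
    PPT inp fun i => encOf (μ i) (A i) (y i) (u i) :=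
  PPT.map (PPT.noiseMat_enc hμ hM hL hR) (PolyTime.ctext hK.weaken hM.weaken hL.weaken hR.weaken
    hA.weaken hu.weaken PolyTime.var hy.weaken)

theorem PPT.encCol (hK : PolyTime inp K) (hM : PolyTime inp M) (hR : PolyTime inp R)
    {A : ∀ i, Matrix (Fin (K i) × Fin (R i)) (Fin (M i)) (ZMod 2)}
    (hA : PolyTime inp A) {ν : ∀ i, PMF (Fin (M i) → ZMod (2 ^ R i))} (hν : PPT inp ν)
    {t : ∀ i, Fin (M i) → ZMod (2 ^ R i)} (ht : PolyTime inp t) :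
    PPT inp fun i => encCol (A i) (ν i) (t i) := by
  have hunif : PPT inp fun i => PMF.uniformOfFintype (Fin (K i) × Fin (R i) → ZMod (2 ^ R i)) := by
    simp only [← indepPi_uniform]
    exact .pi_prod (.pi_fin hK (.pi_fin hR.weaken (PPT.uniform_zmod hR).weaken.weaken))
  refine .bind hunif (.map hν.weaken (.vec hM.weaken.weaken ?_))
  have hR' := hR.weaken (α := fun i => Fin (K i) × Fin (R i) → ZMod (2 ^ R i)) |>.weaken
    (α := fun p => Fin (M p.1) → ZMod (2 ^ R p.1)) |>.weaken (α := fun p => Fin (M p.1.1))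
  exact .zmod_add hR' (.zmod_add hR' (.lift_transpose_mulVec hK.weaken.weaken.weaken hR'
    hA.weaken.weaken.weaken PolyTime.var.weaken.weaken PolyTime.var)
    (PolyTime.var.weaken.get PolyTime.var)) (ht.weaken.weaken.weaken.get PolyTime.var)

theorem PPT.chalCol (hK : PolyTime inp K) (hM : PolyTime inp M) (hL : PolyTime inp L)
    (hR : PolyTime inp R) {μ : ι → PMF ℤ} (hμ : PPT inp μ) {j : ι → ℕ} (hj : PolyTime inp j)
    {A : ∀ i, Matrix (Fin (K i) × Fin (R i)) (Fin (M i)) (ZMod 2)}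
    (hA : PolyTime inp A) {y : ∀ i, Fin (L i) → ZMod (2 ^ R i)} (hy : PolyTime inp y)
    {u : ∀ i, Fin (M i) → ZMod (2 ^ R i)} (hu : PolyTime inp u)
    {c : ∀ i, Fin (M i)} (hc : PolyTime inp c) {d : ∀ i, Fin (L i)} (hd : PolyTime inp d) :
    PPT inp fun i => _root_.chalCol (μ i) (j i) (A i) (y i) (u i) (c i, d i) := by
  have hidx : PolyTime inp fun i => ((finProdFinEquiv (c i, d i) : Fin (M i * L i)) : ℕ) :=
    PolyTime.finProd hL hc hd
  have hunif : PPT inp fun i => PMF.uniformOfFintype (Fin (M i) → ZMod (2 ^ R i)) := by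
    simp only [← indepPi_uniform]
    exact .pi_fin hM (PPT.uniform_zmod hR).weaken
  have h := PPT.cond (hidx.lt hj) hunif (PPT.encCol hK hM hR hA
    (PPT.cond (hidx.eq hj) hu.ppt (PPT.noiseVec_fin hμ hM hR))
    (t := fun i x => HalfSuccinct.messageMat (M i) (L i) (2 ^ R i) (y i) x (c i, d i))
    (.vec hM (.messageMat hR.weaken hy.weaken PolyTime.var hc.weaken hd.weaken)))
  simp only [decide_eq_true_eq] at h
  exact h

theorem PPT.ofCols_chalCol (hK : PolyTime inp K) (hM : PolyTime inp M) (hL : PolyTime inp L)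
    (hR : PolyTime inp R) {μ : ι → PMF ℤ} (hμ : PPT inp μ) {j : ι → ℕ} (hj : PolyTime inp j)
    {A : ∀ i, Matrix (Fin (K i) × Fin (R i)) (Fin (M i)) (ZMod 2)}
    (hA : PolyTime inp A) {y : ∀ i, Fin (L i) → ZMod (2 ^ R i)} (hy : PolyTime inp y)
    {u : ∀ i, Fin (M i) → ZMod (2 ^ R i)} (hu : PolyTime inp u) :
    PPT inp fun i => ofCols (_root_.chalCol (μ i) (j i) (A i) (y i) (u i)) := by
  have hcols : PPT inp fun i => indepPi (_root_.chalCol (μ i) (j i) (A i) (y i) (u i)) :=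
    .pi_prod (.pi_fin hM (.pi_fin hL.weaken (.chalCol hK.weaken.weaken hM.weaken.weaken
      hL.weaken.weaken hR.weaken.weaken hμ.weaken.weaken hj.weaken.weaken hA.weaken.weaken
      hy.weaken.weaken hu.weaken.weaken PolyTime.var.weaken PolyTime.var)))
  refine .map hcols ?_
  have hC : PolyTime (ext inp fun i => Fin (M i) × Fin (L i) → Fin (M i) → ZMod (2 ^ R i))
    fun p c d => p.2 (c, d) := PolyTime.var.curry
  have h : PolyTime (ext inp fun i => Fin (M i) × Fin (L i) → Fin (M i) → ZMod (2 ^ R i))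
    (α := fun p => Fin (M p.1) → Fin (M p.1) × Fin (L p.1) → ZMod (2 ^ R p.1))
    fun p x c => p.2 c x :=
    .vec hM.weaken (.uncurry (.vec hM.weaken.weaken (.vec hL.weaken.weaken.weaken
      (((hC.weaken.weaken.weaken.get PolyTime.var.weaken).get PolyTime.var).get
        PolyTime.var.weaken.weaken))))
  exact h

end

/-! ### Programs for the reductions -/

section

variable {ι : Type} {inp : ι → Data} {K M L R : ι → ℕ}

theorem PolyTime.gadgetInv {x : ∀ i, ZMod (2 ^ R i)} (hx : PolyTime inp x) {j : ∀ i, Fin (R i)}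
    (hj : PolyTime inp j) : PolyTime inp fun i => gadgetInv (R i) (x i) (j i) :=
  .zmod_two (.testBit (fun _ => clog_two_pow _) hx (j := fun i => j i) hj fun i => (j i).2)

theorem PolyTime.binA (hK : PolyTime inp K) (hM : PolyTime inp M) (hR : PolyTime inp R)
    {X : ∀ i, Matrix (Fin (M i)) (Fin (K i)) (ZMod (2 ^ R i))} (hX : PolyTime inp X) :
    PolyTime inp fun i => binA (X i) := by
  have hX' : PolyTime inp (α := fun i => Fin (M i) → Fin (K i) → ZMod (2 ^ R i))
    fun i => X i := hX
  have h : PolyTime inp (α := fun i => Fin (K i) → Fin (R i) → Fin (M i) → ZMod 2)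
      fun i a b j => _root_.gadgetInv (R i) (X i j a) b :=
    .vec hK (.vec hR.weaken (.vec hM.weaken.weaken (.gadgetInv
      ((hX'.weaken.weaken.weaken.get PolyTime.var).get PolyTime.var.weaken.weaken)
      PolyTime.var.weaken)))
  exact h

theorem PolyTime.binB (hK : PolyTime inp K) (hM : PolyTime inp M) (hL : PolyTime inp L)
    (hR : PolyTime inp R)
    {X : ∀ i, Matrix (Fin (K i * R i * (M i * L i))) (Fin (K i)) (ZMod (2 ^ R i))}
    (hX : PolyTime inp X) : PolyTime inp fun i => binB (X i) := by
  have hX' : PolyTime inp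
    (α := fun i => Fin (K i * R i * (M i * L i)) → Fin (K i) → ZMod (2 ^ R i))
    fun i => X i := hX
  suffices h : PolyTime inp (α := fun i => Fin (K i) → Fin (R i) →
      ((Fin (M i) × Fin (L i)) × Fin (K i)) × Fin (R i) → ZMod 2)
      fun i a b => _root_.binB (X i) (a, b) from h
  refine .vec hK (.vec hR.weaken (.uncurry (.uncurry (.uncurry (.vec hM.weaken.weaken
    (.vec hL.weaken.weaken.weaken (.vec hK.weaken.weaken.weaken.weaken
      (.vec hR.weaken.weaken.weaken.weaken.weaken ?_))))))))
  exact .gadgetInv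
    ((hX'.weaken.weaken.weaken.weaken.weaken.weaken.get
      (.rowIdx hM.weaken.weaken.weaken.weaken.weaken.weaken
        hL.weaken.weaken.weaken.weaken.weaken.weaken hR.weaken.weaken.weaken.weaken.weaken.weaken
        PolyTime.var.weaken.weaken.weaken.weaken.weaken PolyTime.var.weaken.weaken.weaken.weaken
        PolyTime.var.weaken.weaken.weaken PolyTime.var.weaken.weaken)).get PolyTime.var.weaken)
    PolyTime.var

theorem PPT.hybridIndex {N : ι → ℕ} (hN : PolyTime inp N) :
    PPT inp fun i => hybridIndex (N i) := by
  obtain ⟨p, hp⟩ := hN.exists_le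
  have hs : PolyTime (ext (ext inp fun i => Fin (N i)) fun _ => ℕ × ℕ) fun q => q.2 :=
    PolyTime.var
  have hb : PolyTime (ext (ext (ext inp fun i => Fin (N i)) fun _ => ℕ × ℕ) fun _ => Bool)
      fun q => q.2.toNat := by
    have h := PolyTime.cond (PolyTime.var (inp := ext (ext inp fun i => Fin (N i)) fun _ => ℕ × ℕ)
      (α := fun _ => Bool)) (PolyTime.const 1) (PolyTime.const 0)
    convert h using 2 with q
    cases q.2 <;> rfl
  have hstep : PPT (ext (ext inp fun i => Fin (N i)) fun _ => ℕ × ℕ)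
      fun q => doubleStep (N q.1.1) q.2 := by
    have h := PPT.cond (hN.weaken.weaken.le hs.fst) hs.ppt (PPT.map PPT.coin
      (((hs.fst.add hs.fst).weaken).pair ((hs.snd.add hs.snd).weaken.add hb))
      (f := fun q b => (q.2.1 + q.2.1, q.2.2 + q.2.2 + b.toNat)))
    simp only [decide_eq_true_eq] at h
    exact h
  have h := PPT.loop hN (s₀ := fun _ => (1, 0)) (PolyTime.const (1, 0))
    (step := fun i _ => doubleStep (N i)) (fun i _ s => s.1 ≤ 2 * N i + 1 ∧ s.2 < s.1)
    (hstep.reindex Subtype.val) (fun i => ⟨by simp, by simp⟩)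
    (fun i j s _ hs s' hs' => by
      rw [doubleStep] at hs'
      split_ifs at hs' with hle
      · obtain rfl : s' = s := by simpa using hs'
        exact hs
      · rw [PMF.support_map] at hs'
        obtain ⟨b, -, rfl⟩ := hs'
        have := Bool.toNat_le b
        dsimp only
        omega)
    (16 * p + 11) (fun i j s _ hs => by
      have h1 := hp i
      have h2 : (toData s).size = (4 * s.1 + 1) + (4 * s.2 + 1) + 1 := by
        rw [← Data.size_toData_nat, ← Data.size_toData_nat]
        rfl
      simp only [Polynomial.eval_add, Polynomial.eval_mul, Polynomial.eval_ofNat]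
      omega)
  exact PPT.map h PolyTime.var.snd

end

section

variable {ι : Type} {inp : ι → Data} {k m ℓ r : ℕ → ℕ} {χ : ℕ → PMF ℤ} {lam : ι → ℕ}
  {A₀ : (lam : ℕ) → Matrix (Fin (k lam) × Fin (r lam)) (Fin (m lam)) (ZMod 2) ×
    Matrix (Fin (k lam) × Fin (r lam))
      (((Fin (m lam) × Fin (ℓ lam)) × Fin (k lam)) × Fin (r lam)) (ZMod 2) →
      PMF ((Fin (ℓ lam) → ZMod (2 ^ r lam)) × Data)}
  {A₁ : (lam : ℕ) → Matrix (Fin (m lam)) (Fin (m lam) × Fin (ℓ lam)) (ZMod (2 ^ r lam)) →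
    Data → PMF Bool}

theorem PolyTimeParam.polyTime {f : ℕ → ℕ} (hf : PolyTimeParam f) (hlam : PolyTime inp lam) :
    PolyTime inp fun i => f (lam i) :=
  IsPPT.comp (inp' := fun lam : ℕ => Data.unary lam) (π := lam) hlam hf

theorem EfficientlySamplable.ppt (hχ : EfficientlySamplable χ) (hlam : PolyTime inp lam) :
    PPT inp fun i => χ (lam i) :=
  IsPPT.comp (inp' := fun lam : ℕ => Data.unary lam) (π := lam) hlam hχ

/-- Running an algorithm that is given the security parameter. -/
theorem PPT.call {κ α : ℕ → Type} [∀ n, ToData (κ n)] [∀ n, ToData (α n)]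
    {F : ∀ n, κ n → PMF (α n)}
    (hF : PPT (fun p : (Σ n, κ n) => toData (Data.unary p.1, p.2)) fun p => F p.1 p.2)
    (hlam : PolyTime inp lam) {x : ∀ i, κ (lam i)} (hx : PolyTime inp x) :
    PPT inp fun i => F (lam i) (x i) :=
  IsPPT.comp (inp' := fun p : (Σ n, κ n) => toData (Data.unary p.1, p.2))
    (π := fun i => ⟨lam i, x i⟩) (IsPPT.pair hlam hx) hF

/-- Running an algorithm that is not given the security parameter. -/
theorem PPT.call₂ {κ ν α : ℕ → Type} [∀ n, ToData (κ n)] [∀ n, ToData (ν n)] [∀ n, ToData (α n)]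
    {F : ∀ n, κ n → ν n → PMF (α n)}
    (hF : PPT (fun p : (Σ n, κ n × ν n) => toData p.2) fun p => F p.1 p.2.1 p.2.2)
    {x : ∀ i, κ (lam i)} (hx : PolyTime inp x) {y : ∀ i, ν (lam i)} (hy : PolyTime inp y) :
    PPT inp fun i => F (lam i) (x i) (y i) :=
  IsPPT.comp (inp' := fun p : (Σ n, κ n × ν n) => toData p.2)
    (π := fun i => ⟨lam i, x i, y i⟩) (IsPPT.pair hx hy) hF

theorem PolyTime.castLE {n n' : ι → ℕ} (hn : PolyTime inp n) (h : ∀ i, n i ≤ n' i)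
    {α : ι → Type} [∀ i, ToData (α i)] {v : ∀ i, Fin (n' i) → α i} (hv : PolyTime inp v) :
    PolyTime inp fun i (j : Fin (n i)) => v i (Fin.castLE (h i) j) :=
  .vec hn (PolyTime.get (v := fun p => v p.1) hv.weaken
    (j := fun p : Σ i, Fin (n i) => Fin.castLE (h p.1) p.2) PolyTime.var)

theorem PPT.reduceB (hk : PolyTimeParam k) (hm : PolyTimeParam m) (hℓ : PolyTimeParam ℓ)
    (hr : PolyTimeParam r) (hχ : EfficientlySamplable χ) (hlam : PolyTime inp lam)
    (hA₀ : PPT (fun p : (Σ lam, Matrix (Fin (k lam) × Fin (r lam)) (Fin (m lam)) (ZMod 2) ×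
      Matrix (Fin (k lam) × Fin (r lam))
        (((Fin (m lam) × Fin (ℓ lam)) × Fin (k lam)) × Fin (r lam)) (ZMod 2)) =>
      toData (Data.unary p.1, p.2)) fun p => A₀ p.1 p.2)
    (hA₁ : PPT (fun p : (Σ lam, Matrix (Fin (m lam)) (Fin (m lam) × Fin (ℓ lam))
      (ZMod (2 ^ r lam)) × Data) => toData p.2) fun p => A₁ p.1 p.2.1 p.2.2)
    {X : ∀ i, Matrix (Fin (k (lam i) * r (lam i) * (m (lam i) * ℓ (lam i)))) (Fin (k (lam i)))
      (ZMod (2 ^ r (lam i)))} (hX : PolyTime inp X)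
    {u : ∀ i, Fin (k (lam i) * r (lam i) * (m (lam i) * ℓ (lam i))) → ZMod (2 ^ r (lam i))}
    (hu : PolyTime inp u) :
    PPT inp fun i => reduceB (A₀ (lam i)) (A₁ (lam i)) (χ (lam i)) (X i) (u i) := by
  have hK := hk.polyTime hlam
  have hM := hm.polyTime hlam
  have hL := hℓ.polyTime hlam
  have hR := hr.polyTime hlam
  refine PPT.bind (PPT.uniformMat_pubA hK hM hR) (PPT.bind (PPT.call hA₀ hlam.weaken
    (PolyTime.var.pair (PolyTime.binB hK hM hL hR hX).weaken)) (PPT.bind ?_ ?_))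
  · exact PPT.encOf hK.weaken.weaken hM.weaken.weaken hL.weaken.weaken hR.weaken.weaken
      (hχ.ppt hlam).weaken.weaken PolyTime.var.weaken PolyTime.var.fst hu.weaken.weaken
  · exact PPT.call₂ hA₁ PolyTime.var PolyTime.var.weaken.snd

theorem PPT.reduceHyb (hk : PolyTimeParam k) (hm : PolyTimeParam m) (hℓ : PolyTimeParam ℓ)
    (hr : PolyTimeParam r) (hχ : EfficientlySamplable χ) (hlam : PolyTime inp lam)
    (hA₀ : PPT (fun p : (Σ lam, Matrix (Fin (k lam) × Fin (r lam)) (Fin (m lam)) (ZMod 2) ×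
      Matrix (Fin (k lam) × Fin (r lam))
        (((Fin (m lam) × Fin (ℓ lam)) × Fin (k lam)) × Fin (r lam)) (ZMod 2)) =>
      toData (Data.unary p.1, p.2)) fun p => A₀ p.1 p.2)
    (hA₁ : PPT (fun p : (Σ lam, Matrix (Fin (m lam)) (Fin (m lam) × Fin (ℓ lam))
      (ZMod (2 ^ r lam)) × Data) => toData p.2) fun p => A₁ p.1 p.2.1 p.2.2)
    (h : ∀ i, m (lam i) ≤ k (lam i) * r (lam i) * (m (lam i) * ℓ (lam i)))
    {X : ∀ i, Matrix (Fin (k (lam i) * r (lam i) * (m (lam i) * ℓ (lam i)))) (Fin (k (lam i)))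
      (ZMod (2 ^ r (lam i)))} (hX : PolyTime inp X)
    {u : ∀ i, Fin (k (lam i) * r (lam i) * (m (lam i) * ℓ (lam i))) → ZMod (2 ^ r (lam i))}
    (hu : PolyTime inp u) :
    PPT inp fun i => reduceHyb (A₀ (lam i)) (A₁ (lam i)) (χ (lam i)) (h i) (X i) (u i) := by
  have hK := hk.polyTime hlam
  have hM := hm.polyTime hlam
  have hL := hℓ.polyTime hlam
  have hR := hr.polyTime hlam
  have hXm : PolyTime inp (α := fun i => Matrix (Fin (m (lam i))) (Fin (k (lam i)))
      (ZMod (2 ^ r (lam i)))) fun i => (X i).submatrix (Fin.castLE (h i)) id := by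
    have hrow := PolyTime.castLE hM h (v := fun i a b => X i a b) hX
    exact hrow
  have hum := PolyTime.castLE hM h hu
  have hA := PolyTime.binA hK hM hR hXm
  have hstep : PPT (ext inp fun _ => ℕ) fun p =>
      _root_.reduceA (A₀ (lam p.1)) (A₁ (lam p.1)) (χ (lam p.1)) p.2
        ((X p.1).submatrix (Fin.castLE (h p.1)) id) fun j => u p.1 (Fin.castLE (h p.1) j) := by
    refine PPT.bind (PPT.uniformMat_pubB hK hM hL hR).weaken (PPT.bind (PPT.call hA₀
      hlam.weaken.weaken (hA.weaken.weaken.pair PolyTime.var)) (PPT.bind ?_ ?_))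
    · exact PPT.ofCols_chalCol hK.weaken.weaken.weaken hM.weaken.weaken.weaken
        hL.weaken.weaken.weaken hR.weaken.weaken.weaken (hχ.ppt hlam).weaken.weaken.weaken
        PolyTime.var.weaken.weaken hA.weaken.weaken.weaken PolyTime.var.fst
        hum.weaken.weaken.weaken
    · exact PPT.call₂ hA₁ PolyTime.var PolyTime.var.weaken.snd
  exact PPT.bind (PPT.hybridIndex (hM.mul hL)) (PPT.cond
    (PolyTime.var.lt (hM.mul hL).weaken) hstep PPT.coin)

end

/-! ### The experiments and the theorem -/

/-- The advantage in the LWE experiment is half of the difference between the acceptance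
probabilities on uniform vectors and on LWE samples. -/
theorem abs_lweExp_sub (χ : ℕ → PMF ℤ) (k m q : ℕ → ℕ) [∀ lam, NeZero (q lam)]
    (A : (lam : ℕ) → Matrix (Fin (m lam)) (Fin (k lam)) (ZMod (q lam)) →
      (Fin (m lam) → ZMod (q lam)) → PMF Bool) (lam : ℕ) :
    |(lweExp χ k m q A lam true).toReal - 1 / 2| =
      |prTrue ((uniformMat (q lam) (Fin (m lam)) (Fin (k lam))).bind fun X =>
        (PMF.uniformOfFintype _).bind (A lam X)) -
      prTrue ((uniformMat (q lam) (Fin (m lam)) (Fin (k lam))).bind fun X =>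
        (lweVec (χ lam) X).bind (A lam X))| / 2 := by
  have e : lweExp χ k m q A lam = (PMF.uniformOfFintype Bool).bind fun b =>
      ((uniformMat (q lam) (Fin (m lam)) (Fin (k lam))).bind fun X =>
        (if b then PMF.uniformOfFintype _ else lweVec (χ lam) X).bind (A lam X)).bind fun b' =>
          PMF.pure (b' == b) := by
    show (PMF.bind _ fun b => PMF.bind _ fun s => PMF.bind _ fun X => PMF.bind _ fun e =>
      PMF.bind _ fun u₁ => PMF.bind _ fun b' => PMF.pure _) = _
    congr 1
    funext b
    rw [PMF.bind_comm, PMF.bind_bind]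
    congr 1
    funext X
    cases b
    · simp [lweVec, PMF.bind_bind, PMF.bind_map, Function.comp_def]
    · simp
  have h := prTrue_guess fun b => (uniformMat (q lam) (Fin (m lam)) (Fin (k lam))).bind fun X =>
    (if b then PMF.uniformOfFintype _ else lweVec (χ lam) X).bind (A lam X)
  rw [← e] at h
  rw [show (lweExp χ k m q A lam true).toReal = prTrue (lweExp χ k m q A lam) from rfl, h,
    add_sub_cancel_left, abs_div, abs_two]
  simp

section

variable {k m ℓ r : ℕ → ℕ} {χ : ℕ → PMF ℤ}

/-- The advantage in the privacy experiment is half of the difference between the acceptance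
probabilities on simulated and on real encodings. -/
theorem abs_encExp_sub
    (Sim : (lam : ℕ) → Matrix (Fin (k lam) × Fin (r lam)) (Fin (m lam)) (ZMod 2) ×
      Matrix (Fin (k lam) × Fin (r lam))
        (((Fin (m lam) × Fin (ℓ lam)) × Fin (k lam)) × Fin (r lam)) (ZMod 2) →
        PMF (Matrix (Fin (m lam)) (Fin (m lam) × Fin (ℓ lam)) (ZMod (2 ^ r lam))))
    (A₀ : (lam : ℕ) → Matrix (Fin (k lam) × Fin (r lam)) (Fin (m lam)) (ZMod 2) ×
      Matrix (Fin (k lam) × Fin (r lam))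
        (((Fin (m lam) × Fin (ℓ lam)) × Fin (k lam)) × Fin (r lam)) (ZMod 2) →
        PMF ((Fin (ℓ lam) → ZMod (2 ^ r lam)) × Data))
    (A₁ : (lam : ℕ) → Matrix (Fin (m lam)) (Fin (m lam) × Fin (ℓ lam)) (ZMod (2 ^ r lam)) →
      Data → PMF Bool) (lam : ℕ) :
    |1 / 2 - ((scheme χ k m ℓ r).encExp Sim A₀ A₁ lam true).toReal| =
      |prTrue (game (A₀ lam) (A₁ lam) fun A B _ => Sim lam (A, B)) -
        prTrue (game (A₀ lam) (A₁ lam) fun A B y => realEnc (χ lam) A B y)| / 2 := by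
  have e : (scheme χ k m ℓ r).encExp Sim A₀ A₁ lam =
      (PMF.uniformOfFintype Bool).bind fun b : Bool =>
        (game (A₀ lam) (A₁ lam) fun A B y => if b then Sim lam (A, B) else
          realEnc (χ lam) A B y).bind fun b' => PMF.pure (b' == b) := by
    have e₁ : (scheme χ k m ℓ r).encExp Sim A₀ A₁ lam =
        ((uniformMat 2 (Fin (k lam) × Fin (r lam)) (Fin (m lam))).bind fun A =>
          (uniformMat 2 (Fin (k lam) × Fin (r lam))
            (((Fin (m lam) × Fin (ℓ lam)) × Fin (k lam)) × Fin (r lam))).bind fun B =>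
              PMF.pure (A, B)).bind fun pk => (A₀ lam pk).bind fun w =>
        (PMF.uniformOfFintype Bool).bind fun b : Bool =>
          (if b then Sim lam pk else realEnc (χ lam) pk.1 pk.2 w.1).bind
            fun E => (A₁ lam E w.2).bind fun b' => PMF.pure (b' == b) := by
      unfold NIOTE.encExp
      refine congrArg _ (funext fun pk => congrArg _ (funext fun w => ?_))
      obtain ⟨y, aux⟩ := w
      refine congrArg (PMF.bind _) (funext fun b => ?_)
      cases b
      · exact congrArg (fun μ => PMF.bind μ _) (enc_map_fst χ k m ℓ r lam pk y)
      · rfl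
    rw [e₁]
    simp only [PMF.bind_bind, PMF.pure_bind, game]
    rw [PMF.bind_comm (PMF.uniformOfFintype Bool)]
    congr 1
    funext A
    rw [PMF.bind_comm (PMF.uniformOfFintype Bool)]
    congr 1
    funext B
    rw [PMF.bind_comm (PMF.uniformOfFintype Bool)]
  have h := prTrue_guess fun b => game (A₀ lam) (A₁ lam) fun A B y =>
    if b then Sim lam (A, B) else realEnc (χ lam) A B y
  rw [← e] at h
  rw [abs_sub_comm, show ((scheme χ k m ℓ r).encExp Sim A₀ A₁ lam true).toReal =
    prTrue ((scheme χ k m ℓ r).encExp Sim A₀ A₁ lam) from rfl, h,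
    add_sub_cancel_left, abs_div, abs_two]
  simp

theorem PMF.eq_of_subsingleton {α : Type*} [Subsingleton α] (μ ν : PMF α) : μ = ν := by
  obtain ⟨a, -⟩ := ν.support_nonempty
  have h : ∀ ρ : PMF α, ρ = PMF.pure a := fun ρ => by
    rw [← PMF.bind_pure ρ, show (PMF.pure : α → PMF α) = fun _ => PMF.pure a from
      funext fun b => congrArg _ (Subsingleton.elim b a), PMF.bind_const]
  rw [h μ, h ν]

/-- Parameters are polynomially bounded, since their unary representation is written out. -/
theorem PolyTimeParam.exists_le {f : ℕ → ℕ} (hf : PolyTimeParam f) :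
    ∃ p : Polynomial ℕ, ∀ n, f n ≤ p.eval n := by
  obtain ⟨p, hp⟩ := IsPPT.exists_size_le hf
  refine ⟨p.comp (4 * Polynomial.X + 1), fun n => ?_⟩
  have h := hp n
  rw [Data.size_unary, Data.size_unary] at h
  simp only [Polynomial.eval_comp, Polynomial.eval_add, Polynomial.eval_mul,
    Polynomial.eval_ofNat, Polynomial.eval_X, Polynomial.eval_one]
  omega

theorem Negligible.add {f g : ℕ → ℝ} (hf : Negligible f) (hg : Negligible g) :
    Negligible fun n => f n + g n :=
  ⟨fun n => add_nonneg (hf.1 n) (hg.1 n), hf.2.add hg.2⟩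

theorem Negligible.mul_of_le {f : ℕ → ℝ} (hf : Negligible f) {c : ℕ → ℕ} {p : Polynomial ℕ}
    (hc : ∀ n, c n ≤ p.eval n) : Negligible fun n => c n * f n := by
  refine ⟨fun n => mul_nonneg (Nat.cast_nonneg _) (hf.1 n), ?_⟩
  refine (hf.2.polynomial_mul (p.map (Nat.castRingHom ℝ))).trans_abs_le fun n => ?_
  have e : (p.map (Nat.castRingHom ℝ)).eval (n : ℝ) = (p.eval n : ℕ) := by
    simp [Polynomial.eval_map, Polynomial.eval₂_at_natCast]
  rw [e, abs_mul, abs_mul, Nat.abs_cast, Nat.abs_cast]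
  have : (c n : ℝ) ≤ (p.eval n : ℕ) := by exact_mod_cast hc n
  gcongr

/-- Finitely many values do not affect negligibility. -/
theorem Negligible.ite_of_eventually {f : ℕ → ℝ} (hf : Negligible f) {P : ℕ → Prop}
    [DecidablePred P] (hP : ∀ᶠ n in Filter.atTop, P n) :
    Negligible fun n => if P n then f n else 1 := by
  refine ⟨fun n => ?_, hf.2.congr' ?_⟩
  · dsimp only
    split_ifs
    · exact hf.1 n
    · exact zero_le_one
  · filter_upwards [hP] with n hn
    rw [if_pos hn]

/-- The advantage against uniform encodings is negligible: it is at most that of `reduceB`, plus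
`2 m ℓ + 1` times that of `reduceHyb`, as soon as `k` is positive. -/
theorem exists_negligible_advantage (hk : PolyTimeParam k) (hm : PolyTimeParam m)
    (hℓ : PolyTimeParam ℓ) (hr : PolyTimeParam r) (hk_pos : ∀ᶠ lam in Filter.atTop, 0 < k lam)
    (hχ : EfficientlySamplable χ)
    (hLWE : LWEHard χ k (fun lam => k lam * r lam * (m lam * ℓ lam)) fun lam => 2 ^ r lam)
    {A₀ : (lam : ℕ) → Matrix (Fin (k lam) × Fin (r lam)) (Fin (m lam)) (ZMod 2) ×
      Matrix (Fin (k lam) × Fin (r lam))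
        (((Fin (m lam) × Fin (ℓ lam)) × Fin (k lam)) × Fin (r lam)) (ZMod 2) →
        PMF ((Fin (ℓ lam) → ZMod (2 ^ r lam)) × Data)}
    {A₁ : (lam : ℕ) → Matrix (Fin (m lam)) (Fin (m lam) × Fin (ℓ lam)) (ZMod (2 ^ r lam)) →
      Data → PMF Bool}
    (hA₀ : PPT (fun p : (Σ lam, Matrix (Fin (k lam) × Fin (r lam)) (Fin (m lam)) (ZMod 2) ×
      Matrix (Fin (k lam) × Fin (r lam))
        (((Fin (m lam) × Fin (ℓ lam)) × Fin (k lam)) × Fin (r lam)) (ZMod 2)) =>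
      toData (Data.unary p.1, p.2)) fun p => A₀ p.1 p.2)
    (hA₁ : PPT (fun p : (Σ lam, Matrix (Fin (m lam)) (Fin (m lam) × Fin (ℓ lam))
      (ZMod (2 ^ r lam)) × Data) => toData p.2) fun p => A₁ p.1 p.2.1 p.2.2) :
    ∃ negl : ℕ → ℝ, Negligible negl ∧ ∀ lam,
      |prTrue (game (A₀ lam) (A₁ lam) fun _ _ _ =>
          uniformMat (2 ^ r lam) (Fin (m lam)) (Fin (m lam) × Fin (ℓ lam))) -
        prTrue (game (A₀ lam) (A₁ lam) fun A B y => realEnc (χ lam) A B y)| / 2 ≤ negl lam := by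
  classical
  let N : ℕ → ℕ := fun lam => k lam * r lam * (m lam * ℓ lam)
  let κ := Σ lam, Matrix (Fin (N lam)) (Fin (k lam)) (ZMod (2 ^ r lam)) ×
    (Fin (N lam) → ZMod (2 ^ r lam))
  let inp : κ → Data := fun i => toData (Data.unary i.1, i.2)
  have hlam : PolyTime inp fun i => i.1 := IsPPT.self.head
  have hX : PolyTime inp fun i => i.2.1 := IsPPT.self.tail.head
  have hu : PolyTime inp fun i => i.2.2 := IsPPT.self.tail.tail
  obtain ⟨negl₁, hnegl₁, h₁⟩ := hLWE (fun lam => reduceB (A₀ lam) (A₁ lam) (χ lam))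
    (PPT.reduceB hk hm hℓ hr hχ hlam hA₀ hA₁ hX hu)
  -- The second reduction needs `m lam` samples. If there are fewer, `k lam`, `r lam` or `ℓ lam`
  -- is zero.
  obtain ⟨negl₂, hnegl₂, h₂⟩ := hLWE (fun lam X u => if h : m lam ≤ N lam then
      reduceHyb (A₀ lam) (A₁ lam) (χ lam) h X u else PMF.uniformOfFintype Bool) (by
    have hb := (hm.polyTime hlam).le (((hk.polyTime hlam).mul (hr.polyTime hlam)).mul
      ((hm.polyTime hlam).mul (hℓ.polyTime hlam)))
    refine PPT.cond_of_subtype hb ?_ ?_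
    · have h : ∀ i : {i : κ // decide (m i.1 ≤ N i.1) = true}, m i.1.1 ≤ N i.1.1 := fun i =>
        of_decide_eq_true i.2
      have := PPT.reduceHyb hk hm hℓ hr hχ (hlam.reindex Subtype.val) hA₀ hA₁ h
        (hX.reindex Subtype.val) (hu.reindex Subtype.val)
      convert this using 2 with i
      exact dif_pos (h i)
    · have h : ∀ i : {i : κ // decide (m i.1 ≤ N i.1) = false}, ¬m i.1.1 ≤ N i.1.1 := fun i =>
        of_decide_eq_false i.2
      have := PPT.coin (inp := fun i : {i : κ // decide (m i.1 ≤ N i.1) = false} => inp i)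
      convert this using 2 with i
      exact dif_neg (h i))
  obtain ⟨pm, hpm⟩ := hm.exists_le
  obtain ⟨pl, hpl⟩ := hℓ.exists_le
  refine ⟨_, (hnegl₁.add (hnegl₂.mul_of_le (c := fun lam => 2 * (m lam * ℓ lam) + 1)
    (p := 2 * (pm * pl) + 1) fun lam => ?_)).ite_of_eventually hk_pos, fun lam => ?_⟩
  · simp only [Polynomial.eval_add, Polynomial.eval_mul, Polynomial.eval_ofNat,
      Polynomial.eval_one]
    have := Nat.mul_le_mul (hpm lam) (hpl lam)
    omega
  have hnonneg := add_nonneg (hnegl₁.1 lam) (mul_nonneg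
    (Nat.cast_nonneg (α := ℝ) (2 * (m lam * ℓ lam) + 1)) (hnegl₂.1 lam))
  -- For the finitely many `lam` with `k lam = 0`, the trivial bound on the advantage is used.
  split_ifs with hk0
  · by_cases h : m lam ≤ N lam
    · have e₁ := h₁ lam
      have e₂ := h₂ lam
      rw [abs_lweExp_sub] at e₁ e₂
      simp only [dif_pos h] at e₂
      rw [bind_reduceB (A₀ lam) (A₁ lam) (χ lam) (fun X => lweVec (χ lam) X)
          (F := fun A B y => realEnc (χ lam) A B y) fun A X y => realEnc_binB _ A X y,
        bind_reduceB (A₀ lam) (A₁ lam) (χ lam) (fun _ => PMF.uniformOfFintype _)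
          (F := fun A _ y => ofCols (hybCol (χ lam) 0 A y))
          fun A X y => ofCols_hybCol_zero _ A y] at e₁
      have e₃ := abs_hybProb_sub_le (A₀ lam) (A₁ lam) (χ lam) h
      have e₄ : prTrue (game (A₀ lam) (A₁ lam) fun _ _ _ =>
          uniformMat (2 ^ r lam) (Fin (m lam)) (Fin (m lam) × Fin (ℓ lam))) =
          hybProb (A₀ lam) (A₁ lam) (χ lam) (m lam * ℓ lam) := by
        simp only [hybProb, ofCols_hybCol_last]
      have e₅ := mul_le_mul_of_nonneg_left e₂
        (Nat.cast_nonneg (α := ℝ) (2 * (m lam * ℓ lam) + 1))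
      rw [mul_div_assoc'] at e₅
      have e₆ := (div_le_div_of_nonneg_right e₃ zero_le_two).trans e₅
      have e₇ := abs_sub_le (hybProb (A₀ lam) (A₁ lam) (χ lam) (m lam * ℓ lam))
        (hybProb (A₀ lam) (A₁ lam) (χ lam) 0)
        (prTrue (game (A₀ lam) (A₁ lam) fun A B y => realEnc (χ lam) A B y))
      rw [e₄]
      simp only [hybProb] at e₁ e₆ e₇ ⊢
      linarith
    -- With `m lam > N lam` and `k lam > 0`, there is only one encoding, real or simulated.
    · have hsub : Subsingleton (Matrix (Fin (m lam)) (Fin (m lam) × Fin (ℓ lam))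
          (ZMod (2 ^ r lam))) := by
        rcases Nat.eq_zero_or_pos (ℓ lam) with hl | hl
        · have : IsEmpty (Fin (ℓ lam)) := by rw [hl]; infer_instance
          exact ⟨fun C D => by ext i c; exact isEmptyElim c.2⟩
        rcases Nat.eq_zero_or_pos (r lam) with hr0 | hr0
        · have : Subsingleton (ZMod (2 ^ r lam)) := by
            rw [hr0]
            exact inferInstanceAs (Subsingleton (ZMod 1))
          exact ⟨fun C D => by ext i c; exact Subsingleton.elim _ _⟩
        exact absurd ((Nat.le_mul_of_pos_right _ hl).trans
          (Nat.le_mul_of_pos_left _ (Nat.mul_pos hk0 hr0))) h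
      have e : (fun A B y => realEnc (K := k lam) (χ lam) A B y) = fun _ _ _ =>
          uniformMat (2 ^ r lam) (Fin (m lam)) (Fin (m lam) × Fin (ℓ lam)) := by
        funext A B y
        exact PMF.eq_of_subsingleton _ _
      rw [e, sub_self, abs_zero, zero_div]
      exact hnonneg
  · have h1 := prTrue_nonneg (game (A₀ lam) (A₁ lam) fun A B y => realEnc (χ lam) A B y)
    have h2 := prTrue_le_one (game (A₀ lam) (A₁ lam) fun A B y => realEnc (χ lam) A B y)
    have h3 := prTrue_nonneg (game (A₀ lam) (A₁ lam) fun _ _ _ =>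
      uniformMat (2 ^ r lam) (Fin (m lam)) (Fin (m lam) × Fin (ℓ lam)))
    have h4 := prTrue_le_one (game (A₀ lam) (A₁ lam) fun _ _ _ =>
      uniformMat (2 ^ r lam) (Fin (m lam)) (Fin (m lam) × Fin (ℓ lam)))
    rw [div_le_iff₀ two_pos, abs_le]
    constructor <;> linarith

end

end

theorem mainTheorem2 (χ : ℕ → PMF ℤ) (k m ℓ r : ℕ → ℕ)
    (hk : PolyTimeParam k) (hm : PolyTimeParam m) (hℓ : PolyTimeParam ℓ) (hr : PolyTimeParam r)
    (hk_pos : ∀ᶠ lam in Filter.atTop, 0 < k lam)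
    (hχ : EfficientlySamplable χ)
    (hLWE : LWEHard χ k (fun lam => k lam * r lam * (m lam * ℓ lam)) (fun lam => 2 ^ r lam)) :
    (HalfSuccinct.scheme χ k m ℓ r).EncoderPrivate := by
  refine ⟨fun lam _ => uniformMat (2 ^ r lam) (Fin (m lam)) (Fin (m lam) × Fin (ℓ lam)), ?_, ?_⟩
  · have hlam : PolyTime (fun i : Σ lam, (HalfSuccinct.scheme χ k m ℓ r).PK lam =>
      ToData.toData (Data.unary i.1, i.2)) (fun i => i.1) := IsPPT.self.head
    exact PPT.uniformMat_enc (hm.polyTime hlam) (hℓ.polyTime hlam) (hr.polyTime hlam)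
  · intro A₀ A₁ hA₀ hA₁
    obtain ⟨negl, hnegl, h⟩ := exists_negligible_advantage hk hm hℓ hr hk_pos hχ hLWE hA₀ hA₁
    exact ⟨negl, hnegl, fun lam => (abs_encExp_sub _ A₀ A₁ lam).trans_le (h lam)⟩
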